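/- Let $H$ be a separable complex Hilbert space with a complex conjugation $J$ (an antiunitary involution), and let $Q$ be an orthogonal projection on $H$ that commutes with $J$, of finite even rank $2n$, such that $Q^\perp=1-Q$ has infinite rank. The inner product is antilinear in its first argument. *The algebras.* Let $H_Q=H\oplus Q^\perp H$ with the conjugation $J_Q=R_Q(J\oplus Q^\perp J)$, where $R_Q(f\oplus h)=(Qf+h)\oplus Q^\perp f$. Let $\mathcal E$ be the selfdual CAR algebra over $(H_Q,J_Q)$, that is, the unital C*-algebra generated by operators $B(k)$, $k\in H_Q$, depending linearly on $k$, with $B(k)^*=B(J_Qk)$ and $B(k)B(l)+B(l)B(k)=\langle J_Qk,l\rangle 1$. Put $G(f)=B(f\oplus 0)$ for $f\in H$. The GAR algebra $\mathfrak A$ is the norm-closed unital subalgebra of $\mathcal E$ generated by all $G(f)$, $f\in H$; its Grassmann part $\Lambda$ is the norm-closed unital subalgebra generated by the $G(f)$ with $f\in Q^\perp H$; $\Lambda_1\subset\Lambda$ is the closed linear span of the products of an odd number of such $G(f)$. Let $\star$ be the continuous antilinear antimultiplicative involution of $\mathfrak A$ with $G(f)^\star=G(Jf)$. *Phase space.*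 Let $\Xi=QH\otimes\Lambda_1$. For $\xi\in\Xi$ define $\Phi(\xi)\in\mathfrak A$ linearly by $\Phi(f\otimes\lambda)=G(f)\lambda$, and put $w(\xi)=\exp\Phi(\xi)$ and $\alpha_\xi(A)=w(-\xi)\,A\,w(\xi)$ for $A\in\mathfrak A$. Let $\langle f\otimes\lambda,h\otimes\mu\rangle_Q=\langle f,h\rangle\lambda^\star\mu$ (sesquilinearly extended to $QH\otimes\Lambda$), $\xi_u=\langle u\otimes 1,\xi\rangle_Q$ for $u\in QH$, and $(f\otimes\lambda)^\star=Jf\otimes\lambda^\star$ for $\lambda\in\Lambda_1$, extended antilinearly to $\Xi$. *G-holomorphic functions and integral.* A function $F:\Xi\to\Lambda$ is G-holomorphic if it is a linear combination of functions $\xi\mapsto X\,\xi_{u_1}\cdots\xi_{u_k}$ with $X\in\Lambda$, $u_1,\dots,u_k\in QH$. With respect to an orthonormal basis $e^1,\dots,e^{2n}$ of $QH$ with $Je^i=e^i$ such a function has the form $F(\xi)=\sum_{I\subset N}F^I\xi_I$, $N=\{1,\dots,2n\}$, where $F^I\in\Lambda$ and $\xi_I=\xi_{e^{i_1}}\cdots\xi_{e^{i_k}}$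 for $I=\{i_1<\dots<i_k\}$. For a form $v=v_N\,e^1\wedge\dots\wedge e^{2n}$ of highest degree in the Grassmann algebra over $QH$ the Grassmann integral is $\int_Q v\,F=\int_Q v(\xi)\,F(\xi)=v_NF^N$; it does not depend on the choices. Fix such a form $v$ that is normalized ($|v_N|=1$) and selfadjoint ($v^\star=v$, where $\star$ is the antilinear antimultiplicative involution that extends $J|_{QH}$). *Fourier transforms.* A bounded right module homomorphism is a bounded linear map $\boldsymbol\varphi:\mathfrak A\to\Lambda$ with $\boldsymbol\varphi(A\lambda)=\boldsymbol\varphi(A)\lambda$ for $A\in\mathfrak A$, $\lambda\in\Lambda$. For such $\boldsymbol\varphi$ and $A\in\mathfrak A$ put $$(\mathcal F\boldsymbol\varphi)(\xi)=\boldsymbol\varphi(w(\xi)),\qquad (\boldsymbol\varphi*A)(\xi)=\boldsymbol\varphi(\alpha_\xi(A)),$$ and for a G-holomorphic function $f$ put $$(\mathcal Ff)(\xi)=\int_Q v(\eta)\,f(\eta)\,e^{\langle\xi^\star,\eta\rangle_Q}.$$ **Corollary.** Let $\boldsymbol\omega,\boldsymbol\varphi$ be bounded right module homomorphisms, and suppose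 that $\mathcal F\boldsymbol\varphi$ divides $\mathcal F\boldsymbol\omega$ in the ring of G-holomorphic functions with values in $\Lambda$, in the sense that $\mathcal F\boldsymbol\omega=q\cdot\mathcal F\boldsymbol\varphi$ for a G-holomorphic function $q=\frac{\mathcal F\boldsymbol\omega}{\mathcal F\boldsymbol\varphi}$. Then for every such $q$ and all $A\in\mathfrak A$ all functions involved, namely $\mathcal F\boldsymbol\omega$, $\mathcal F\boldsymbol\varphi$, the functions $\eta\mapsto(\boldsymbol\varphi*A)(\eta)\,e^{\langle\xi^\star,\eta\rangle_Q}$ for $\xi\in\Xi$, $\mathcal F(\boldsymbol\varphi*A)$ and $q\cdot\mathcal F(\boldsymbol\varphi*A)$, are G-holomorphic, and $$\boldsymbol\omega(A)=\int_Q v\;q\cdot\mathcal F(\boldsymbol\varphi*A)=\int_Q v\;\frac{\mathcal F\boldsymbol\omega}{\mathcal F\boldsymbol\varphi}\;\mathcal F(\boldsymbol\varphi*A).$$ -/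

import Mathlib

open scoped TensorProduct ComplexConjugate InnerProductSpace ENNReal lp

noncomputable section

namespace GARAlgebra

/-! ### Complex conjugations and the selfdual CAR algebra -/

/-- A complex conjugation on a complex inner product space: an antiunitary involution. -/
structure Conjugation (K : Type*) [NormedAddCommGroup K] [InnerProductSpace ℂ K]
    extends K →ₗ⋆[ℂ] K where
  involutive' : ∀ f, toFun (toFun f) = f
  inner_map' : ∀ f h, ⟪toFun f, toFun h⟫_ℂ = ⟪h, f⟫_ℂ

instance {K : Type*} [NormedAddCommGroup K] [InnerProductSpace ℂ K] :
    CoeFun (Conjugation K) (fun _ => K → K) := ⟨fun J => J.toFun⟩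

/-- The separable Hilbert space `ℓ²(ℕ)`. -/
abbrev SepHilbert : Type := ℓ²(ℕ, ℂ)

instance : Nontrivial SepHilbert :=
  ⟨⟨lp.single 2 (0 : ℕ) (1 : ℂ), 0, fun h => by
    have h1 := congrArg (fun x : SepHilbert => x 0) h
    simp at h1⟩⟩

section CAR

variable {K : Type*} [NormedAddCommGroup K] [InnerProductSpace ℂ K]

/-- A representation of the selfdual canonical anticommutation relations over `(K, J)` by bounded
operators on `ℓ²(ℕ)`: a complex linear map `f ↦ π(f)` with `π(f)* = π(J f)` and
`{π(f), π(h)} = ⟨J f, h⟩ 1`. -/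
structure CARRep (J : Conjugation K) where
  field : K →ₗ[ℂ] (SepHilbert →L[ℂ] SepHilbert)
  star_field : ∀ f, star (field f) = field (J f)
  anticomm : ∀ f h, field f * field h + field h * field f =
    ⟪J f, h⟫_ℂ • (1 : SepHilbert →L[ℂ] SepHilbert)

theorem CARRep.norm_field_le {J : Conjugation K} (π : CARRep J) (f : K) : ‖π.field f‖ ≤ ‖f‖ := by
  refine ContinuousLinearMap.opNorm_le_bound _ (norm_nonneg _) fun x => ?_
  have h := π.anticomm (J f) f
  rw [← π.star_field, J.involutive' f, ContinuousLinearMap.star_eq_adjoint] at h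
  have h1 := congrArg (fun T : SepHilbert →L[ℂ] SepHilbert => ⟪x, T x⟫_ℂ) h
  change ⟪x, ContinuousLinearMap.adjoint (π.field f) (π.field f x)
    + π.field f (ContinuousLinearMap.adjoint (π.field f) x)⟫_ℂ = ⟪x, ⟪f, f⟫_ℂ • x⟫_ℂ at h1
  have h3 := ContinuousLinearMap.adjoint_inner_right (π.field f) x (π.field f x)
  have h4 := ContinuousLinearMap.adjoint_inner_left (π.field f)
    (ContinuousLinearMap.adjoint (π.field f) x) x
  rw [inner_add_right, h3, ← h4, inner_smul_right, inner_self_eq_norm_sq_to_K,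
    inner_self_eq_norm_sq_to_K, inner_self_eq_norm_sq_to_K, inner_self_eq_norm_sq_to_K] at h1
  have h2 : ‖π.field f x‖ ^ 2 + ‖(ContinuousLinearMap.adjoint (π.field f)) x‖ ^ 2
      = ‖f‖ ^ 2 * ‖x‖ ^ 2 := by exact_mod_cast h1
  refine abs_le_of_sq_le_sq' ?_ (by positivity) |>.2
  nlinarith [sq_nonneg ‖(ContinuousLinearMap.adjoint (π.field f)) x‖]

/-- The C*-algebra of all uniformly bounded families of operators on `ℓ²(ℕ)` that are indexed by the
representations of the canonical anticommutation relations over `(K, J)`. -/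
def Ambient (J : Conjugation K) : Type _ :=
  lp (fun _ : CARRep J => SepHilbert →L[ℂ] SepHilbert) ∞

/-- The C*-algebra structure of the algebra of bounded families, with the supremum norm. -/
def ambientCStarAlgebra (J : Conjugation K) : CStarAlgebra (Ambient J) where
  toNormedRing := lp.inftyNormedRing (B := fun _ : CARRep J => SepHilbert →L[ℂ] SepHilbert)
  toStarRing := lp.inftyStarRing (B := fun _ : CARRep J => SepHilbert →L[ℂ] SepHilbert)
  toCompleteSpace := lp.completeSpace (E := fun _ : CARRep J => SepHilbert →L[ℂ] SepHilbert)
  toCStarRing := lp.inftyCStarRing (B := fun _ : CARRep J => SepHilbert →L[ℂ] SepHilbert)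
  toNormedAlgebra := lp.inftyNormedAlgebra (B := fun _ : CARRep J => SepHilbert →L[ℂ] SepHilbert)
  toStarModule := inferInstanceAs
    (StarModule ℂ (lp (fun _ : CARRep J => SepHilbert →L[ℂ] SepHilbert) ∞))

instance (J : Conjugation K) : CStarAlgebra (Ambient J) := ambientCStarAlgebra J

/-- The universal field operator: the family `(π(f))_π`. -/
def ambientField (J : Conjugation K) : K →ₗ[ℂ] Ambient J where
  toFun f := ⟨fun π => π.field f, memℓp_infty ⟨‖f‖, by
    rintro _ ⟨π, rfl⟩; exact π.norm_field_le f⟩⟩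
  map_add' f h := Subtype.ext (funext fun π => π.field.map_add f h)
  map_smul' c f := Subtype.ext (funext fun π => π.field.map_smul c f)

/-- The closed *-subalgebra of the ambient algebra that is generated by the universal field
operators. -/
def carSubalgebra (J : Conjugation K) : StarSubalgebra ℂ (Ambient J) :=
  (StarAlgebra.adjoin ℂ (Set.range (ambientField J))).topologicalClosure

/-- The selfdual CAR algebra over `(K, J)`: the C*-algebra that is generated by the field operators
in their universal representation. (For separable `K`, every representation of the relations is, up to
multiplicity, a direct sum of representations on separable Hilbert spaces, so that this is the
universal C*-algebra of the relations.) -/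
def CAR (J : Conjugation K) : Type _ := carSubalgebra J

instance (J : Conjugation K) : IsClosed (carSubalgebra J : Set (Ambient J)) :=
  StarSubalgebra.isClosed_topologicalClosure _

instance (J : Conjugation K) : CStarAlgebra (CAR J) :=
  inferInstanceAs (CStarAlgebra (carSubalgebra J))

theorem ambientField_mem (J : Conjugation K) (f : K) : ambientField J f ∈ carSubalgebra J :=
  StarSubalgebra.le_topologicalClosure _ (StarAlgebra.subset_adjoin ℂ _ ⟨f, rfl⟩)

/-- The Fermi field operators `B(f)` of the selfdual CAR algebra. -/
def B (J : Conjugation K) : K →ₗ[ℂ] CAR J where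
  toFun f := ⟨ambientField J f, ambientField_mem J f⟩
  map_add' f h := Subtype.ext ((ambientField J).map_add f h)
  map_smul' c f := Subtype.ext ((ambientField J).map_smul c f)

theorem star_B (J : Conjugation K) (f : K) : star (B J f) = B J (J f) :=
  Subtype.ext (Subtype.ext (funext fun π => π.star_field f))

theorem B_anticomm (J : Conjugation K) (f h : K) :
    B J f * B J h + B J h * B J f = ⟪J f, h⟫_ℂ • (1 : CAR J) :=
  Subtype.ext (Subtype.ext (funext fun π => π.anticomm f h))

/-! Bogoliubov automorphisms: an isometry `U` commuting with `J` induces `B(f) ↦ B(U f)`. -/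

/-- The representation `f ↦ π(U f)`. -/
def CARRep.comp {J : Conjugation K} (π : CARRep J) (U : K →ₗ[ℂ] K) (hJ : ∀ f, U (J f) = J (U f))
    (hU : ∀ f h, ⟪U f, U h⟫_ℂ = ⟪f, h⟫_ℂ) : CARRep J where
  field := π.field ∘ₗ U
  star_field f := by simp only [LinearMap.comp_apply, π.star_field, hJ]
  anticomm f h := by simp only [LinearMap.comp_apply, π.anticomm, ← hJ, hU]

/-- The action of the Bogoliubov automorphism on families of operators. -/
def ambientBogoliubov {J : Conjugation K} (U : K →ₗ[ℂ] K) (hJ : ∀ f, U (J f) = J (U f))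
    (hU : ∀ f h, ⟪U f, U h⟫_ℂ = ⟪f, h⟫_ℂ) : Ambient J →⋆ₐ[ℂ] Ambient J where
  toFun a := ⟨fun π => a.1 (π.comp U hJ hU), memℓp_infty ⟨‖a‖, by
    rintro _ ⟨π, rfl⟩; exact lp.norm_apply_le_norm ENNReal.top_ne_zero a _⟩⟩
  map_one' := rfl
  map_mul' _ _ := rfl
  map_zero' := rfl
  map_add' _ _ := rfl
  commutes' _ := rfl
  map_star' _ := rfl

theorem ambientBogoliubov_norm_le {J : Conjugation K} (U : K →ₗ[ℂ] K)
    (hJ : ∀ f, U (J f) = J (U f)) (hU : ∀ f h, ⟪U f, U h⟫_ℂ = ⟪f, h⟫_ℂ) (a : Ambient J) :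
    ‖ambientBogoliubov U hJ hU a‖ ≤ ‖a‖ :=
  lp.norm_le_of_forall_le (norm_nonneg _) fun _ => lp.norm_apply_le_norm ENNReal.top_ne_zero a _

theorem ambientBogoliubov_mem {J : Conjugation K} (U : K →ₗ[ℂ] K)
    (hJ : ∀ f, U (J f) = J (U f)) (hU : ∀ f h, ⟪U f, U h⟫_ℂ = ⟪f, h⟫_ℂ) (a : Ambient J)
    (ha : a ∈ carSubalgebra J) : ambientBogoliubov U hJ hU a ∈ carSubalgebra J := by
  have hc : Continuous (ambientBogoliubov U hJ hU) :=
    AddMonoidHomClass.continuous_of_bound _ 1 fun a => by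
      simpa using ambientBogoliubov_norm_le U hJ hU a
  have hle : StarAlgebra.adjoin ℂ (Set.range (ambientField J)) ≤
      (StarAlgebra.adjoin ℂ (Set.range (ambientField J))).comap (ambientBogoliubov U hJ hU) := by
    refine StarAlgebra.adjoin_le ?_
    rintro _ ⟨f, rfl⟩
    exact StarAlgebra.subset_adjoin ℂ _ ⟨U f, rfl⟩
  have ha' : a ∈ closure (StarAlgebra.adjoin ℂ (Set.range (ambientField J)) : Set (Ambient J)) := ha
  exact map_mem_closure hc ha' fun x hx => hle hx

/-- The Bogoliubov automorphism of the CAR algebra induced by `U`. -/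
def bogoliubov {J : Conjugation K} (U : K →ₗ[ℂ] K) (hJ : ∀ f, U (J f) = J (U f))
    (hU : ∀ f h, ⟪U f, U h⟫_ℂ = ⟪f, h⟫_ℂ) : CAR J →⋆ₐ[ℂ] CAR J :=
  ((ambientBogoliubov U hJ hU).comp (carSubalgebra J).subtype).codRestrict (carSubalgebra J)
    fun a => ambientBogoliubov_mem U hJ hU a a.2

theorem bogoliubov_B {J : Conjugation K} (U : K →ₗ[ℂ] K) (hJ : ∀ f, U (J f) = J (U f))
    (hU : ∀ f h, ⟪U f, U h⟫_ℂ = ⟪f, h⟫_ℂ) (f : K) : bogoliubov U hJ hU (B J f) = B J (U f) := rfl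

theorem continuous_bogoliubov {J : Conjugation K} (U : K →ₗ[ℂ] K) (hJ : ∀ f, U (J f) = J (U f))
    (hU : ∀ f h, ⟪U f, U h⟫_ℂ = ⟪f, h⟫_ℂ) : Continuous (bogoliubov U hJ hU) :=
  AddMonoidHomClass.continuous_of_bound _ 1 fun a => by
    rw [one_mul]; exact ambientBogoliubov_norm_le U hJ hU a.1

end CAR

/-! ### The GAR algebra -/

/-- A complex conjugation `J` together with an orthogonal projection `Q` that commutes with it. -/
structure Triple (H : Type*) [NormedAddCommGroup H] [InnerProductSpace ℂ H] [CompleteSpace H] where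
  J : Conjugation H
  Q : H →L[ℂ] H
  isProj : IsStarProjection Q
  comm : ∀ f, Q (J f) = J (Q f)

namespace Triple

variable {H : Type*} [NormedAddCommGroup H] [InnerProductSpace ℂ H] [CompleteSpace H]
variable (D : Triple H)

/-- The range `Q H`. -/
def ran : Submodule ℂ H := LinearMap.range (D.Q : H →ₗ[ℂ] H)

/-- The range `Q⊥ H` of the complementary projection `Q⊥ = 1 - Q`. -/
def perp : Submodule ℂ H := LinearMap.range ((1 - D.Q : H →L[ℂ] H) : H →ₗ[ℂ] H)

theorem Q_Q (f : H) : D.Q (D.Q f) = D.Q f :=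
  congrArg (fun T : H →L[ℂ] H => T f) D.isProj.isIdempotentElem

theorem inner_Q_left (f h : H) : ⟪D.Q f, h⟫_ℂ = ⟪f, D.Q h⟫_ℂ := by
  have h1 : ContinuousLinearMap.adjoint D.Q = D.Q := D.isProj.isSelfAdjoint
  rw [← ContinuousLinearMap.adjoint_inner_left, h1]

theorem mem_ran {f : H} : f ∈ D.ran ↔ D.Q f = f :=
  ⟨by rintro ⟨g, rfl⟩; exact D.Q_Q g, fun h => ⟨f, h⟩⟩

theorem mem_perp {f : H} : f ∈ D.perp ↔ D.Q f = 0 := by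
  constructor
  · rintro ⟨g, rfl⟩
    simp [D.Q_Q]
  · intro h
    exact ⟨f, by simp [h]⟩

theorem J_mem_ran {f : H} (hf : f ∈ D.ran) : D.J f ∈ D.ran := by
  rw [mem_ran] at *; rw [D.comm, hf]

theorem J_mem_perp {f : H} (hf : f ∈ D.perp) : D.J f ∈ D.perp := by
  rw [mem_perp] at *; rw [D.comm, hf]; exact D.J.map_zero

instance : CompleteSpace D.ran :=
  (ContinuousLinearMap.IsIdempotentElem.isClosed_range
    D.isProj.isIdempotentElem).completeSpace_coe

/-- The restriction `QJ` of `J` to `Q H`. -/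
def Jran : Conjugation D.ran where
  toFun f := ⟨D.J f, D.J_mem_ran f.2⟩
  map_add' _ _ := Subtype.ext (D.J.map_add _ _)
  map_smul' _ _ := Subtype.ext (D.J.map_smulₛₗ _ _)
  involutive' _ := Subtype.ext (D.J.involutive' _)
  inner_map' _ _ := D.J.inner_map' _ _

/-- The projection `Q⊥ f` of `f` as an element of `Q⊥ H`. -/
def toPerp : H →ₗ[ℂ] D.perp :=
  LinearMap.codRestrict D.perp ((1 - D.Q : H →L[ℂ] H) : H →ₗ[ℂ] H) fun f => ⟨f, rfl⟩

theorem coe_toPerp (f : H) : (D.toPerp f : H) = f - D.Q f := rfl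

/-- The Hilbert space `H_Q = H ⊕ Q⊥ H`. -/
abbrev HQ : Type _ := WithLp 2 (H × D.perp)

/-- The reflection `R_Q (f ⊕ h) = (Q f + h) ⊕ Q⊥ f`. -/
def refl : D.HQ →ₗ[ℂ] D.HQ where
  toFun x := WithLp.toLp 2 (D.Q x.fst + (x.snd : H), D.toPerp x.fst)
  map_add' x y := by
    apply (WithLp.equiv 2 _).injective
    refine Prod.ext ?_ (D.toPerp.map_add _ _)
    simp [add_add_add_comm]
  map_smul' c x := by
    apply (WithLp.equiv 2 _).injective
    refine Prod.ext ?_ (D.toPerp.map_smul _ _)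
    simp

theorem refl_inner (x y : D.HQ) : ⟪D.refl x, D.refl y⟫_ℂ = ⟪x, y⟫_ℂ := by
  have hx : D.Q (x.snd : H) = 0 := D.mem_perp.1 x.snd.2
  have hy : D.Q (y.snd : H) = 0 := D.mem_perp.1 y.snd.2
  have e1 : ⟪D.Q x.fst, (y.snd : H)⟫_ℂ = 0 := by rw [D.inner_Q_left, hy, inner_zero_right]
  have e2 : ⟪(x.snd : H), D.Q y.fst⟫_ℂ = 0 := by rw [← D.inner_Q_left, hx, inner_zero_left]
  have e3 : ⟪D.Q x.fst, D.Q y.fst⟫_ℂ = ⟪x.fst, D.Q y.fst⟫_ℂ := by rw [D.inner_Q_left, D.Q_Q]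
  have e4 : ⟪D.Q x.fst, y.fst⟫_ℂ = ⟪x.fst, D.Q y.fst⟫_ℂ := D.inner_Q_left _ _
  change ⟪D.Q x.fst + (x.snd : H), D.Q y.fst + (y.snd : H)⟫_ℂ
    + ⟪x.fst - D.Q x.fst, y.fst - D.Q y.fst⟫_ℂ = ⟪x.fst, y.fst⟫_ℂ + ⟪(x.snd : H), (y.snd : H)⟫_ℂ
  simp only [inner_add_left, inner_add_right, inner_sub_left, inner_sub_right]
  rw [e1, e2, e3, e4]
  ring

/-- The conjugation `J ⊕ Q⊥ J` of `H ⊕ Q⊥ H`. -/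
def sumJ (x : D.HQ) : D.HQ :=
  WithLp.toLp 2 (D.J x.fst, ⟨D.J (x.snd : H), D.J_mem_perp x.snd.2⟩)

theorem refl_refl (x : D.HQ) : D.refl (D.refl x) = x := by
  have hx : D.Q (x.snd : H) = 0 := D.mem_perp.1 x.snd.2
  apply (WithLp.equiv 2 _).injective
  refine Prod.ext ?_ (Subtype.ext ?_)
  · change D.Q (D.Q x.fst + (x.snd : H)) + (x.fst - D.Q x.fst) = x.fst
    rw [map_add, D.Q_Q, hx]; abel
  · change D.Q x.fst + (x.snd : H) - D.Q (D.Q x.fst + (x.snd : H)) = x.snd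
    rw [map_add, D.Q_Q, hx]; abel

theorem refl_sumJ (x : D.HQ) : D.refl (D.sumJ x) = D.sumJ (D.refl x) := by
  apply (WithLp.equiv 2 _).injective
  refine Prod.ext ?_ (Subtype.ext ?_)
  · change D.Q (D.J x.fst) + D.J (x.snd : H) = D.J (D.Q x.fst + (x.snd : H))
    rw [D.comm]; exact (D.J.map_add _ _).symm
  · change D.J x.fst - D.Q (D.J x.fst) = D.J (x.fst - D.Q x.fst)
    rw [D.comm]
    exact (map_sub D.J.toLinearMap _ _).symm

/-- The complex conjugation `J_Q = R_Q (J ⊕ Q⊥ J)` of `H_Q`. -/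
def JQ : Conjugation D.HQ where
  toFun x := D.refl (D.sumJ x)
  map_add' x y := by
    rw [← map_add]
    congr 1
    apply (WithLp.equiv 2 _).injective
    exact Prod.ext (D.J.map_add _ _) (Subtype.ext (D.J.map_add _ _))
  map_smul' c x := by
    rw [← map_smul]
    congr 1
    apply (WithLp.equiv 2 _).injective
    exact Prod.ext (D.J.map_smulₛₗ _ _) (Subtype.ext (D.J.map_smulₛₗ _ _))
  involutive' x := by
    rw [← refl_sumJ, refl_refl]
    apply (WithLp.equiv 2 _).injective
    exact Prod.ext (D.J.involutive' _) (Subtype.ext (D.J.involutive' _))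
  inner_map' x y := by
    rw [refl_inner]
    simp only [WithLp.prod_inner_apply, sumJ, Submodule.coe_inner]
    exact congrArg₂ (· + ·) (D.J.inner_map' _ _) (D.J.inner_map' _ _)

/-- The enveloping CAR algebra of the GAR algebra. -/
abbrev Env : Type _ := CAR D.JQ

/-- The Grassmann-Fermi field operators `G(f) = B(f ⊕ 0)`. -/
def G : H →ₗ[ℂ] D.Env where
  toFun f := B D.JQ (WithLp.toLp 2 (f, 0))
  map_add' f h := by
    rw [← map_add]; congr 1
    apply (WithLp.equiv 2 _).injective; exact Prod.ext rfl (by simp)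
  map_smul' c f := by
    rw [RingHom.id_apply, ← map_smul]; congr 1
    apply (WithLp.equiv 2 _).injective; exact Prod.ext rfl (by simp)

/-- The GAR algebra: the norm-closed unital subalgebra generated by the operators `G(f)`. -/
def GAR : Subalgebra ℂ D.Env := (Algebra.adjoin ℂ (Set.range D.G)).topologicalClosure

/-- The Grassmann part of the GAR algebra: the norm-closed unital subalgebra generated by the
operators `G(f)` with `f ∈ Q⊥ H`. -/
def Gr : Subalgebra ℂ D.Env := (Algebra.adjoin ℂ (D.G '' D.perp)).topologicalClosure

theorem G_mem_GAR (f : H) : D.G f ∈ D.GAR :=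
  Subalgebra.le_topologicalClosure _ (Algebra.subset_adjoin ⟨f, rfl⟩)

theorem G_mem_Gr (f : D.perp) : D.G (f : H) ∈ D.Gr :=
  Subalgebra.le_topologicalClosure _ (Algebra.subset_adjoin ⟨f, f.2, rfl⟩)

theorem Gr_le_GAR : D.Gr ≤ D.GAR :=
  Subalgebra.topologicalClosure_mono (Algebra.adjoin_mono (Set.image_subset_range _ _))

/-- The inclusion of the Grassmann part into the GAR algebra. -/
def incl : D.Gr →ₐ[ℂ] D.GAR := Subalgebra.inclusion D.Gr_le_GAR

/-- The odd part `Gr₁` of the Grassmann part: the closed linear span of the products of an odd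
number of operators `G(f)`, `f ∈ Q⊥ H`. -/
def GrOdd : Submodule ℂ D.Gr :=
  (Submodule.span ℂ {x : D.Gr | ∃ l : List D.perp, Odd l.length ∧
    x = (l.map fun f : D.perp => (⟨D.G (f : H), D.G_mem_Gr f⟩ : D.Gr)).prod}).topologicalClosure

theorem refl_JQ (x : D.HQ) : D.refl (D.JQ x) = D.JQ (D.refl x) :=
  congrArg D.refl (D.refl_sumJ x)

/-- The adjoint `⋆` with `G(f)⋆ = G(J f)`: the C*-adjoint of the enveloping CAR algebra, followed by
the Bogoliubov automorphism of the reflection `R_Q`. -/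
def adj : D.Env →ₗ⋆[ℂ] D.Env where
  toFun a := bogoliubov D.refl D.refl_JQ D.refl_inner (star a)
  map_add' a b := by rw [star_add, map_add]
  map_smul' c a := by rw [star_smul, map_smul]; rfl

theorem adj_mul (a b : D.Env) : D.adj (a * b) = D.adj b * D.adj a := by
  change bogoliubov _ _ _ (star (a * b)) = bogoliubov _ _ _ (star b) * bogoliubov _ _ _ (star a)
  rw [star_mul, map_mul]

theorem adj_G (f : H) : D.adj (D.G f) = D.G (D.J f) := by
  change bogoliubov D.refl D.refl_JQ D.refl_inner (star (B D.JQ _)) = B D.JQ _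
  rw [star_B, bogoliubov_B]
  congr 1
  change D.refl (D.refl (D.sumJ _)) = _
  rw [refl_refl]
  apply (WithLp.equiv 2 _).injective
  exact Prod.ext rfl (Subtype.ext D.J.map_zero)

theorem continuous_adj : Continuous D.adj :=
  (continuous_bogoliubov D.refl D.refl_JQ D.refl_inner).comp continuous_star

theorem adj_mem_Gr {a : D.Env} (ha : a ∈ D.Gr) : D.adj a ∈ D.Gr := by
  have ha' : a ∈ closure (Algebra.adjoin ℂ (D.G '' D.perp) : Set D.Env) := ha
  refine map_mem_closure D.continuous_adj ha' fun x hx => ?_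
  rw [SetLike.mem_coe] at hx ⊢
  induction hx using Algebra.adjoin_induction with
  | mem x hx =>
    obtain ⟨f, hf, rfl⟩ := hx
    rw [adj_G]
    exact Algebra.subset_adjoin ⟨D.J f, D.J_mem_perp hf, rfl⟩
  | algebraMap c =>
    have : D.adj (algebraMap ℂ D.Env c) = algebraMap ℂ D.Env (conj c) := by
      change bogoliubov D.refl D.refl_JQ D.refl_inner (star (algebraMap ℂ D.Env c)) = _
      rw [← algebraMap_star_comm]
      exact AlgHomClass.commutes _ _
    rw [this]
    exact Subalgebra.algebraMap_mem _ _
  | add x y _ _ hx hy => rw [map_add]; exact add_mem hx hy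
  | mul x y _ _ hx hy => rw [adj_mul]; exact mul_mem hy hx

/-- The adjoint `⋆` of the Grassmann part. -/
def adjGr : D.Gr →ₗ⋆[ℂ] D.Gr where
  toFun a := ⟨D.adj a, D.adj_mem_Gr a.2⟩
  map_add' _ _ := Subtype.ext (D.adj.map_add _ _)
  map_smul' _ _ := Subtype.ext (D.adj.map_smulₛₗ _ _)

/-! ### Anticommutative phase space -/

/-- The anticommutative phase space `QH ⊗ Gr`. (If `Q` has finite rank, the algebraic tensor product
is already complete with respect to the projective cross norm.) -/
abbrev Phase : Type _ := D.ran ⊗[ℂ] D.Gr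

/-- The even part `QH ⊗ Gr₁` of the phase space. -/
def PhaseEven : Submodule ℂ D.Phase :=
  LinearMap.range (TensorProduct.map (LinearMap.id : D.ran →ₗ[ℂ] D.ran) D.GrOdd.subtype)

/-- The Grassmann valued rigging map `⟨f ⊗ l, h ⊗ m⟩_Q = ⟨f, h⟩ l⋆ m`. -/
def rigging : D.Phase →ₗ⋆[ℂ] D.Phase →ₗ[ℂ] D.Gr :=
  TensorProduct.lift <| LinearMap.mk₂'ₛₗ (starRingEnd ℂ) (starRingEnd ℂ)
    (fun (f : D.ran) (l : D.Gr) => TensorProduct.lift <|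
      LinearMap.mk₂ ℂ (fun (h : D.ran) (m : D.Gr) => ⟪f, h⟫_ℂ • (D.adjGr l * m))
        (fun h h' m => by rw [inner_add_right, add_smul])
        (fun c h m => by rw [inner_smul_right, mul_smul])
        (fun h m m' => by rw [mul_add, smul_add])
        (fun c h m => by rw [mul_smul_comm, smul_comm]))
    (fun f f' l => TensorProduct.ext' fun h m => by
      simp [add_smul])
    (fun c f l => TensorProduct.ext' fun h m => by
      simpa [mul_smul] using smul_comm _ _ _)
    (fun f l l' => TensorProduct.ext' fun h m => by
      simp [add_mul])
    (fun c f l => TensorProduct.ext' fun h m => by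
      simpa using smul_comm _ _ _)

theorem rigging_tmul (f h : D.ran) (l m : D.Gr) :
    D.rigging (f ⊗ₜ l) (h ⊗ₜ m) = ⟪f, h⟫_ℂ • (D.adjGr l * m) := by
  simp [rigging]

/-- The complex conjugation of even phase space vectors, `(f ⊗ l)⋆ = J f ⊗ l⋆` for odd `l`. -/
def phaseConj : D.PhaseEven →ₗ⋆[ℂ] D.Phase :=
  (TensorProduct.map D.Jran.toLinearMap D.adjGr).comp D.PhaseEven.subtype

/-- The component `ξ_u = ⟨u ⊗ 1, ξ⟩_Q` of a phase space vector, `u ∈ QH`. -/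
def comp (u : D.ran) (ξ : D.Phase) : D.Gr := D.rigging (u ⊗ₜ 1) ξ

/-- The Grassmann-Bose field `Φ(f ⊗ l) = G(f) l`. -/
def Phi : D.Phase →ₗ[ℂ] D.GAR :=
  TensorProduct.lift <| LinearMap.mk₂ ℂ
    (fun (f : D.ran) (l : D.Gr) => (⟨D.G f, D.G_mem_GAR f⟩ : D.GAR) * D.incl l)
    (fun f f' l => by rw [← add_mul]; congr 1; exact Subtype.ext (D.G.map_add _ _))
    (fun c f l => by rw [← smul_mul_assoc]; congr 1; exact Subtype.ext (D.G.map_smul _ _))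
    (fun f l l' => by rw [map_add, mul_add])
    (fun c f l => by rw [map_smul, mul_smul_comm])

/-- The Grassmann-Weyl operators `w(ξ) = exp(Φ(ξ))`. -/
def weyl (ξ : D.PhaseEven) : D.GAR := NormedSpace.exp (D.Phi ξ)

/-- The phase space translations `α_ξ(A) = w(-ξ) A w(ξ)`. -/
def translate (ξ : D.PhaseEven) (A : D.GAR) : D.GAR := D.weyl (-ξ) * A * D.weyl ξ

/-! ### G-holomorphic functions and the Grassmann integral -/

/-- Functions on the even part of the phase space with values in the Grassmann part form a ring with
pointwise operations. -/
abbrev Fun : Type _ := D.PhaseEven → D.Gr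

/-- A function is G-holomorphic if it is a linear combination of monomial functions
`ξ ↦ X ξ_{u₁} ⋯ ξ_{uₖ}` with a coefficient `X` in the Grassmann part and `u₁, …, uₖ ∈ QH`. -/
def IsGHolomorphic (F : D.Fun) : Prop :=
  F ∈ Submodule.span ℂ {M : D.Fun | ∃ (X : D.Gr) (l : List D.ran),
    M = fun ξ : D.PhaseEven => X * (l.map fun u => D.comp u ξ).prod}

/-- An orthonormal basis `(eⁱ)` of `QH` is real if `J eⁱ = eⁱ`. -/
def IsRealBasis {N : ℕ} (e : OrthonormalBasis (Fin N) ℂ D.ran) : Prop := ∀ i, D.Jran (e i) = e i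

/-- The ordered monomial `ξ_I = ξ_{i₁} ⋯ ξ_{iₖ}` for `I = {i₁ < ⋯ < iₖ}`. -/
def monomial {N : ℕ} (e : OrthonormalBasis (Fin N) ℂ D.ran) (I : Finset (Fin N))
    (ξ : D.PhaseEven) : D.Gr :=
  (I.sort.map fun i => D.comp (e i) ξ).prod

/-- The triple `(QH, QJ, 0)`. -/
def grassmann : Triple D.ran where
  J := D.Jran
  Q := 0
  isProj := ⟨mul_zero _, star_zero _⟩
  comm _ := D.Jran.map_zero.symm

/-- The Grassmann algebra over `(QH, QJ)`, that is, the GAR algebra of `(QH, QJ, 0)`. -/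
abbrev Forms : Type _ := D.grassmann.GAR

/-- The form `e¹ ∧ ⋯ ∧ eᴺ = Λ(e¹) ⋯ Λ(eᴺ)`. -/
def wedge {N : ℕ} (e : OrthonormalBasis (Fin N) ℂ D.ran) : D.Forms :=
  (List.ofFn fun i => (⟨D.grassmann.G (e i), D.grassmann.G_mem_GAR (e i)⟩ : D.Forms)).prod

/-- `v` is a form of highest degree: `v Λ(h) = 0` for all `h ∈ QH`. -/
def IsTopForm (v : D.Forms) : Prop := ∀ h : D.ran, (v : D.grassmann.Env) * D.grassmann.G h = 0

/-- A form `v` of highest degree is selfadjoint if `v⋆ = v`. -/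
def IsSelfadjointForm (v : D.Forms) : Prop := D.grassmann.adj v = v

/-- A form `v` of highest degree is normalized if `⟨v, v⟩ = 1` in the antisymmetric Fock space over
`QH`, that is, `v` is a multiple `c e¹ ∧ ⋯ ∧ eᴺ` with `|c| = 1` of the unit vector
`e¹ ∧ ⋯ ∧ eᴺ` given by some orthonormal basis of `QH`. -/
def IsNormalizedForm (v : D.Forms) : Prop :=
  ∃ (e : OrthonormalBasis (Fin (Module.finrank ℂ D.ran)) ℂ D.ran) (c : ℂ),
    ‖c‖ = 1 ∧ v = c • D.wedge e

/-- `X` is a value of the Grassmann integral of `F` over the form `v` of highest degree: in some real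
orthonormal basis one has `v = v_N e¹ ∧ ⋯ ∧ eᴺ`, `F(ξ) = ∑_I F^I ξ_I` and `X = v_N F^N`, where `F^N`
is the coefficient of the monomial of highest degree. -/
def IsIntegral (v : D.Forms) (F : D.Fun) (X : D.Gr) : Prop :=
  ∃ (e : OrthonormalBasis (Fin (Module.finrank ℂ D.ran)) ℂ D.ran) (c : ℂ)
    (a : Finset (Fin (Module.finrank ℂ D.ran)) → D.Gr),
    D.IsRealBasis e ∧ v = c • D.wedge e ∧
      (∀ ξ, F ξ = ∑ I : Finset (Fin (Module.finrank ℂ D.ran)), a I * D.monomial e I ξ) ∧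
      X = c • a Finset.univ

open Classical in
/-- The Grassmann integral `∫_Q v F` (with the value `0` if `F` has no polynomial representation). -/
def integral (v : D.Forms) (F : D.Fun) : D.Gr :=
  if h : ∃ X, D.IsIntegral v F X then h.choose else 0

/-! ### Right module homomorphisms, convolution and Fourier transform -/

/-- The bounded right module homomorphisms from the GAR algebra into its Grassmann part. -/
structure RightModuleHom extends D.GAR →L[ℂ] D.Gr where
  map_mul_right' : ∀ (A : D.GAR) (l : D.Gr), toFun (A * D.incl l) = toFun A * l

instance : CoeFun D.RightModuleHom (fun _ => D.GAR → D.Gr) := ⟨fun w => w.toContinuousLinearMap⟩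

/-- The convolution `(φ ∗ A)(ξ) = φ(α_ξ(A))`. -/
def conv (φ : D.RightModuleHom) (A : D.GAR) : D.Fun := fun ξ => φ (D.translate ξ A)

/-- The integrand `η ↦ f(η) exp ⟨ξ⋆, η⟩_Q` of the Fourier transform of `f` at `ξ`. -/
def fourierIntegrand (f : D.Fun) (ξ : D.PhaseEven) : D.Fun :=
  fun η => f η * NormedSpace.exp (D.rigging (D.phaseConj ξ) η)

/-- The Fourier transform of a G-holomorphic function,
`(𝓕 f)(ξ) = ∫_Q v(η) f(η) exp ⟨ξ⋆, η⟩_Q`. -/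
def fourier (v : D.Forms) (f : D.Fun) : D.Fun := fun ξ => D.integral v (D.fourierIntegrand f ξ)

/-- The Fourier transform `(𝓕 φ)(ξ) = φ(w(ξ))` of a right module homomorphism. -/
def fourierHom (φ : D.RightModuleHom) : D.Fun := fun ξ => φ (D.weyl ξ)

end Triple

end GARAlgebra

end

namespace GARAlgebra

/-! Both sides of the formula are additive in `A` and compatible with right multiplication by the
Grassmann part, so the formula can be tested on Grassmann-Weyl operators, provided these determine
everything.

Inversion. In a real basis the commutator of two fields `Φ(ζ)`, `Φ(η)` is `-∑ ζ_i η_i`, which is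
even and commutes with both fields, so `α_η(w(ζ)) = w(ζ) exp(-∑ ζ_i η_i)` (`translate_weyl`). The
integrand of the Fourier transform of `φ * w(ζ)` at `ξ` is therefore `φ(w(ζ)) exp(∑ (ξ - ζ)_i η_i)`,
and its top coefficient is `(-1)^(N choose 2) φ(w(ζ)) δ(ξ - ζ)`, where the delta function is the top
monomial. Since `(ξ - ζ)_u δ(ξ - ζ) = 0`, the factor `q(ξ)` becomes `q(ζ)`, and the second integral
gives `c² (-1)^(N choose 2) q(ζ) φ(w(ζ))` with `v = c e¹ ∧ ⋯ ∧ eᴺ` (`integral_fourier_conv_weyl`).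
For `N = 2n`, normalization and selfadjointness force `c² = (-1)^n`, which cancels the other sign
(`exists_form_coefficient`). The divisibility hypothesis at `ζ` turns the result into `ω(w(ζ))`.

Spanning. The operators `w(ζ) X` with `X` in the Grassmann part need not span the GAR algebra, but
they do after multiplication on the right by `N` generators `G(g_1) ⋯ G(g_N)`, `g_i ∈ Q⊥ H`: an
occurrence of `G(e_j)` is paired with `G(g_j)`, and `G(e_j) G(g_j) = w(e_j ⊗ G(g_j)) - 1`
(`mul_list_prod_mem_weylSpan`). No continuity of the right-hand side in `A` is needed, because this
is an exact algebraic statement about the closed algebra.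

Cancellation. The difference of the two sides is thus annihilated by all such products. As `Q⊥` has
infinite rank, an approximating polynomial misses some unit vector `g`, and the relations for `G(g)`
and its adjoint give `‖y‖ ≤ 2 ‖y G(g)‖`; hence the difference vanishes (`eq_zero_of_mul_G`,
`eq_zero_of_mul_list_prod`). The same cancellation, combined with a growth argument along rays,
makes the top coefficient unique, so that the integral, which is defined by choice, can be computed
in any real basis (`integral_eq`). -/

theorem eq_zero_of_eq_neg_self {E : Type*} [AddCommGroup E] [Module ℂ E] {x : E} (h : x = -x) :
    x = 0 := by
  have h2 : (2 : ℂ) • x = 0 := by rw [two_smul]; nth_rw 2 [h]; exact add_neg_cancel x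
  exact (smul_eq_zero.1 h2).resolve_left two_ne_zero

/-! ### The parity automorphism and the anticommutation relations -/

theorem norm_B_le {K : Type*} [NormedAddCommGroup K] [InnerProductSpace ℂ K] (J : Conjugation K)
    (f : K) : ‖B J f‖ ≤ ‖f‖ :=
  lp.norm_le_of_forall_le (norm_nonneg _) fun π : CARRep J => π.norm_field_le f

theorem nontrivial_CAR {K : Type*} [NormedAddCommGroup K] [InnerProductSpace ℂ K]
    {J : Conjugation K} (π : CARRep J) : Nontrivial (CAR J) := by
  refine ⟨⟨1, 0, fun h => ?_⟩⟩
  have h1 : (1 : SepHilbert →L[ℂ] SepHilbert) = 0 := congrArg (fun a : CAR J => a.1.1 π) h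
  exact one_ne_zero h1

theorem subsingleton_CAR {K : Type*} [NormedAddCommGroup K] [InnerProductSpace ℂ K]
    {J : Conjugation K} (h : IsEmpty (CARRep J)) : Subsingleton (CAR J) :=
  ⟨fun _ _ => Subtype.ext (Subtype.ext (funext fun π => h.elim π))⟩

/-- An element of the algebra is a family indexed by representations, and composing a representation
twice with the involution `U` returns the same representation. -/
theorem bogoliubov_bogoliubov {K : Type*} [NormedAddCommGroup K] [InnerProductSpace ℂ K]
    {J : Conjugation K} (U : K →ₗ[ℂ] K) (hJ : ∀ f, U (J f) = J (U f))
    (hU : ∀ f h, ⟪U f, U h⟫_ℂ = ⟪f, h⟫_ℂ) (hUU : ∀ f, U (U f) = f) (a : CAR J) :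
    bogoliubov U hJ hU (bogoliubov U hJ hU a) = a := by
  refine Subtype.ext (Subtype.ext (funext fun π => ?_))
  change a.1.1 ((π.comp U hJ hU).comp U hJ hU) = a.1.1 π
  have h : (π.comp U hJ hU).comp U hJ hU = π := by
    have h1 : (π.field ∘ₗ U) ∘ₗ U = π.field := LinearMap.ext fun f => by simp [hUU]
    rcases π with ⟨F, h2, h3⟩
    simp only [CARRep.comp]
    congr 1
  rw [h]

/-- The parity automorphism of the selfdual CAR algebra, `B(f) ↦ -B(f)`. -/
noncomputable def parity {K : Type*} [NormedAddCommGroup K] [InnerProductSpace ℂ K]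
    (J : Conjugation K) : CAR J →⋆ₐ[ℂ] CAR J :=
  bogoliubov (-LinearMap.id) (fun f => (map_neg J.toLinearMap f).symm)
    (fun f h => by simp)

section Parity

variable {K : Type*} [NormedAddCommGroup K] [InnerProductSpace ℂ K] (J : Conjugation K)

theorem parity_B (f : K) : parity J (B J f) = -B J f := by
  rw [parity, bogoliubov_B]; simp

theorem parity_parity (a : CAR J) : parity J (parity J a) = a :=
  bogoliubov_bogoliubov _ _ _ (by simp) a

theorem norm_parity_le (a : CAR J) : ‖parity J a‖ ≤ ‖a‖ := ambientBogoliubov_norm_le _ _ _ a.1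

theorem continuous_parity : Continuous (parity J) := continuous_bogoliubov _ _ _

end Parity

namespace Triple

variable {H : Type*} [NormedAddCommGroup H] [InnerProductSpace ℂ H] [CompleteSpace H]
variable (D : Triple H)

/-- The reflection in `J_Q` moves the `Q⊥` component of the first vector to the second summand,
where `h ⊕ 0` vanishes; only the `Q` components are left to pair. -/
theorem G_anticomm (f h : H) :
    D.G f * D.G h + D.G h * D.G f = ⟪D.J f, D.Q h⟫_ℂ • (1 : D.Env) := by
  refine (B_anticomm D.JQ _ _).trans ?_
  congr 1
  change ⟪D.refl _, _⟫_ℂ = _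
  rw [WithLp.prod_inner_apply]
  change ⟪D.Q (D.J f) + D.J (0 : H), h⟫_ℂ + ⟪_, (0 : D.perp)⟫_ℂ = _
  have h0 : D.J (0 : H) = 0 := map_zero D.J.toLinearMap
  rw [h0, add_zero, inner_zero_right, add_zero, D.inner_Q_left]

theorem G_anticomm_perp {f : H} (hf : f ∈ D.perp) (h : H) : D.G f * D.G h = -(D.G h * D.G f) := by
  rw [eq_neg_iff_add_eq_zero, D.G_anticomm, ← D.inner_Q_left, D.mem_perp.1 (D.J_mem_perp hf),
    inner_zero_left, zero_smul]

theorem norm_G_le (f : H) : ‖D.G f‖ ≤ ‖f‖ := by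
  refine (norm_B_le D.JQ _).trans (le_of_eq ?_)
  rw [WithLp.prod_norm_eq_of_L2]
  simp

theorem G_mul_self_perp {f : H} (hf : f ∈ D.perp) : D.G f * D.G f = 0 :=
  eq_zero_of_eq_neg_self (D.G_anticomm_perp hf f)

/-- The star of `G(g)` anticommutes with `G(f)` up to `⟨g, f⟩`. -/
theorem star_G_anticomm (g f : H) :
    star (D.G g) * D.G f + D.G f * star (D.G g) = ⟪g, f⟫_ℂ • (1 : D.Env) := by
  have h1 : star (D.G g) = B D.JQ (D.JQ (WithLp.toLp 2 (g, 0))) := star_B _ _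
  rw [h1]
  refine (B_anticomm D.JQ _ _).trans ?_
  rw [D.JQ.involutive', WithLp.prod_inner_apply]
  simp

theorem parity_G (f : H) : parity D.JQ (D.G f) = -D.G f := parity_B _ _

theorem mem_closure_of_forall_mem {R S : Type*} [TopologicalSpace R] [TopologicalSpace S]
    {s : Set R} {t : Set S} (ht : IsClosed t) {F : R → S} (hF : Continuous F)
    (h : ∀ x ∈ s, F x ∈ t) {x : R} (hx : x ∈ closure s) : F x ∈ t := by
  have := map_mem_closure hF hx h
  rwa [ht.closure_eq] at this

theorem isClosed_Gr : IsClosed (D.Gr : Set D.Env) := Subalgebra.isClosed_topologicalClosure _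

theorem isClosed_GAR : IsClosed (D.GAR : Set D.Env) := Subalgebra.isClosed_topologicalClosure _

theorem mem_GAR_induction {p : D.Env → Prop} (hcl : IsClosed {a | p a}) (hG : ∀ f, p (D.G f))
    (halg : ∀ c : ℂ, p (algebraMap ℂ _ c)) (hadd : ∀ x y, p x → p y → p (x + y))
    (hmul : ∀ x y, p x → p y → p (x * y)) {a : D.Env} (ha : a ∈ D.GAR) : p a := by
  have ha' : a ∈ closure (Algebra.adjoin ℂ (Set.range D.G) : Set D.Env) := ha
  refine mem_closure_of_forall_mem hcl continuous_id (fun x hx => ?_) ha'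
  rw [SetLike.mem_coe] at hx
  change p x
  induction hx using Algebra.adjoin_induction with
  | mem x hx => obtain ⟨f, rfl⟩ := hx; exact hG f
  | algebraMap c => exact halg c
  | add x y _ _ hx hy => exact hadd x y hx hy
  | mul x y _ _ hx hy => exact hmul x y hx hy

theorem mem_Gr_induction {p : D.Env → Prop} (hcl : IsClosed {a | p a})
    (hG : ∀ f ∈ D.perp, p (D.G f))
    (halg : ∀ c : ℂ, p (algebraMap ℂ _ c)) (hadd : ∀ x y, p x → p y → p (x + y))
    (hmul : ∀ x y, p x → p y → p (x * y)) {a : D.Env} (ha : a ∈ D.Gr) : p a := by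
  have ha' : a ∈ closure (Algebra.adjoin ℂ (D.G '' D.perp) : Set D.Env) := ha
  refine mem_closure_of_forall_mem hcl continuous_id (fun x hx => ?_) ha'
  rw [SetLike.mem_coe] at hx
  change p x
  induction hx using Algebra.adjoin_induction with
  | mem x hx => obtain ⟨f, hf, rfl⟩ := hx; exact hG f hf
  | algebraMap c => exact halg c
  | add x y _ _ hx hy => exact hadd x y hx hy
  | mul x y _ _ hx hy => exact hmul x y hx hy

theorem parity_mem_GAR {a : D.Env} (ha : a ∈ D.GAR) : parity D.JQ a ∈ D.GAR := by
  refine D.mem_GAR_induction (p := fun a => parity D.JQ a ∈ D.GAR)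
    (D.isClosed_GAR.preimage (continuous_parity _)) (fun f => ?_) (fun c => ?_)
    (fun x y hx hy => ?_) (fun x y hx hy => ?_) ha
  · rw [parity_G]; exact neg_mem (D.G_mem_GAR f)
  · rw [AlgHomClass.commutes]; exact Subalgebra.algebraMap_mem _ _
  · rw [map_add]; exact add_mem hx hy
  · rw [map_mul]; exact mul_mem hx hy

theorem parity_mem_Gr {a : D.Env} (ha : a ∈ D.Gr) : parity D.JQ a ∈ D.Gr := by
  refine D.mem_Gr_induction (p := fun a => parity D.JQ a ∈ D.Gr)
    (D.isClosed_Gr.preimage (continuous_parity _)) (fun f hf => ?_) (fun c => ?_)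
    (fun x y hx hy => ?_) (fun x y hx hy => ?_) ha
  · rw [parity_G]; exact neg_mem (D.G_mem_Gr ⟨f, hf⟩)
  · rw [AlgHomClass.commutes]; exact Subalgebra.algebraMap_mem _ _
  · rw [map_add]; exact add_mem hx hy
  · rw [map_mul]; exact mul_mem hx hy

/-- The parity automorphism of the GAR algebra. -/
noncomputable def parityGAR (A : D.GAR) : D.GAR := ⟨parity D.JQ A, D.parity_mem_GAR A.2⟩

/-- The parity automorphism of the Grassmann part. -/
noncomputable def parityGr (X : D.Gr) : D.Gr := ⟨parity D.JQ X, D.parity_mem_Gr X.2⟩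

theorem coe_parityGr (X : D.Gr) : (D.parityGr X : D.Env) = parity D.JQ X := rfl

theorem coe_parityGAR (X : D.GAR) : (D.parityGAR X : D.Env) = parity D.JQ X := rfl

/-- `G(f)` with `f ∈ Q⊥ H` commutes with elements of the GAR algebra up to parity. -/
theorem G_mul_of_perp {f : H} (hf : f ∈ D.perp) {a : D.Env} (ha : a ∈ D.GAR) :
    D.G f * a = parity D.JQ a * D.G f := by
  refine D.mem_GAR_induction (p := fun a => D.G f * a = parity D.JQ a * D.G f)
    (isClosed_eq (by fun_prop) ((continuous_parity _).mul continuous_const))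
    (fun h => ?_) (fun c => ?_) (fun x y hx hy => ?_) (fun x y hx hy => ?_) ha
  · rw [parity_G, D.G_anticomm_perp hf, neg_mul]
  · rw [AlgHomClass.commutes]; exact (Algebra.commutes _ _).symm
  · rw [map_add, add_mul, mul_add, hx, hy]
  · rw [map_mul, ← mul_assoc, hx, mul_assoc, hy, mul_assoc]

/-- An odd element of the Grassmann part: it changes sign under the parity automorphism and passes
through the GAR algebra up to parity. -/
structure IsOdd (x : D.Env) : Prop where
  parity_eq : parity D.JQ x = -x
  mul_eq : ∀ a ∈ D.GAR, x * a = parity D.JQ a * x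

theorem isOdd_G {f : H} (hf : f ∈ D.perp) : D.IsOdd (D.G f) :=
  ⟨D.parity_G f, fun _ ha => D.G_mul_of_perp hf ha⟩

variable {D}

theorem IsOdd.add {x y : D.Env} (hx : D.IsOdd x) (hy : D.IsOdd y) : D.IsOdd (x + y) :=
  ⟨by rw [map_add, hx.1, hy.1, neg_add], fun a ha => by rw [add_mul, mul_add, hx.2 a ha, hy.2 a ha]⟩

theorem IsOdd.smul {x : D.Env} (hx : D.IsOdd x) (c : ℂ) : D.IsOdd (c • x) :=
  ⟨by rw [map_smul, hx.1, smul_neg], fun a ha => by rw [smul_mul_assoc, hx.2 a ha, mul_smul_comm]⟩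

theorem IsOdd.zero : D.IsOdd 0 := ⟨by simp, by simp⟩

theorem IsOdd.anticomm {x y : D.Env} (hx : D.IsOdd x) (hy : D.IsOdd y) (hy' : y ∈ D.GAR) :
    x * y = -(y * x) := by
  rw [hx.2 y hy', hy.1, neg_mul]

/-- Passing through two odd elements applies the parity twice, which is the identity. -/
theorem IsOdd.mul_mul_comm {x y a : D.Env} (hx : D.IsOdd x) (hy : D.IsOdd y) (ha : a ∈ D.GAR) :
    x * y * a = a * (x * y) := by
  rw [mul_assoc, hy.2 a ha, ← mul_assoc, hx.2 _ (D.parity_mem_GAR ha), parity_parity, mul_assoc]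

variable (D)

theorem isClosed_isOdd : IsClosed {x | D.IsOdd x} := by
  have : {x | D.IsOdd x} = {x | parity D.JQ x = -x} ∩
      ⋂ a ∈ D.GAR, {x | x * a = parity D.JQ a * x} := by
    ext x
    simp only [Set.mem_ofPred_eq, Set.mem_inter_iff, Set.mem_iInter]
    exact ⟨fun h => ⟨h.1, h.2⟩, fun h => ⟨h.1, h.2⟩⟩
  rw [this]
  refine (isClosed_eq (continuous_parity _) continuous_neg).inter
    (isClosed_biInter fun a _ => isClosed_eq (by fun_prop) (by fun_prop))

/-- Both parities are carried through one induction, since removing a factor switches between them.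
-/
theorem isOdd_list_prod (l : List D.perp) :
    (Odd l.length → D.IsOdd (l.map fun f : D.perp => D.G (f : H)).prod) ∧
    (Even l.length → parity D.JQ (l.map fun f : D.perp => D.G (f : H)).prod =
        (l.map fun f : D.perp => D.G (f : H)).prod ∧
      ∀ a ∈ D.GAR, (l.map fun f : D.perp => D.G (f : H)).prod * a =
        a * (l.map fun f : D.perp => D.G (f : H)).prod) := by
  induction l with
  | nil => simp
  | cons f l ih =>
    simp only [List.length_cons, List.map_cons, List.prod_cons]
    have hf := D.isOdd_G f.2
    refine ⟨fun h => ?_, fun h => ?_⟩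
    · have h1 := ih.2 (by rwa [Nat.odd_add_one, Nat.not_odd_iff_even] at h)
      refine ⟨by rw [map_mul, h1.1, hf.1, neg_mul], fun a ha => ?_⟩
      rw [mul_assoc, h1.2 a ha, ← mul_assoc, hf.2 a ha, mul_assoc]
    · have h1 := ih.1 (by rwa [Nat.even_add_one, Nat.not_even_iff_odd] at h)
      exact ⟨by rw [map_mul, h1.1, hf.1, neg_mul_neg], fun a ha => hf.mul_mul_comm h1 ha⟩

theorem isOdd_of_mem_GrOdd {x : D.Gr} (hx : x ∈ D.GrOdd) : D.IsOdd (x : D.Env) := by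
  have hx' : x ∈ closure ((Submodule.span ℂ {x : D.Gr | ∃ l : List D.perp, Odd l.length ∧
    x = (l.map fun f : D.perp => (⟨D.G (f : H), D.G_mem_Gr f⟩ : D.Gr)).prod} : Submodule ℂ D.Gr) :
      Set D.Gr) := hx
  refine mem_closure_of_forall_mem D.isClosed_isOdd continuous_subtype_val (fun y hy => ?_) hx'
  rw [SetLike.mem_coe] at hy
  change D.IsOdd (y : D.Env)
  induction hy using Submodule.span_induction with
  | mem y hy =>
    obtain ⟨l, hl, rfl⟩ := hy
    have : (((l.map fun f : D.perp => (⟨D.G (f : H), D.G_mem_Gr f⟩ : D.Gr)).prod : D.Gr) : D.Env) =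
        (l.map fun f : D.perp => D.G (f : H)).prod := by
      rw [← Subalgebra.coe_val, map_list_prod, List.map_map]; rfl
    rw [this]
    exact (D.isOdd_list_prod l).1 hl
  | zero => exact IsOdd.zero
  | add x y _ _ hx hy => exact hx.add hy
  | smul c x _ hx => exact hx.smul c

/-! ### Cancellation of odd generators -/

/-- `‖X‖ ≤ 2 ‖X G(g)‖` if the unit vector `g` is orthogonal to everything that occurs in `X`. -/
theorem norm_le_two_mul {g : H} (hg1 : ‖g‖ = 1) {x : D.Env}
    (hxg : star (D.G g) * parity D.JQ x = x * star (D.G g)) : ‖x‖ ≤ 2 * ‖x * D.G g‖ := by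
  set l := D.G g with hl
  have hl1 : ‖l‖ ≤ 1 := by rw [← hg1]; exact D.norm_G_le g
  have h1 : star l * l + l * star l = 1 := by
    rw [D.star_G_anticomm, inner_self_eq_norm_sq_to_K, hg1]; simp
  -- The unit `l* l + l l*` is inserted to the right of `x`, and `x l*` is rewritten as `l*` times
  -- the parity image of `x`, so that both terms contain `x l` up to parity.
  have h2 : x = star l * (parity D.JQ x * l) + x * l * star l := by
    rw [← mul_assoc, hxg, mul_assoc, mul_assoc, ← mul_add, h1, mul_one]
  have h3 : ‖parity D.JQ x * l‖ ≤ ‖x * l‖ := by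
    have : parity D.JQ x * l = -parity D.JQ (x * l) := by
      rw [map_mul, hl, D.parity_G, mul_neg, neg_neg]
    rw [this, norm_neg]; exact norm_parity_le _ _
  calc ‖x‖ = ‖star l * (parity D.JQ x * l) + x * l * star l‖ := by rw [← h2]
    _ ≤ ‖star l‖ * ‖parity D.JQ x * l‖ + ‖x * l‖ * ‖star l‖ :=
      (norm_add_le _ _).trans (add_le_add (norm_mul_le _ _) (norm_mul_le _ _))
    _ ≤ 1 * ‖x * l‖ + ‖x * l‖ * 1 := by
      rw [norm_star]
      gcongr
    _ = _ := by ring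

/-- The orthogonal projection from the infinite-dimensional `Q⊥ H` to the finite-dimensional `W` has
a nonzero kernel vector, which is then normalized. -/
theorem exists_orthogonal_unit (hinf : ¬ FiniteDimensional ℂ D.perp) (W : Submodule ℂ H)
    [FiniteDimensional ℂ W] : ∃ g ∈ D.perp, ‖g‖ = 1 ∧ ∀ f ∈ W, ⟪g, f⟫_ℂ = 0 := by
  let P : D.perp →ₗ[ℂ] W := (W.orthogonalProjectionOnto : H →ₗ[ℂ] W) ∘ₗ D.perp.subtype
  have hP : ¬ Function.Injective P := fun h => hinf (FiniteDimensional.of_injective P h)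
  rw [← LinearMap.ker_eq_bot, Submodule.eq_bot_iff] at hP
  push Not at hP
  obtain ⟨x, hx, hx0⟩ := hP
  have hx0' : (x : H) ≠ 0 := by simpa using hx0
  refine ⟨((‖(x : H)‖⁻¹ : ℝ) : ℂ) • (x : H), D.perp.smul_mem _ x.2, ?_, fun f hf => ?_⟩
  · rw [norm_smul, Complex.norm_real, norm_inv, norm_norm, inv_mul_cancel₀ (norm_ne_zero_iff.2 hx0')]
  · have : (x : H) ∈ Wᗮ := by
      rw [← Submodule.orthogonalProjectionOnto_eq_zero_iff]; exact hx
    rw [inner_smul_left, Submodule.inner_left_of_mem_orthogonal hf this, mul_zero]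

/-- A polynomial contains only finitely many generators `G(f)`; `W` is the span of their vectors.
For `g` orthogonal to `W`, the operator `G(g)*` anticommutes with each of these generators, which is
passage up to parity. -/
theorem exists_finiteDimensional {x : D.Env} (hx : x ∈ Algebra.adjoin ℂ (D.G '' D.perp)) :
    ∃ W : Submodule ℂ H, FiniteDimensional ℂ W ∧ ∀ g, (∀ f ∈ W, ⟪g, f⟫_ℂ = 0) →
      star (D.G g) * parity D.JQ x = x * star (D.G g) := by
  induction hx using Algebra.adjoin_induction with
  | mem x hx =>
    obtain ⟨f, -, rfl⟩ := hx
    refine ⟨ℂ ∙ f, inferInstance, fun g hg => ?_⟩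
    have := D.star_G_anticomm g f
    rw [hg f (Submodule.mem_span_singleton_self f), zero_smul] at this
    rw [D.parity_G, mul_neg, neg_eq_iff_add_eq_zero, this]
  | algebraMap c =>
    refine ⟨⊥, inferInstance, fun g _ => ?_⟩
    rw [AlgHomClass.commutes]; exact (Algebra.commutes _ _).symm
  | add x y _ _ hx hy =>
    obtain ⟨V, hV, hx⟩ := hx
    obtain ⟨W, hW, hy⟩ := hy
    refine ⟨V ⊔ W, inferInstance, fun g hg => ?_⟩
    rw [map_add, mul_add, add_mul, hx g fun f hf => hg f (Submodule.mem_sup_left hf),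
      hy g fun f hf => hg f (Submodule.mem_sup_right hf)]
  | mul x y _ _ hx hy =>
    obtain ⟨V, hV, hx⟩ := hx
    obtain ⟨W, hW, hy⟩ := hy
    refine ⟨V ⊔ W, inferInstance, fun g hg => ?_⟩
    rw [map_mul, ← mul_assoc, hx g fun f hf => hg f (Submodule.mem_sup_left hf), mul_assoc,
      hy g fun f hf => hg f (Submodule.mem_sup_right hf), mul_assoc]

/-- If `Q⊥` has infinite rank, an element of the Grassmann part that is annihilated by all generators
vanishes. -/
theorem eq_zero_of_mul_G (hinf : ¬ FiniteDimensional ℂ D.perp) {x : D.Env} (hx : x ∈ D.Gr)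
    (h : ∀ g ∈ D.perp, x * D.G g = 0) : x = 0 := by
  have hx' : x ∈ closure (Algebra.adjoin ℂ (D.G '' D.perp) : Set D.Env) := hx
  rw [← norm_eq_zero]
  refine le_antisymm (le_of_forall_pos_le_add fun ε hε => ?_) (norm_nonneg _)
  -- The constant `3` comes from `‖x‖ ≤ ‖x - y‖ + 2 ‖y G(g)‖`, where `y G(g) = -(x - y) G(g)` has
  -- norm at most `‖x - y‖`.
  obtain ⟨y, hy, hxy⟩ := Metric.mem_closure_iff.1 hx' (ε / 3) (by positivity)
  rw [dist_eq_norm] at hxy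
  obtain ⟨W, hW, hyW⟩ := D.exists_finiteDimensional hy
  obtain ⟨g, hg, hg1, hgW⟩ := D.exists_orthogonal_unit hinf W
  have h1 := D.norm_le_two_mul hg1 (hyW g hgW)
  have h2 : ‖y * D.G g‖ ≤ ‖x - y‖ := by
    have : y * D.G g = -((x - y) * D.G g) := by rw [sub_mul, h g hg]; simp
    rw [this, norm_neg]
    refine (norm_mul_le _ _).trans (mul_le_of_le_one_right (norm_nonneg _) ?_)
    rw [← hg1]; exact D.norm_G_le g
  have h3 : ‖x‖ ≤ ‖x - y‖ + ‖y‖ := by simpa using norm_add_le (x - y) y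
  linarith

/-- The leftmost generator is stripped by `eq_zero_of_mul_G`. Distinct indices are needed so that it
can be varied by `Function.update` without changing the remaining factors. -/
theorem eq_zero_of_mul_list_prod (hinf : ¬ FiniteDimensional ℂ D.perp) {ι : Type*} [DecidableEq ι]
    (l : List ι) (hl : l.Nodup) {x : D.Env} (hx : x ∈ D.Gr)
    (h : ∀ g : ι → D.perp, x * (l.map fun i => D.G (g i : H)).prod = 0) : x = 0 := by
  induction l generalizing x with
  | nil => simpa using h 0
  | cons i l ih =>
    refine D.eq_zero_of_mul_G hinf hx fun g hg => ?_
    refine ih (List.nodup_cons.1 hl).2 (mul_mem hx (D.G_mem_Gr ⟨g, hg⟩)) fun g' => ?_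
    have := h (Function.update g' i ⟨g, hg⟩)
    rw [List.map_cons, List.prod_cons, Function.update_self, ← mul_assoc] at this
    rw [← this]
    congr 2
    refine List.map_congr_left fun j hj => ?_
    rw [Function.update_of_ne]
    rintro rfl
    exact (List.nodup_cons.1 hl).1 hj

end Triple


/-! ### Products over bases -/

/-- A linear map with square-zero values extends to the exterior algebra, so the product is an
alternating form of top degree and hence a multiple of the determinant. This serves both for forms
and for top monomials. -/
theorem ofFn_prod_eq_det_smul {R V : Type*} [Ring R] [Algebra ℂ R] [AddCommGroup V] [Module ℂ V]
    (f : V →ₗ[ℂ] R) (hf : ∀ x, f x * f x = 0) {N : ℕ} (b b' : Module.Basis (Fin N) ℂ V) :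
    (List.ofFn fun i => f (b' i)).prod = b.det b' • (List.ofFn fun i => f (b i)).prod := by
  let F : V [⋀^Fin N]→ₗ[ℂ] R :=
    (ExteriorAlgebra.lift ℂ ⟨f, hf⟩).toLinearMap.compAlternatingMap (ExteriorAlgebra.ιMulti ℂ N)
  have hF : ∀ v, F v = (List.ofFn fun i => f (v i)).prod := fun v => by
    simp only [F, LinearMap.compAlternatingMap_apply, ExteriorAlgebra.ιMulti_apply,
      AlgHom.toLinearMap_apply, map_list_prod, List.map_ofFn]
    congr 2
    funext i
    exact ExteriorAlgebra.lift_ι_apply ℂ f hf (v i)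
  have h : F = (LinearMap.toSpanSingleton ℂ R (F b)).compAlternatingMap b.det := by
    refine Module.Basis.ext_alternating b fun v hv => ?_
    let s : Equiv.Perm (Fin N) := Equiv.ofBijective v (Finite.injective_iff_bijective.1 hv)
    have hs : (fun i => b (v i)) = b ∘ s := rfl
    rw [hs, AlternatingMap.map_perm, AlternatingMap.map_perm,
      LinearMap.compAlternatingMap_apply _ b.det,
      Module.Basis.det_self, LinearMap.toSpanSingleton_apply, one_smul]
  rw [← hF b', ← hF b]
  exact congrArg (fun G : V [⋀^Fin N]→ₗ[ℂ] R => G b') h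

namespace Triple

variable {H : Type*} [NormedAddCommGroup H] [InnerProductSpace ℂ H] [CompleteSpace H]
variable (D : Triple H)

/-! ### Real orthonormal bases of `QH` -/

theorem inner_real_basis {N : ℕ} {e e' : OrthonormalBasis (Fin N) ℂ D.ran}
    (he : D.IsRealBasis e) (he' : D.IsRealBasis e') (i j : Fin N) : ⟪e i, e' j⟫_ℂ = ⟪e' j, e i⟫_ℂ := by
  have h := D.Jran.inner_map' (e' j) (e i)
  rw [show D.Jran.toFun (e' j) = e' j from he' j, show D.Jran.toFun (e i) = e i from he i] at h
  exact h.symm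

/-- The transition matrix between real orthonormal bases is real and unitary, so its determinant is
real of modulus one. -/
theorem det_mul_self {N : ℕ} {e e' : OrthonormalBasis (Fin N) ℂ D.ran}
    (he : D.IsRealBasis e) (he' : D.IsRealBasis e') :
    e.toBasis.det e' * e.toBasis.det e' = 1 := by
  have h1 : conj (e.toBasis.det e') = e.toBasis.det e' := by
    rw [Module.Basis.det_apply, RingHom.map_det]
    congr 1
    ext i j
    simp only [RingHom.mapMatrix_apply, Matrix.map_apply, Module.Basis.toMatrix_apply,
      OrthonormalBasis.coe_toBasis_repr_apply, OrthonormalBasis.repr_apply_apply]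
    rw [inner_conj_symm, D.inner_real_basis he he']
  have h2 := e.det_to_matrix_orthonormalBasis e'
  nth_rw 1 [← h1]
  rw [RCLike.conj_mul, h2]
  simp

/-- The finite rank projection admits a basis of real vectors. -/
theorem exists_real_basis [FiniteDimensional ℂ D.ran] :
    ∃ e : OrthonormalBasis (Fin (Module.finrank ℂ D.ran)) ℂ D.ran, D.IsRealBasis e := by
  let _ : InnerProductSpace ℝ D.ran := InnerProductSpace.rclikeToReal ℂ D.ran
  -- The vectors fixed by `J` form a real Hilbert space, since the inner product of two of them is
  -- symmetric and thus real; a real orthonormal basis of it is the desired basis.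
  let V : Submodule ℝ D.ran :=
    { carrier := {f | D.Jran f = f}
      add_mem' := fun {a b} ha hb => (map_add D.Jran.toLinearMap a b).trans (congrArg₂ _ ha hb)
      zero_mem' := map_zero D.Jran.toLinearMap
      smul_mem' := fun c f hf => by
        have h := map_smulₛₗ D.Jran.toLinearMap (c : ℂ) f
        rw [Complex.conj_ofReal] at h
        exact h.trans (congrArg _ hf) }
  have hV : ∀ f g : V, ⟪(f : D.ran), (g : D.ran)⟫_ℂ = ((⟪f, g⟫_ℝ : ℝ) : ℂ) := fun f g => by
    have h1 : ⟪(f : D.ran), (g : D.ran)⟫_ℂ = ⟪(g : D.ran), (f : D.ran)⟫_ℂ := by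
      have := D.Jran.inner_map' (f : D.ran) (g : D.ran)
      rwa [show D.Jran.toFun f = f from f.2, show D.Jran.toFun g = g from g.2] at this
    rw [← inner_conj_symm] at h1
    have h2 := Complex.conj_eq_iff_re.1 h1
    rw [← h1, inner_conj_symm] at h2
    exact h2.symm
  let b := stdOrthonormalBasis ℝ V
  have hb : Orthonormal ℂ fun i => ((b i : V) : D.ran) := by
    rw [orthonormal_iff_ite]
    intro i j
    rw [hV, orthonormal_iff_ite.1 b.orthonormal i j]
    split_ifs <;> simp
  have hmem : ∀ f ∈ V, f ∈ Submodule.span ℂ (Set.range fun i => ((b i : V) : D.ran)) := fun f hf => by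
    have h := b.sum_repr ⟨f, hf⟩
    have h' := congrArg (fun x : V => (x : D.ran)) h
    simp only [Submodule.coe_sum, Submodule.coe_smul] at h'
    rw [← h']
    refine Submodule.sum_mem _ fun i _ => ?_
    exact Submodule.smul_mem _ (_ : ℂ) (Submodule.subset_span ⟨i, rfl⟩)
  have hspan : ⊤ ≤ Submodule.span ℂ (Set.range fun i => ((b i : V) : D.ran)) := by
    intro f _
    have hJJ : D.Jran (D.Jran f) = f := D.Jran.involutive' f
    have h1 : f + D.Jran f ∈ V :=
      (map_add D.Jran.toLinearMap _ _).trans (by rw [add_comm]; exact congrArg (· + _) hJJ)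
    have h2 : Complex.I • (f - D.Jran f) ∈ V := by
      refine (map_smulₛₗ D.Jran.toLinearMap _ _).trans ?_
      rw [map_sub, Complex.conj_I, neg_smul, ← smul_neg, neg_sub]
      exact congrArg (fun x => Complex.I • (x - _)) hJJ
    -- Decomposition into real and imaginary parts with respect to `J`.
    have h3 : f = (1 / 2 : ℂ) • (f + D.Jran f) +
        (-Complex.I / 2) • (Complex.I • (f - D.Jran f)) := by
      rw [smul_smul]
      have : -Complex.I / 2 * Complex.I = 1 / 2 := by
        rw [div_mul_eq_mul_div, neg_mul, Complex.I_mul_I, neg_neg]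
      rw [this, ← smul_add, add_add_sub_cancel, ← two_smul ℂ f, smul_smul]
      norm_num
    rw [h3]
    exact add_mem (Submodule.smul_mem _ _ (hmem _ h1)) (Submodule.smul_mem _ _ (hmem _ h2))
  let e := OrthonormalBasis.mk hb hspan
  have hcard : Module.finrank ℂ D.ran = Module.finrank ℝ V := by
    rw [Module.finrank_eq_card_basis e.toBasis, Fintype.card_fin]
  refine ⟨e.reindex (finCongr hcard.symm), fun i => ?_⟩
  have : (e.reindex (finCongr hcard.symm)) i = ((b (finCongr hcard i) : V) : D.ran) := by
    simp [e]
  rw [this]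
  exact (b (finCongr hcard i)).2

/-! ### The form of highest degree -/

/-- This finds room for a copy of `QH` inside `Q⊥ H`, which realizes the Grassmann algebra of forms
within a representation over `H_Q`. -/
theorem exists_isometry [FiniteDimensional ℂ D.ran] (hinf : ¬ FiniteDimensional ℂ D.perp) :
    Nonempty (D.ran →ₗᵢ[ℂ] D.perp) := by
  have h1 : ((Module.finrank ℂ D.ran : ℕ) : Cardinal) ≤ Module.rank ℂ D.perp := by
    refine (Cardinal.natCast_le_aleph0).trans ?_
    rw [← not_lt]
    exact fun h => hinf (Module.rank_lt_aleph0_iff.1 h)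
  obtain ⟨f, hf⟩ := exists_linearIndependent_of_le_rank h1
  have h2 : Module.finrank ℂ (Submodule.span ℂ (Set.range f)) = Module.finrank ℂ D.ran := by
    rw [finrank_span_eq_card hf, Fintype.card_fin]
  have := FiniteDimensional.span_of_finite ℂ (Set.finite_range f)
  let b := stdOrthonormalBasis ℂ D.ran
  let b' := stdOrthonormalBasis ℂ (Submodule.span ℂ (Set.range f))
  exact ⟨(Submodule.span ℂ (Set.range f)).subtypeₗᵢ.comp (b.equiv b' (finCongr h2.symm)).toLinearIsometry⟩

/-- The pullback of a representation along an isometry that intertwines the conjugations. -/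
noncomputable def _root_.GARAlgebra.CARRep.pullback {K K' : Type*} [NormedAddCommGroup K]
    [InnerProductSpace ℂ K] [NormedAddCommGroup K'] [InnerProductSpace ℂ K'] {J : Conjugation K}
    {J' : Conjugation K'} (π : CARRep J) (U : K' →ₗ[ℂ] K) (hJ : ∀ f, U (J' f) = J (U f))
    (hU : ∀ f h, ⟪U f, U h⟫_ℂ = ⟪f, h⟫_ℂ) : CARRep J' where
  field := π.field ∘ₗ U
  star_field f := by simp only [LinearMap.comp_apply, π.star_field, hJ]
  anticomm f h := by simp only [LinearMap.comp_apply, π.anticomm, ← hJ, hU]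

/-- A representation of the relations over `(H_Q, J_Q)` restricts to one of the relations that belong
to the Grassmann algebra over `Q H`. -/
theorem nonempty_grassmann_rep [FiniteDimensional ℂ D.ran] (hinf : ¬ FiniteDimensional ℂ D.perp)
    (π : CARRep D.JQ) : Nonempty (CARRep D.grassmann.JQ) := by
  obtain ⟨V⟩ := D.exists_isometry hinf
  -- The isometry `V` need not commute with `J`. As `J_Q` exchanges the two summands on `Q⊥ H ⊕ Q⊥
  -- H`, the second one is embedded by `W = J V J`; then `V ⊕ W` intertwines the conjugations.
  let W : D.ran →ₗ[ℂ] D.perp :=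
    { toFun := fun f => ⟨D.J (V (D.Jran f)), D.J_mem_perp (V (D.Jran f)).2⟩
      map_add' := fun f h => Subtype.ext <| by
        have h1 : D.Jran (f + h) = D.Jran f + D.Jran h := map_add D.Jran.toLinearMap f h
        rw [h1, map_add]
        exact map_add D.J.toLinearMap _ _
      map_smul' := fun c f => Subtype.ext <| by
        have h1 : D.Jran (c • f) = conj c • D.Jran f := map_smulₛₗ D.Jran.toLinearMap c f
        rw [h1, map_smul]
        refine (map_smulₛₗ D.J.toLinearMap _ _).trans ?_
        rw [Complex.conj_conj]
        rfl }
  have hW : ∀ f h, ⟪W f, W h⟫_ℂ = ⟪f, h⟫_ℂ := fun f h => by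
    refine (D.J.inner_map' _ _).trans ?_
    refine (V.inner_map_map _ _).trans ?_
    exact D.Jran.inner_map' h f
  have hJ0 : D.Jran 0 = 0 := map_zero D.Jran.toLinearMap
  let U : D.grassmann.HQ →ₗ[ℂ] D.HQ :=
    { toFun := fun x => WithLp.toLp 2 ((V x.fst : H), W x.snd)
      map_add' := fun x y => by
        apply (WithLp.equiv 2 _).injective
        refine Prod.ext ?_ ?_
        · exact congrArg Subtype.val (V.map_add x.fst y.fst)
        · exact W.map_add (x.snd : D.ran) (y.snd : D.ran)
      map_smul' := fun c x => by
        apply (WithLp.equiv 2 _).injective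
        refine Prod.ext ?_ ?_
        · exact congrArg Subtype.val (V.map_smul c x.fst)
        · exact W.map_smul c (x.snd : D.ran) }
  refine ⟨π.pullback U (fun x => ?_) fun x y => ?_⟩
  · apply (WithLp.equiv 2 _).injective
    have hQ : ∀ z : D.perp, D.Q (D.J (z : H)) = 0 := fun z => D.mem_perp.1 (D.J_mem_perp z.2)
    refine Prod.ext ?_ (Subtype.ext ?_)
    · change (V ((0 : D.ran →L[ℂ] D.ran) (D.Jran x.fst) + D.Jran (x.snd : D.ran)) : H) =
        D.Q (D.J (V x.fst : H)) + D.J (D.J (V (D.Jran (x.snd : D.ran))))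
      rw [hQ, zero_add, zero_apply, zero_add]
      exact (D.J.involutive' _).symm
    · change D.J (V (D.Jran (D.Jran x.fst - (0 : D.ran →L[ℂ] D.ran) (D.Jran x.fst)))) =
        D.J (V x.fst : H) - D.Q (D.J (V x.fst : H))
      rw [hQ, sub_zero, zero_apply, sub_zero]
      have h1 : D.Jran (D.Jran x.fst) = x.fst := D.Jran.involutive' _
      rw [h1]
  · rw [WithLp.prod_inner_apply, WithLp.prod_inner_apply]
    exact congrArg₂ (· + ·) (V.inner_map_map _ _) (hW _ _)

/-- If `G(e_i) P = 0`, then `P = (G(e_i)* G(e_i) + G(e_i) G(e_i)*) P` vanishes as well, because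
`G(e_i)*` passes through `P` up to a sign. So the factors can be removed one by one until `1 = 0` is
reached. -/
theorem G_list_prod_ne_zero [Nontrivial D.Env] {ι : Type*} (e : ι → H) (he : Orthonormal ℂ e)
    (l : List ι) (hl : l.Nodup) (hperp : ∀ i, e i ∈ D.perp) :
    (l.map fun i => D.G (e i)).prod ≠ 0 := by
  induction l with
  | nil => simp
  | cons i l ih =>
    intro h0
    rw [List.map_cons, List.prod_cons] at h0
    obtain ⟨hi, hl⟩ := List.nodup_cons.1 hl
    refine ih hl ?_
    have h1 : ∀ l' : List ι, i ∉ l' → ∃ c : ℂ, star (D.G (e i)) * (l'.map fun i => D.G (e i)).prod =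
        c • ((l'.map fun i => D.G (e i)).prod * star (D.G (e i))) ∧
        D.G (e i) * (l'.map fun i => D.G (e i)).prod =
        c • ((l'.map fun i => D.G (e i)).prod * D.G (e i)) := by
      intro l' hl'
      induction l' with
      | nil => exact ⟨1, by simp⟩
      | cons j l' ih' =>
        obtain ⟨hj, hl'⟩ := not_or.1 (List.mem_cons.not.1 hl')
        obtain ⟨c, hc, hc'⟩ := ih' hl'
        have h2 : star (D.G (e i)) * D.G (e j) = -(D.G (e j) * star (D.G (e i))) := by
          rw [eq_neg_iff_add_eq_zero, D.star_G_anticomm, he.2 hj, zero_smul]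
        refine ⟨-c, ?_, ?_⟩
        · rw [List.map_cons, List.prod_cons, ← mul_assoc, h2, neg_mul, mul_assoc, hc]
          simp [mul_assoc]
        · rw [List.map_cons, List.prod_cons, ← mul_assoc, D.G_anticomm_perp (hperp i), neg_mul,
            mul_assoc, hc']
          simp [mul_assoc]
    obtain ⟨c, hc, hc'⟩ := h1 l hi
    have h3 : star (D.G (e i)) * D.G (e i) + D.G (e i) * star (D.G (e i)) = 1 := by
      rw [D.star_G_anticomm, inner_self_eq_norm_sq_to_K, he.1 i]; simp
    rw [← one_mul (List.prod _), ← h3, add_mul, mul_assoc, h0, mul_zero, zero_add, mul_assoc, hc,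
      mul_smul_comm, ← mul_assoc, h0, zero_mul, smul_zero]

theorem coe_wedge {N : ℕ} (e : OrthonormalBasis (Fin N) ℂ D.ran) :
    (D.wedge e : D.grassmann.Env) = (List.ofFn fun i => D.grassmann.G (e i)).prod := by
  rw [wedge, ← Subalgebra.coe_val, map_list_prod, List.map_ofFn]; rfl

theorem mem_grassmann_perp (f : D.ran) : f ∈ D.grassmann.perp :=
  D.grassmann.mem_perp.2 rfl

/-- This makes the coefficient of a form of highest degree unique. -/
theorem wedge_ne_zero [FiniteDimensional ℂ D.ran] (hinf : ¬ FiniteDimensional ℂ D.perp)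
    (π : CARRep D.JQ) {N : ℕ} (e : OrthonormalBasis (Fin N) ℂ D.ran) : D.wedge e ≠ 0 := by
  obtain ⟨π'⟩ := D.nonempty_grassmann_rep hinf π
  have : Nontrivial D.grassmann.Env := nontrivial_CAR π'
  have h := D.grassmann.G_list_prod_ne_zero e e.orthonormal (List.finRange N)
    (List.nodup_finRange N) fun i => D.mem_grassmann_perp _
  rw [← List.ofFn_eq_map, ← coe_wedge] at h
  exact fun h0 => h (congrArg Subtype.val h0)

theorem wedge_eq_det_smul {N : ℕ} (e e' : OrthonormalBasis (Fin N) ℂ D.ran) :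
    D.wedge e' = e.toBasis.det e' • D.wedge e := by
  refine Subtype.ext ?_
  have h := ofFn_prod_eq_det_smul D.grassmann.G
    (fun x => D.grassmann.G_mul_self_perp (D.mem_grassmann_perp x)) e.toBasis e'.toBasis
  simp only [OrthonormalBasis.coe_toBasis] at h
  rw [← D.coe_wedge, ← D.coe_wedge] at h
  exact h

theorem adj_list_prod (l : List D.Env) : D.adj l.prod = (l.map D.adj).reverse.prod := by
  induction l with
  | nil =>
    change bogoliubov D.refl D.refl_JQ D.refl_inner (star 1) = 1
    rw [star_one, map_one]
  | cons a l ih => simp [adj_mul, ih]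

theorem list_prod_mul_of_anticomm {R : Type*} [Ring R] (l : List R) (a : R)
    (h : ∀ x ∈ l, x * a = -(a * x)) : l.prod * a = (-1) ^ l.length * (a * l.prod) := by
  induction l with
  | nil => simp
  | cons x l ih =>
    rw [List.prod_cons, mul_assoc, ih fun y hy => h y (List.mem_cons_of_mem _ hy),
      ← mul_assoc, ← ((Commute.neg_one_left x).pow_left l.length).eq, mul_assoc, ← mul_assoc x,
      h x List.mem_cons_self, List.length_cons, pow_succ]
    simp [mul_assoc]

/-- Moving the first of `k + 1` factors to the end costs `(-1)^k`; the exponents add up by Pascal's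
rule. -/
theorem prod_reverse_of_anticomm {R : Type*} [Ring R] (l : List R)
    (h : ∀ x ∈ l, ∀ y ∈ l, x * y = -(y * x)) :
    l.reverse.prod = (-1) ^ (l.length.choose 2) * l.prod := by
  induction l with
  | nil => simp
  | cons x l ih =>
    rw [List.reverse_cons, List.prod_append, List.prod_singleton,
      ih fun y hy z hz => h y (List.mem_cons_of_mem _ hy) z (List.mem_cons_of_mem _ hz), mul_assoc,
      list_prod_mul_of_anticomm l x fun y hy => h y (List.mem_cons_of_mem _ hy) x List.mem_cons_self,
      ← mul_assoc, ← pow_add, List.prod_cons, List.length_cons, Nat.choose_succ_succ' l.length 1,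
      Nat.choose_one_right, add_comm]

theorem neg_one_pow_choose_two (R : Type*) [Ring R] (n : ℕ) :
    (-1 : R) ^ ((2 * n).choose 2) = (-1) ^ n := by
  have h : (2 * n).choose 2 = n * (2 * n - 1) := by
    rw [Nat.choose_two_right, mul_assoc, Nat.mul_div_cancel_left _ two_pos]
  rw [h, pow_mul]
  rcases n.eq_zero_or_pos with rfl | hn
  · simp
  · rw [← pow_mul, mul_comm, pow_mul, Odd.neg_one_pow ⟨n - 1, by omega⟩]

/-- The coefficient of a normalized selfadjoint form of highest degree with respect to a real basis
has the square `(-1) ^ n`. -/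
theorem exists_form_coefficient [FiniteDimensional ℂ D.ran] (hinf : ¬ FiniteDimensional ℂ D.perp)
    (π : CARRep D.JQ) {n : ℕ} (hrank : Module.finrank ℂ D.ran = 2 * n) {v : D.Forms}
    (hv_adj : D.IsSelfadjointForm v) (hv_norm : D.IsNormalizedForm v)
    {e : OrthonormalBasis (Fin (Module.finrank ℂ D.ran)) ℂ D.ran} (he : D.IsRealBasis e) :
    ∃ c : ℂ, v = c • D.wedge e ∧ c * c = (-1) ^ n := by
  obtain ⟨e', c', hc', rfl⟩ := hv_norm
  set c := c' * e.toBasis.det e' with hc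
  have hv : c' • D.wedge e' = c • D.wedge e := by rw [D.wedge_eq_det_smul e e', smul_smul]
  have hc1 : ‖c‖ = 1 := by rw [hc, norm_mul, hc', e.det_to_matrix_orthonormalBasis, one_mul]
  refine ⟨c, hv, ?_⟩
  rw [hv] at hv_adj
  -- The adjoint fixes the real generators and reverses their order, with sign `(-1)^(2n choose 2) =
  -- (-1)^n`.
  have h1 : D.grassmann.adj (D.wedge e : D.grassmann.Env) = ((-1 : ℂ) ^ n) • (D.wedge e) := by
    rw [coe_wedge, adj_list_prod, List.map_ofFn]
    have h2 : (D.grassmann.adj ∘ fun i => D.grassmann.G (e i)) = fun i => D.grassmann.G (e i) := by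
      funext i
      rw [Function.comp_apply, adj_G]
      exact congrArg _ (he i)
    have h3 : (-1 : D.grassmann.Env) ^ (Module.finrank ℂ D.ran).choose 2 = (-1) ^ n := by
      rw [hrank, neg_one_pow_choose_two]
    rw [h2, prod_reverse_of_anticomm, List.length_ofFn, h3]
    · rcases neg_one_pow_eq_or ℂ n with h | h
      all_goals rcases n.even_or_odd with h' | h' <;> simp [h'.neg_one_pow]
    · intro x hx y hy
      obtain ⟨i, rfl⟩ := (List.mem_ofFn' _ _).1 hx
      obtain ⟨j, rfl⟩ := (List.mem_ofFn' _ _).1 hy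
      exact D.grassmann.G_anticomm_perp (D.mem_grassmann_perp _) _
  have h3 : (conj c * (-1) ^ n) • D.wedge e = c • D.wedge e := by
    refine Subtype.ext ?_
    have h4 : D.grassmann.adj (c • (D.wedge e : D.grassmann.Env)) = c • (D.wedge e) := hv_adj
    rw [map_smulₛₗ, h1, smul_smul] at h4
    exact h4
  -- Selfadjointness gives `conj c * (-1)^n = c`; multiplication by `c` and `|c| = 1` then give `c²
  -- = (-1)^n`.
  have h5 := smul_left_injective ℂ (D.wedge_ne_zero hinf π e) h3
  have h6 : c * conj c = 1 := by rw [Complex.mul_conj, Complex.normSq_eq_norm_sq, hc1]; simp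
  calc c * c = c * (conj c * (-1) ^ n) := by rw [show conj c * (-1) ^ n = c from h5]
    _ = (-1) ^ n := by rw [← mul_assoc, h6, one_mul]


variable {H : Type*} [NormedAddCommGroup H] [InnerProductSpace ℂ H] [CompleteSpace H]
variable (D : Triple H)

/-! ### Components of phase space vectors -/

theorem adjGr_one : D.adjGr 1 = 1 := by
  refine Subtype.ext ?_
  change bogoliubov D.refl D.refl_JQ D.refl_inner (star 1) = 1
  rw [star_one, map_one]

theorem adjGr_adjGr (l : D.Gr) : D.adjGr (D.adjGr l) = l := by
  refine Subtype.ext ?_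
  change bogoliubov D.refl D.refl_JQ D.refl_inner
    (star (bogoliubov D.refl D.refl_JQ D.refl_inner (star (l : D.Env)))) = l
  rw [← map_star, star_star]
  exact bogoliubov_bogoliubov _ _ _ D.refl_refl _

theorem rigging_tmul_left (u : D.ran) (l : D.Gr) (η : D.Phase) :
    D.rigging (u ⊗ₜ l) η = D.adjGr l * D.comp u η := by
  induction η using TensorProduct.induction_on with
  | zero => simp [comp]
  | tmul h m => simp [comp, rigging_tmul, adjGr_one]
  | add x y hx hy => rw [map_add, hx, hy, comp, comp, comp, map_add, mul_add]

theorem comp_tmul (u f : D.ran) (l : D.Gr) : D.comp u (f ⊗ₜ l) = ⟪u, f⟫_ℂ • l := by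
  rw [comp, rigging_tmul, adjGr_one, one_mul]

theorem comp_add (u : D.ran) (ξ η : D.Phase) : D.comp u (ξ + η) = D.comp u ξ + D.comp u η :=
  map_add _ _ _

theorem comp_sub (u : D.ran) (ξ η : D.Phase) : D.comp u (ξ - η) = D.comp u ξ - D.comp u η :=
  map_sub _ _ _

theorem comp_smul (u : D.ran) (c : ℂ) (ξ : D.Phase) : D.comp u (c • ξ) = c • D.comp u ξ :=
  map_smul _ _ _

theorem comp_sum {ι : Type*} (s : Finset ι) (u : D.ran) (ξ : ι → D.Phase) :
    D.comp u (∑ i ∈ s, ξ i) = ∑ i ∈ s, D.comp u (ξ i) := map_sum _ _ _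

variable {N : ℕ} (e : OrthonormalBasis (Fin N) ℂ D.ran)

theorem phase_eq_sum (ξ : D.Phase) : ξ = ∑ i, e i ⊗ₜ D.comp (e i) ξ := by
  induction ξ using TensorProduct.induction_on with
  | zero => simp [comp]
  | tmul h m =>
    nth_rw 1 [← e.sum_repr' h]
    simp_rw [TensorProduct.sum_tmul, comp_tmul, TensorProduct.smul_tmul]
  | add x y hx hy =>
    nth_rw 1 [hx, hy]
    simp_rw [comp_add, TensorProduct.tmul_add, Finset.sum_add_distrib]

theorem comp_eq_sum (u : D.ran) (ξ : D.Phase) :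
    D.comp u ξ = ∑ i, ⟪u, e i⟫_ℂ • D.comp (e i) ξ := by
  nth_rw 1 [D.phase_eq_sum e ξ]
  simp_rw [comp_sum, comp_tmul]

theorem comp_mem_GrOdd (u : D.ran) (ξ : D.PhaseEven) : D.comp u ξ ∈ D.GrOdd := by
  obtain ⟨ξ, t, rfl⟩ := ξ
  change D.comp u (TensorProduct.map LinearMap.id D.GrOdd.subtype t) ∈ _
  induction t using TensorProduct.induction_on with
  | zero => simp [comp]
  | tmul h m =>
    rw [TensorProduct.map_tmul, comp_tmul]
    exact D.GrOdd.smul_mem _ m.2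
  | add x y hx hy => rw [map_add, comp_add]; exact add_mem hx hy

theorem isOdd_comp (u : D.ran) (ξ : D.PhaseEven) : D.IsOdd (D.comp u ξ : D.Gr) :=
  D.isOdd_of_mem_GrOdd (D.comp_mem_GrOdd u ξ)

/-- The even phase space vector with prescribed odd components. -/
noncomputable def ofComponents (x : Fin N → D.GrOdd) : D.PhaseEven :=
  ⟨∑ i, e i ⊗ₜ (x i : D.Gr), Submodule.sum_mem _ fun i _ => ⟨e i ⊗ₜ x i, by simp⟩⟩

theorem comp_ofComponents (x : Fin N → D.GrOdd) (i : Fin N) :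
    D.comp (e i) (D.ofComponents e x) = x i := by
  change D.comp (e i) (∑ j, e j ⊗ₜ (x j : D.Gr)) = _
  simp_rw [comp_sum, comp_tmul, orthonormal_iff_ite.1 e.orthonormal]
  simp

theorem G_mem_GrOdd (f : D.perp) : (⟨D.G (f : H), D.G_mem_Gr f⟩ : D.Gr) ∈ D.GrOdd :=
  Submodule.le_topologicalClosure _ (Submodule.subset_span ⟨[f], by simp, by simp⟩)

variable {e} in
-- In a real basis the components of `ξ⋆` are the adjoints of those of `ξ`, and the rigging map is
-- antilinear in its first argument through a second adjoint. The two cancel, leaving a bilinear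
-- pairing.
theorem rigging_phaseConj (he : D.IsRealBasis e) (ξ : D.PhaseEven) (η : D.Phase) :
    D.rigging (D.phaseConj ξ) η = ∑ i, D.comp (e i) ξ * D.comp (e i) η := by
  have h1 : D.phaseConj ξ = ∑ i, e i ⊗ₜ D.adjGr (D.comp (e i) ξ) := by
    change TensorProduct.map D.Jran.toLinearMap D.adjGr (ξ : D.Phase) = _
    nth_rw 1 [D.phase_eq_sum e ξ]
    rw [map_sum]
    refine Finset.sum_congr rfl fun i _ => ?_
    rw [TensorProduct.map_tmul]
    congr 1
    exact he i
  rw [h1, map_sum, LinearMap.sum_apply]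
  simp_rw [rigging_tmul_left, adjGr_adjGr]

theorem Phi_tmul (f : D.ran) (l : D.Gr) :
    D.Phi (f ⊗ₜ l) = (⟨D.G f, D.G_mem_GAR f⟩ : D.GAR) * D.incl l := by
  simp [Phi]

theorem Phi_eq_sum (ξ : D.Phase) :
    D.Phi ξ = ∑ i, (⟨D.G (e i : H), D.G_mem_GAR _⟩ : D.GAR) * D.incl (D.comp (e i) ξ) := by
  nth_rw 1 [D.phase_eq_sum e ξ]
  simp_rw [map_sum, Phi_tmul]

/-! ### Polynomial functions on the phase space -/

/-- The component functions `ξ ↦ ξ_u`. -/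
noncomputable def compFun (u : D.ran) : D.Fun := fun ξ => D.comp u ξ

theorem list_prod_compFun_apply (l : List D.ran) (ξ : D.PhaseEven) :
    (l.map D.compFun).prod ξ = (l.map fun u => D.comp u ξ).prod := by
  induction l with
  | nil => rfl
  | cons u l ih => simp only [List.map_cons, List.prod_cons, Pi.mul_apply, ih]; rfl

section Poly

variable {R : Type*} [Ring R] [Algebra ℂ R] (j : D.Gr →ₐ[ℂ] R)

/-- The functions of degree less than `k`: linear combinations of `ξ ↦ X ξ_{u₁} ⋯ ξ_{uₘ}`, `m < k`,
with values in an algebra over the Grassmann part. -/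
def polyFun (k : ℕ) : Submodule ℂ (D.PhaseEven → R) :=
  Submodule.span ℂ {M | ∃ (X : R) (l : List D.ran), l.length < k ∧
    M = fun ξ => X * j ((l.map D.compFun).prod ξ)}

/-- Odd elements of the Grassmann part can be moved to the right of every element. -/
def PassesOdd : Prop := ∀ b : R, ∃ b' : R, ∀ x ∈ D.GrOdd, j x * b = b' * j x

variable {D j}

theorem generator_mem_polyFun {k : ℕ} (X : R) {l : List D.ran} (h : l.length < k) :
    (fun ξ => X * j ((l.map D.compFun).prod ξ)) ∈ D.polyFun j k :=
  Submodule.subset_span ⟨X, l, h, rfl⟩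

theorem polyFun_mono {k m : ℕ} (h : k ≤ m) : D.polyFun j k ≤ D.polyFun j m := by
  refine Submodule.span_mono ?_
  rintro _ ⟨X, l, hl, rfl⟩
  exact ⟨X, l, hl.trans_le h, rfl⟩

theorem const_mem_polyFun (X : R) {k : ℕ} (hk : 0 < k) : (fun _ => X) ∈ D.polyFun j k := by
  have := generator_mem_polyFun (D := D) (j := j) (k := k) X (l := []) hk
  simpa using this

theorem comp_mem_polyFun (u : D.ran) {k : ℕ} (hk : 1 < k) :
    (fun ξ : D.PhaseEven => j (D.comp u ξ)) ∈ D.polyFun j k := by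
  have := generator_mem_polyFun (D := D) (j := j) (k := k) 1 (l := [u]) hk
  simp only [List.map_cons, List.map_nil, List.prod_singleton, one_mul] at this
  exact this

theorem PassesOdd.list (hj : D.PassesOdd j) (l : List D.ran) (b : R) : ∃ b' : R,
    ∀ ξ : D.PhaseEven, j ((l.map D.compFun).prod ξ) * b = b' * j ((l.map D.compFun).prod ξ) := by
  induction l generalizing b with
  | nil => exact ⟨b, by simp⟩
  | cons u l ih =>
    obtain ⟨b1, h1⟩ := ih b
    obtain ⟨b2, h2⟩ := hj b1
    refine ⟨b2, fun ξ => ?_⟩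
    rw [List.map_cons, List.prod_cons, Pi.mul_apply, map_mul, mul_assoc, h1, ← mul_assoc,
      show j (D.compFun u ξ) * b1 = b2 * j (D.compFun u ξ) from h2 _ (D.comp_mem_GrOdd u ξ), mul_assoc]

/-- Coefficients are collected on the left by moving the second one through the first monomial. The
degrees are at most `k - 1` and `m - 1`, so the product has degree less than `k + m - 1`. -/
theorem mul_mem_polyFun (hj : D.PassesOdd j) {k m r : ℕ} (hr : k + m ≤ r + 1)
    {F G : D.PhaseEven → R} (hF : F ∈ D.polyFun j k) (hG : G ∈ D.polyFun j m) :
    F * G ∈ D.polyFun j r := by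
  induction hF using Submodule.span_induction with
  | zero => rw [zero_mul]; exact zero_mem _
  | add x y _ _ hx hy => rw [add_mul]; exact add_mem hx hy
  | smul c x _ hx => rw [smul_mul_assoc]; exact Submodule.smul_mem _ _ hx
  | mem F hF =>
    obtain ⟨X, l, hl, rfl⟩ := hF
    induction hG using Submodule.span_induction with
    | zero => rw [mul_zero]; exact zero_mem _
    | add x y _ _ hx hy => rw [mul_add]; exact add_mem hx hy
    | smul c x _ hx => rw [mul_smul_comm]; exact Submodule.smul_mem _ _ hx
    | mem G hG =>
      obtain ⟨Y, l', hl', rfl⟩ := hG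
      obtain ⟨Y', hY⟩ := hj.list l Y
      have : (fun ξ => X * j ((l.map D.compFun).prod ξ)) * (fun ξ => Y * j ((l'.map D.compFun).prod ξ))
          = fun ξ => (X * Y') * j (((l ++ l').map D.compFun).prod ξ) := by
        funext ξ
        rw [Pi.mul_apply, List.map_append, List.prod_append, Pi.mul_apply, map_mul, mul_assoc,
          ← mul_assoc _ Y, hY]
        simp only [mul_assoc]
      rw [this]
      exact generator_mem_polyFun _ (by rw [List.length_append]; omega)

end Poly

theorem passesOdd_id : D.PassesOdd (AlgHom.id ℂ D.Gr) := fun b =>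
  ⟨D.parityGr b, fun x hx => by
    have h := (D.isOdd_of_mem_GrOdd hx).2 b (D.Gr_le_GAR b.2)
    rw [AlgHom.id_apply, Subtype.ext_iff, Subalgebra.coe_mul, Subalgebra.coe_mul, h, coe_parityGr]⟩

theorem coe_incl (X : D.Gr) : (D.incl X : D.Env) = X := by
  unfold incl
  exact Subalgebra.coe_inclusion D.Gr_le_GAR X

theorem passesOdd_incl : D.PassesOdd D.incl := fun b =>
  ⟨D.parityGAR b, fun x hx => by
    have h := (D.isOdd_of_mem_GrOdd hx).2 b b.2
    rw [Subtype.ext_iff, Subalgebra.coe_mul, Subalgebra.coe_mul, coe_incl, h, coe_parityGAR]⟩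

/-- Polynomial functions with values in the Grassmann part. -/
noncomputable abbrev polyGr (k : ℕ) : Submodule ℂ D.Fun := D.polyFun (AlgHom.id ℂ D.Gr) k

/-- Polynomial functions with values in the GAR algebra. -/
noncomputable abbrev polyGAR (k : ℕ) : Submodule ℂ (D.PhaseEven → D.GAR) := D.polyFun D.incl k

variable {D} in
theorem isGHolomorphic_of_mem {k : ℕ} {F : D.Fun} (h : F ∈ D.polyGr k) : D.IsGHolomorphic F := by
  refine Submodule.span_mono ?_ h
  rintro _ ⟨X, l, -, rfl⟩
  exact ⟨X, l, funext fun ξ => congrArg (X * ·) (D.list_prod_compFun_apply l ξ)⟩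

variable {D} in
theorem IsGHolomorphic.exists_mem {F : D.Fun} (h : D.IsGHolomorphic F) : ∃ k, F ∈ D.polyGr k := by
  unfold IsGHolomorphic at h
  induction h using Submodule.span_induction with
  | zero => exact ⟨0, zero_mem _⟩
  | add x y _ _ hx hy =>
    obtain ⟨k, hx⟩ := hx
    obtain ⟨m, hy⟩ := hy
    exact ⟨max k m, add_mem (polyFun_mono (le_max_left _ _) hx) (polyFun_mono (le_max_right _ _) hy)⟩
  | smul c x _ hx =>
    obtain ⟨k, hx⟩ := hx
    exact ⟨k, Submodule.smul_mem _ _ hx⟩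
  | mem F hF =>
    obtain ⟨X, l, rfl⟩ := hF
    refine ⟨l.length + 1, ?_⟩
    have := generator_mem_polyFun (D := D) (j := AlgHom.id ℂ D.Gr) X (Nat.lt_succ_self l.length)
    simpa only [AlgHom.id_apply, list_prod_compFun_apply] using this

variable {D} in
theorem IsGHolomorphic.add {F G : D.Fun} (hF : D.IsGHolomorphic F) (hG : D.IsGHolomorphic G) :
    D.IsGHolomorphic (F + G) := add_mem (S := Submodule ℂ D.Fun) hF hG

variable {D} in
theorem IsGHolomorphic.mul {F G : D.Fun} (hF : D.IsGHolomorphic F) (hG : D.IsGHolomorphic G) :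
    D.IsGHolomorphic (F * G) := by
  obtain ⟨k, hF⟩ := hF.exists_mem
  obtain ⟨m, hG⟩ := hG.exists_mem
  exact isGHolomorphic_of_mem (mul_mem_polyFun D.passesOdd_id (Nat.le_succ _) hF hG)

theorem isGHolomorphic_const (X : D.Gr) : D.IsGHolomorphic fun _ => X :=
  isGHolomorphic_of_mem (const_mem_polyFun X one_pos)

theorem isGHolomorphic_comp (u : D.ran) : D.IsGHolomorphic (D.compFun u) :=
  isGHolomorphic_of_mem (comp_mem_polyFun u one_lt_two)

/-- A bounded right module homomorphism maps polynomials to polynomials. -/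
theorem map_mem_polyGr (φ : D.RightModuleHom) {k : ℕ} {F : D.PhaseEven → D.GAR}
    (hF : F ∈ D.polyGAR k) : (fun ξ => φ (F ξ)) ∈ D.polyGr k := by
  induction hF using Submodule.span_induction with
  | zero =>
    have : (fun ξ : D.PhaseEven => φ ((0 : D.PhaseEven → D.GAR) ξ)) = 0 :=
      funext fun ξ => φ.toContinuousLinearMap.map_zero
    rw [this]; exact zero_mem _
  | add x y _ _ hx hy =>
    have : (fun ξ : D.PhaseEven => φ ((x + y) ξ)) = (fun ξ => φ (x ξ)) + fun ξ => φ (y ξ) :=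
      funext fun ξ => φ.toContinuousLinearMap.map_add _ _
    rw [this]; exact add_mem hx hy
  | smul c x _ hx =>
    have : (fun ξ : D.PhaseEven => φ ((c • x) ξ)) = c • fun ξ => φ (x ξ) :=
      funext fun ξ => φ.toContinuousLinearMap.map_smul _ _
    rw [this]; exact Submodule.smul_mem _ _ hx
  | mem F hF =>
    obtain ⟨X, l, hl, rfl⟩ := hF
    have : (fun ξ : D.PhaseEven => φ (X * D.incl ((l.map D.compFun).prod ξ))) =
        fun ξ => φ X * AlgHom.id ℂ D.Gr ((l.map D.compFun).prod ξ) :=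
      funext fun ξ => φ.map_mul_right' X _
    rw [this]
    exact generator_mem_polyFun _ hl

/-! ### Ordered monomials -/

/-- Sorting changes only the sign, and a repeated index gives zero after two equal factors are
brought together. The bound on the cardinality keeps track of the degree. -/
theorem list_prod_anticomm {ι R : Type*} [LinearOrder ι] [Ring R] [Algebra ℂ R] (x : ι → R)
    (hx : ∀ i j, x i * x j = -(x j * x i)) (l : List ι) :
    (l.map x).prod = 0 ∨ ∃ I : Finset ι, I.card ≤ l.length ∧
      ((l.map x).prod = (I.sort.map x).prod ∨ (l.map x).prod = -(I.sort.map x).prod) := by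
  have hperm : ∀ {l l' : List ι}, l.Perm l' →
      (l.map x).prod = (l'.map x).prod ∨ (l.map x).prod = -(l'.map x).prod := by
    intro l l' h
    induction h with
    | nil => exact Or.inl rfl
    | cons i _ ih =>
      rcases ih with h | h
      · left; rw [List.map_cons, List.prod_cons, h]; rfl
      · right; rw [List.map_cons, List.prod_cons, h, mul_neg]; rfl
    | swap i j l =>
      right
      simp only [List.map_cons, List.prod_cons, ← mul_assoc]
      rw [hx j i, neg_mul]
    | trans _ _ h1 h2 =>
      rcases h1 with h1 | h1 <;> rcases h2 with h2 | h2 <;> rw [h1, h2] <;> simp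
  have hself : ∀ i, x i * x i = 0 := fun i => eq_zero_of_eq_neg_self (hx i i)
  by_cases hl : l.Nodup
  · refine Or.inr ⟨l.toFinset, l.toFinset_card_le, hperm ?_⟩
    refine (List.perm_of_nodup_nodup_toFinset_eq hl (Finset.sort_nodup _ _) ?_)
    rw [Finset.sort_toFinset]
  · left
    obtain ⟨i, hi⟩ := List.exists_duplicate_iff_not_nodup.2 hl
    obtain ⟨l', hl'⟩ := (List.duplicate_iff_sublist.1 hi).exists_perm_append
    have h0 : (([i, i] ++ l').map x).prod = 0 := by
      simp [← mul_assoc, hself]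
    rcases hperm hl' with h | h <;> rw [h, h0]
    simp

/-- Ordered monomials as elements of the ring of functions. -/
theorem monomial_eq (I : Finset (Fin N)) :
    D.monomial e I = (I.sort.map fun i => D.compFun (e i)).prod := by
  funext ξ
  have := D.list_prod_compFun_apply (I.sort.map e) ξ
  rw [List.map_map, List.map_map] at this
  exact this.symm

theorem comp_anticomm (u u' : D.ran) (ξ ξ' : D.PhaseEven) :
    D.comp u ξ * D.comp u' ξ' = -(D.comp u' ξ' * D.comp u ξ) := by
  have h := (D.isOdd_comp u ξ).anticomm (D.isOdd_comp u' ξ') (D.Gr_le_GAR (D.comp u' ξ').2)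
  rw [Subtype.ext_iff, Subalgebra.coe_mul, h, NegMemClass.coe_neg, Subalgebra.coe_mul]

theorem compFun_anticomm (u u' : D.ran) :
    D.compFun u * D.compFun u' = -(D.compFun u' * D.compFun u) :=
  funext fun ξ => D.comp_anticomm u u' ξ ξ

theorem compFun_eq_sum (u : D.ran) : D.compFun u = ∑ i, ⟪u, e i⟫_ℂ • D.compFun (e i) := by
  funext ξ
  simp only [Finset.sum_apply, Pi.smul_apply]
  exact D.comp_eq_sum e u ξ

/-- Each `ξ_u` is expanded in the basis, and the resulting words in the basis components are then
sorted. -/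
theorem list_prod_compFun_mem (l : List D.ran) :
    (l.map D.compFun).prod ∈
      Submodule.span ℂ {M : D.Fun | ∃ I : Finset (Fin N), I.card ≤ l.length ∧ M = D.monomial e I} := by
  have h1 : (l.map D.compFun).prod ∈ Submodule.span ℂ {M : D.Fun | ∃ l' : List (Fin N),
      l'.length = l.length ∧ M = (l'.map fun i => D.compFun (e i)).prod} := by
    induction l with
    | nil => exact Submodule.subset_span ⟨[], rfl, rfl⟩
    | cons u l ih =>
      rw [List.map_cons, List.prod_cons]
      generalize (l.map D.compFun).prod = P at ih ⊢
      induction ih using Submodule.span_induction with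
      | zero => rw [mul_zero]; exact zero_mem _
      | add x y _ _ hx hy => rw [mul_add]; exact add_mem hx hy
      | smul c x _ hx => rw [mul_smul_comm]; exact Submodule.smul_mem _ _ hx
      | mem M hM =>
        obtain ⟨l', hl', rfl⟩ := hM
        rw [D.compFun_eq_sum e u, Finset.sum_mul]
        refine Submodule.sum_mem _ fun i _ => ?_
        rw [smul_mul_assoc]
        refine Submodule.smul_mem _ _ (Submodule.subset_span ⟨i :: l', by simp [hl'], ?_⟩)
        rw [List.map_cons, List.prod_cons]
  refine Submodule.span_le.2 ?_ h1
  rintro _ ⟨l', hl', rfl⟩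
  rw [SetLike.mem_coe]
  rcases list_prod_anticomm (fun i => D.compFun (e i)) (fun i j => D.compFun_anticomm _ _) l' with
    h | ⟨I, hI, h | h⟩ <;> rw [h]
  · exact zero_mem _
  · exact Submodule.subset_span ⟨I, hl' ▸ hI, (D.monomial_eq e I).symm⟩
  · exact neg_mem (Submodule.subset_span ⟨I, hl' ▸ hI, (D.monomial_eq e I).symm⟩)

/-- The vanishing clause is what separates the top coefficient: for `k = N` the expansion has no
term of highest degree. -/
theorem exists_coefficients {k : ℕ} {F : D.Fun} (hF : F ∈ D.polyGr k) :
    ∃ a : Finset (Fin N) → D.Gr, (∀ ξ, F ξ = ∑ I, a I * D.monomial e I ξ) ∧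
      ∀ I, k ≤ I.card → a I = 0 := by
  classical
  induction hF using Submodule.span_induction with
  | zero => exact ⟨0, by simp⟩
  | add x y _ _ hx hy =>
    obtain ⟨a, ha, ha'⟩ := hx
    obtain ⟨b, hb, hb'⟩ := hy
    refine ⟨a + b, fun ξ => ?_, fun I hI => ?_⟩
    · simp only [Pi.add_apply, add_mul, Finset.sum_add_distrib, ha, hb]
    · rw [Pi.add_apply, ha' I hI, hb' I hI, add_zero]
  | smul c x _ hx =>
    obtain ⟨a, ha, ha'⟩ := hx
    refine ⟨c • a, fun ξ => ?_, fun I hI => ?_⟩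
    · simp only [Pi.smul_apply, smul_mul_assoc, ← Finset.smul_sum, ha]
    · rw [Pi.smul_apply, ha' I hI, smul_zero]
  | mem F hF =>
    obtain ⟨X, l, hl, rfl⟩ := hF
    have h := D.list_prod_compFun_mem e l
    simp only [AlgHom.id_apply]
    generalize (l.map D.compFun).prod = P at h ⊢
    induction h using Submodule.span_induction with
    | zero => exact ⟨0, by simp⟩
    | add x y _ _ hx hy =>
      obtain ⟨a, ha, ha'⟩ := hx
      obtain ⟨b, hb, hb'⟩ := hy
      refine ⟨a + b, fun ξ => ?_, fun I hI => ?_⟩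
      · simp only [Pi.add_apply, add_mul, mul_add, Finset.sum_add_distrib, ha, hb]
      · rw [Pi.add_apply, ha' I hI, hb' I hI, add_zero]
    | smul c x _ hx =>
      obtain ⟨a, ha, ha'⟩ := hx
      refine ⟨c • a, fun ξ => ?_, fun I hI => ?_⟩
      · simp only [Pi.smul_apply, smul_mul_assoc, mul_smul_comm, ← Finset.smul_sum, ha]
      · rw [Pi.smul_apply, ha' I hI, smul_zero]
    | mem M hM =>
      obtain ⟨I, hI, rfl⟩ := hM
      refine ⟨Pi.single I X, fun ξ => ?_, fun J hJ => ?_⟩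
      · rw [Finset.sum_eq_single I]
        · rw [Pi.single_eq_same]
        · intro J _ hJ; rw [Pi.single_eq_of_ne hJ, zero_mul]
        · simp
      · refine Pi.single_eq_of_ne ?_ _
        rintro rfl
        omega


variable {H : Type*} [NormedAddCommGroup H] [InnerProductSpace ℂ H] [CompleteSpace H]
variable (D : Triple H) {N : ℕ} (e : OrthonormalBasis (Fin N) ℂ D.ran)

/-! ### The coefficient of highest degree -/

theorem monomial_univ (ξ : D.PhaseEven) :
    D.monomial e Finset.univ ξ = (List.ofFn fun i => D.comp (e i) ξ).prod := by
  rw [monomial, List.ofFn_eq_map]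
  congr 2
  exact Fin.sort_univ N

theorem monomial_univ_eq_det_smul {e e' : OrthonormalBasis (Fin N) ℂ D.ran}
    (he : D.IsRealBasis e) (he' : D.IsRealBasis e') (ξ : D.PhaseEven) :
    D.monomial e' Finset.univ ξ = e.toBasis.det e' • D.monomial e Finset.univ ξ := by
  -- The map `u ↦ ξ_u` is antilinear; composition with `J` makes it linear without changing its
  -- values on real basis vectors.
  let f : D.ran →ₗ[ℂ] D.Gr :=
    { toFun := fun u => D.comp (D.Jran u) ξ
      map_add' := fun u w => by
        have h1 : D.Jran (u + w) = D.Jran u + D.Jran w := map_add D.Jran.toLinearMap u w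
        rw [h1, comp, TensorProduct.add_tmul, map_add]; rfl
      map_smul' := fun c u => by
        have h1 : D.Jran (c • u) = conj c • D.Jran u := map_smulₛₗ D.Jran.toLinearMap c u
        rw [h1, comp, ← TensorProduct.smul_tmul', LinearMap.map_smulₛₗ, Complex.conj_conj]; rfl }
  have hf : ∀ x, f x * f x = 0 := fun x => eq_zero_of_eq_neg_self (D.comp_anticomm _ _ ξ ξ)
  have h := ofFn_prod_eq_det_smul f hf e.toBasis e'.toBasis
  simp only [OrthonormalBasis.coe_toBasis] at h
  have h1 : ∀ i, f (e i) = D.comp (e i) ξ := fun i => congrArg (D.comp · (ξ : D.Phase)) (he i)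
  have h2 : ∀ i, f (e' i) = D.comp (e' i) ξ := fun i => congrArg (D.comp · (ξ : D.Phase)) (he' i)
  simp only [h1, h2] at h
  rw [monomial_univ, monomial_univ, h]

theorem list_prod_comp_smul (l : List D.ran) (t : ℂ) (ξ : D.PhaseEven) :
    (l.map D.compFun).prod (t • ξ) = t ^ l.length • (l.map D.compFun).prod ξ := by
  induction l with
  | nil => simp
  | cons u l ih =>
    simp only [List.map_cons, List.prod_cons, Pi.mul_apply, ih, List.length_cons]
    have : D.compFun u (t • ξ) = t • D.compFun u ξ := D.comp_smul u t ξ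
    rw [this, smul_mul_smul_comm, pow_succ']

/-- Growth of a polynomial function of degree less than `k` along a ray. -/
theorem growth_of_mem_polyGr {k : ℕ} {F : D.Fun} (hF : F ∈ D.polyGr k) (ξ : D.PhaseEven) :
    ∃ C : ℝ, ∀ t : ℝ, 1 ≤ t → t * ‖F ((t : ℂ) • ξ)‖ ≤ C * t ^ k := by
  induction hF using Submodule.span_induction with
  | zero => exact ⟨0, fun t _ => by simp⟩
  | add x y _ _ hx hy =>
    obtain ⟨C, hC⟩ := hx
    obtain ⟨C', hC'⟩ := hy
    refine ⟨C + C', fun t ht => ?_⟩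
    calc t * ‖(x + y) ((t : ℂ) • ξ)‖ ≤ t * (‖x ((t : ℂ) • ξ)‖ + ‖y ((t : ℂ) • ξ)‖) := by
          gcongr; exact norm_add_le _ _
      _ ≤ (C + C') * t ^ k := by linarith [hC t ht, hC' t ht]
  | smul c x _ hx =>
    obtain ⟨C, hC⟩ := hx
    refine ⟨‖c‖ * C, fun t ht => ?_⟩
    rw [Pi.smul_apply, norm_smul, mul_left_comm, mul_assoc]
    exact mul_le_mul_of_nonneg_left (hC t ht) (norm_nonneg _)
  | mem F hF =>
    obtain ⟨X, l, hl, rfl⟩ := hF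
    -- A monomial of length `m < k` scales like `t^m`; the extra factor `t` in the estimate avoids
    -- the exponent `k - 1`, also for `k = 0`.
    refine ⟨‖X * (l.map D.compFun).prod ξ‖, fun t ht => ?_⟩
    simp only [AlgHom.id_apply]
    rw [list_prod_comp_smul, mul_smul_comm, norm_smul, norm_pow, Complex.norm_real,
      Real.norm_of_nonneg (by linarith), ← mul_assoc, ← pow_succ', mul_comm]
    exact mul_le_mul_of_nonneg_left (pow_le_pow_right₀ ht hl) (norm_nonneg _)

/-- `Y` is the coefficient of highest degree of `F` with respect to the basis `e`. -/
def HasTop (F : D.Fun) (Y : D.Gr) : Prop :=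
  (F - fun ξ => Y * D.monomial e Finset.univ ξ) ∈ D.polyGr N

variable {D e}

theorem HasTop.add {F G : D.Fun} {X Y : D.Gr} (hF : D.HasTop e F X) (hG : D.HasTop e G Y) :
    D.HasTop e (F + G) (X + Y) := by
  unfold HasTop
  convert add_mem hF hG using 1
  funext ξ
  simp only [Pi.sub_apply, Pi.add_apply, add_mul]
  abel

theorem HasTop.const_mul {F : D.Fun} {Y : D.Gr} (hF : D.HasTop e F Y) (X : D.Gr) :
    D.HasTop e (fun ξ => X * F ξ) (X * Y) := by
  have h := mul_mem_polyFun D.passesOdd_id (k := 1) (m := N) (r := N) (by omega)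
    (const_mem_polyFun X one_pos) hF
  unfold HasTop
  convert h using 1
  funext ξ
  simp only [Pi.sub_apply, Pi.mul_apply, mul_sub, mul_assoc]

theorem HasTop.smul {F : D.Fun} {Y : D.Gr} (hF : D.HasTop e F Y) (c : ℂ) :
    D.HasTop e (c • F) (c • Y) := by
  unfold HasTop
  convert Submodule.smul_mem _ c hF using 1
  funext ξ
  simp only [Pi.sub_apply, Pi.smul_apply, smul_sub, smul_mul_assoc]

theorem hasTop_of_mem {F : D.Fun} (hF : F ∈ D.polyGr N) : D.HasTop e F 0 := by
  unfold HasTop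
  convert hF using 1
  funext ξ
  simp

theorem monomial_mem (I : Finset (Fin N)) {k : ℕ} (hk : I.card < k) :
    D.monomial e I ∈ D.polyGr k := by
  have := generator_mem_polyFun (D := D) (j := AlgHom.id ℂ D.Gr) 1 (l := I.sort.map e) (k := k)
    (by simpa using hk)
  simp only [AlgHom.id_apply, one_mul, List.map_map] at this
  rw [monomial_eq]
  exact this

theorem hasTop_of_coefficients {F : D.Fun} {a : Finset (Fin N) → D.Gr}
    (ha : ∀ ξ, F ξ = ∑ I, a I * D.monomial e I ξ) : D.HasTop e F (a Finset.univ) := by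
  classical
  have : (F - fun ξ => a Finset.univ * D.monomial e Finset.univ ξ) =
      ∑ I ∈ Finset.univ.erase Finset.univ, (fun _ => a I) * D.monomial e I := by
    funext ξ
    rw [Pi.sub_apply, ha, ← Finset.add_sum_erase _ _ (Finset.mem_univ Finset.univ),
      add_sub_cancel_left, Finset.sum_apply]
    rfl
  rw [HasTop, this]
  refine Submodule.sum_mem _ fun I hI => ?_
  have hI' : I.card < N := by
    have := Finset.card_lt_univ_of_notMem (s := I) (x := _) 
      (Classical.choose_spec (not_forall.1 fun h => (Finset.mem_erase.1 hI).1
        (Finset.eq_univ_iff_forall.2 h)))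
    simpa using this
  exact mul_mem_polyFun D.passesOdd_id (k := 1) (m := N) (by omega) (const_mem_polyFun _ one_pos)
    (monomial_mem I hI')

variable (e) in
theorem IsGHolomorphic.exists_hasTop {F : D.Fun} (hF : D.IsGHolomorphic F) :
    ∃ Y, D.HasTop e F Y := by
  obtain ⟨k, hF⟩ := hF.exists_mem
  obtain ⟨a, ha, -⟩ := D.exists_coefficients e hF
  exact ⟨_, hasTop_of_coefficients ha⟩

theorem HasTop.exists_coefficients {F : D.Fun} {Y : D.Gr} (hF : D.HasTop e F Y) :
    ∃ a : Finset (Fin N) → D.Gr, (∀ ξ, F ξ = ∑ I, a I * D.monomial e I ξ) ∧ a Finset.univ = Y := by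
  classical
  obtain ⟨a, ha, ha'⟩ := D.exists_coefficients e hF
  refine ⟨a + Pi.single Finset.univ Y, fun ξ => ?_, ?_⟩
  · have h := ha ξ
    rw [Pi.sub_apply, sub_eq_iff_eq_add] at h
    simp only [Pi.add_apply, add_mul, Finset.sum_add_distrib]
    rw [h]
    congr 1
    rw [Finset.sum_eq_single Finset.univ]
    · rw [Pi.single_eq_same]
    · intro J _ hJ; rw [Pi.single_eq_of_ne hJ, zero_mul]
    · simp
  · rw [Pi.add_apply, ha' _ (by simp), Pi.single_eq_same, zero_add]

theorem HasTop.isGHolomorphic {F : D.Fun} {Y : D.Gr} (hF : D.HasTop e F Y) : D.IsGHolomorphic F := by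
  have h1 := isGHolomorphic_of_mem hF
  have h2 := (D.isGHolomorphic_const Y).mul
    (isGHolomorphic_of_mem (monomial_mem (e := e) Finset.univ (Nat.lt_succ_self _)))
  have := h1.add h2
  convert this using 1
  funext ξ
  simp

/-- The top monomial scales like `t^N` along a ray, whereas a function of degree less than `N` grows
at most like `t^(N-1)`; hence `Y` annihilates every value of the monomial. Components `G(g_i)` may
be prescribed, and cancellation of generators gives `Y = 0`. -/
theorem eq_zero_of_monomial_mem (hinf : ¬ FiniteDimensional ℂ D.perp) {Y : D.Gr}
    (h : (fun ξ => Y * D.monomial e Finset.univ ξ) ∈ D.polyGr N) : Y = 0 := by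
  refine Subtype.ext (D.eq_zero_of_mul_list_prod hinf (List.finRange N) (List.nodup_finRange N) Y.2
    fun g => ?_)
  let ξ := D.ofComponents e fun i => ⟨_, D.G_mem_GrOdd (g i)⟩
  have hξ : ((Y * D.monomial e Finset.univ ξ : D.Gr) : D.Env) =
      Y * ((List.finRange N).map fun i => D.G (g i : H)).prod := by
    rw [monomial_univ, Subalgebra.coe_mul, ← Subalgebra.coe_val, map_list_prod,
      List.map_ofFn, List.ofFn_eq_map]
    congr 3
    funext i
    rw [Function.comp_apply, D.comp_ofComponents]
    rfl
  rw [← hξ]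
  obtain ⟨C, hC⟩ := D.growth_of_mem_polyGr h ξ
  have h0 : ‖Y * D.monomial e Finset.univ ξ‖ = 0 := by
    by_contra hne
    have hpos : 0 < ‖Y * D.monomial e Finset.univ ξ‖ := lt_of_le_of_ne (norm_nonneg _) (Ne.symm hne)
    set x := ‖Y * D.monomial e Finset.univ ξ‖ with hx
    have h1 : ∀ t : ℝ, 1 ≤ t → t * x ≤ C := by
      intro t ht
      have ht0 : 0 < t ^ N := by positivity
      have h2 := hC t ht
      rw [monomial_eq] at h2 hx
      have h3 := D.list_prod_comp_smul ((Finset.univ : Finset (Fin N)).sort.map e) t ξ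
      rw [List.map_map] at h3
      change (List.map (fun i => D.compFun (e i)) _).prod _ =
        _ • (List.map (fun i => D.compFun (e i)) _).prod _ at h3
      rw [h3, mul_smul_comm, norm_smul, ← hx, List.length_map, Finset.length_sort, Finset.card_univ,
        Fintype.card_fin, norm_pow, Complex.norm_real, Real.norm_of_nonneg (by linarith),
        mul_left_comm, mul_comm C] at h2
      exact le_of_mul_le_mul_left h2 ht0
    have h4 := h1 (max 1 ((C + 1) / x)) (le_max_left _ _)
    have h5 : (C + 1) / x * x ≤ max 1 ((C + 1) / x) * x :=
      mul_le_mul_of_nonneg_right (le_max_right _ _) hpos.le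
    rw [div_mul_cancel₀ _ hpos.ne'] at h5
    linarith
  rw [norm_eq_zero.1 h0]
  rfl

/-- Subtracting the two expansions leaves a multiple of one top monomial that has degree less than
`N`, so its coefficient vanishes. -/
theorem HasTop.eq_det_smul (hinf : ¬ FiniteDimensional ℂ D.perp)
    {e e' : OrthonormalBasis (Fin N) ℂ D.ran} (he : D.IsRealBasis e) (he' : D.IsRealBasis e')
    {F : D.Fun} {Y Y' : D.Gr} (h : D.HasTop e F Y) (h' : D.HasTop e' F Y') :
    Y = e.toBasis.det e' • Y' := by
  rw [← sub_eq_zero]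
  refine eq_zero_of_monomial_mem (e := e) hinf ?_
  convert sub_mem h' h using 1
  funext ξ
  simp only [Pi.sub_apply, D.monomial_univ_eq_det_smul he he', sub_mul, mul_smul_comm,
    smul_mul_assoc]
  abel

/-- The Grassmann integral is determined by the coefficient of highest degree. -/
theorem integral_eq [FiniteDimensional ℂ D.ran] (hinf : ¬ FiniteDimensional ℂ D.perp)
    (π : CARRep D.JQ) {e : OrthonormalBasis (Fin (Module.finrank ℂ D.ran)) ℂ D.ran}
    (he : D.IsRealBasis e) {v : D.Forms} {c : ℂ} (hv : v = c • D.wedge e) {F : D.Fun} {Y : D.Gr}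
    (hF : D.HasTop e F Y) : D.integral v F = c • Y := by
  have hex : ∃ X, D.IsIntegral v F X := by
    obtain ⟨a, ha, ha'⟩ := hF.exists_coefficients
    exact ⟨c • Y, e, c, a, he, hv, ha, by rw [ha']⟩
  rw [integral, dif_pos hex]
  -- The basis chosen in the definition of the integral may differ from `e`. The coefficients of the
  -- form and of the function both acquire the determinant of the transition matrix, whose square is
  -- `1`.
  obtain ⟨e', c', a', he', hv', ha', hX⟩ := hex.choose_spec
  rw [hX, hF.eq_det_smul hinf he he' (hasTop_of_coefficients ha'), smul_smul]
  congr 1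
  rw [hv, D.wedge_eq_det_smul e e', smul_smul] at hv'
  have h1 : c = c' * e.toBasis.det e' := smul_left_injective ℂ (D.wedge_ne_zero hinf π e) hv'
  rw [h1, mul_assoc, D.det_mul_self he he', mul_one]

/-! ### Parity of monomials -/

theorem comp_mul (u : D.ran) (ξ : D.PhaseEven) (X : D.Gr) :
    D.comp u ξ * X = D.parityGr X * D.comp u ξ := by
  have h := (D.isOdd_comp u ξ).2 X (D.Gr_le_GAR X.2)
  rw [Subtype.ext_iff, Subalgebra.coe_mul, Subalgebra.coe_mul, h, coe_parityGr]

theorem parityGr_involutive : Function.Involutive D.parityGr := fun X =>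
  Subtype.ext (by rw [coe_parityGr, coe_parityGr, parity_parity])

theorem list_prod_mul (l : List D.Gr) (hl : ∀ x ∈ l, ∀ X, x * X = D.parityGr X * x) (X : D.Gr) :
    l.prod * X = D.parityGr^[l.length] X * l.prod := by
  induction l generalizing X with
  | nil => simp
  | cons x l ih =>
    rw [List.prod_cons, mul_assoc, ih fun y hy => hl y (List.mem_cons_of_mem _ hy), ← mul_assoc,
      hl x List.mem_cons_self, mul_assoc, List.length_cons, Function.iterate_succ_apply']

theorem list_prod_mul_comm (l : List D.Gr) (hl : ∀ x ∈ l, ∀ X, x * X = D.parityGr X * x)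
    (heven : Even l.length) (X : D.Gr) : l.prod * X = X * l.prod := by
  rw [list_prod_mul l hl, parityGr_involutive.iterate_even heven, id]

/-- Each component passes through `X` up to parity, and an even number of parities cancel. This is
where the even rank makes the integral linear under right multiplication. -/
theorem monomial_univ_mul_comm (hN : Even N) (ξ : D.PhaseEven) (X : D.Gr) :
    D.monomial e Finset.univ ξ * X = X * D.monomial e Finset.univ ξ := by
  rw [monomial_univ]
  refine list_prod_mul_comm _ (fun x hx X => ?_) (by simpa using hN) X
  obtain ⟨i, rfl⟩ := (List.mem_ofFn' _ _).1 hx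
  exact comp_mul _ _ _

theorem HasTop.mul_const (hN : Even N) {F : D.Fun} {Y : D.Gr} (hF : D.HasTop e F Y) (X : D.Gr) :
    D.HasTop e (fun ξ => F ξ * X) (Y * X) := by
  have h := mul_mem_polyFun D.passesOdd_id (k := N) (m := 1) (r := N) (by omega)
    hF (const_mem_polyFun X one_pos)
  unfold HasTop
  convert h using 1
  funext ξ
  simp only [Pi.sub_apply, Pi.mul_apply, sub_mul, mul_assoc, monomial_univ_mul_comm hN]

end Triple

/-! ### Exponentials in Banach algebras -/

section Exp

variable {R : Type*} [NormedRing R] [NormedAlgebra ℂ R] [CompleteSpace R]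

theorem exp_add_of_commute {a b : R} (h : Commute a b) :
    NormedSpace.exp (a + b) = NormedSpace.exp a * NormedSpace.exp b := by
  let _ : NormedAlgebra ℚ R := NormedAlgebra.restrictScalars ℚ ℂ R
  exact NormedSpace.exp_add_of_commute h

theorem commute_exp_right {a b : R} (h : Commute a b) : Commute a (NormedSpace.exp b) := by
  let _ : NormedAlgebra ℚ R := NormedAlgebra.restrictScalars ℚ ℂ R
  exact SemiconjBy.exp_right h

theorem exp_neg_mul_exp (a : R) : NormedSpace.exp (-a) * NormedSpace.exp a = 1 := by
  rw [← exp_add_of_commute (Commute.refl a).neg_left, neg_add_cancel]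
  exact NormedSpace.exp_zero

theorem exp_of_mul_self {a : R} (h : a * a = 0) : NormedSpace.exp a = 1 + a := by
  have h1 : HasSum (fun n : ℕ => ((n.factorial : ℂ)⁻¹) • a ^ n) (NormedSpace.exp a) :=
    NormedSpace.exp_series_hasSum_exp' a
  refine h1.unique ?_
  have h2 : 1 + a = ∑ n ∈ Finset.range 2, ((n.factorial : ℂ)⁻¹) • a ^ n := by
    simp [Finset.sum_range_succ]
  rw [h2]
  refine hasSum_sum_of_ne_finset_zero fun n hn => ?_
  obtain ⟨k, rfl⟩ : ∃ k, n = 2 + k := ⟨n - 2, by simp at hn; omega⟩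
  rw [pow_add, pow_two, h, zero_mul, smul_zero]

/-- The exponential of a sum of commuting elements with square zero. -/
theorem exp_list_sum {ι : Type*} (z : ι → R) (hc : ∀ i j, Commute (z i) (z j))
    (h0 : ∀ i, z i * z i = 0) (l : List ι) :
    NormedSpace.exp (l.map z).sum = (l.map fun i => z i + 1).prod := by
  induction l with
  | nil => exact NormedSpace.exp_zero
  | cons i l ih =>
    rw [List.map_cons, List.sum_cons, exp_add_of_commute, ih, exp_of_mul_self (h0 i), List.map_cons,
      List.prod_cons, add_comm 1]
    induction l with
    | nil => exact Commute.zero_right _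
    | cons j l ih' =>
      rw [List.map_cons, List.sum_cons]
      clear ih ih'
      refine (hc i j).add_right ?_
      induction l with
      | nil => exact Commute.zero_right _
      | cons k l ih' => rw [List.map_cons, List.sum_cons]; exact (hc i k).add_right ih'

/-- If `c = [a, b]` commutes with `b`, then `a e^b = e^b (a + c)`. -/
theorem mul_exp_of_commutator {a b c : R} (h : a * b = b * a + c) (hbc : Commute b c) :
    a * NormedSpace.exp b = NormedSpace.exp b * (a + c) := by
  -- The commutator with `a` acts on powers of `b` as a derivation.
  have hpow : ∀ n : ℕ, a * b ^ (n + 1) = b ^ (n + 1) * a + ((n + 1 : ℕ) : ℂ) • (b ^ n * c) := by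
    intro n
    induction n with
    | zero => simp [h]
    | succ n ih =>
      rw [pow_succ b (n + 1), ← mul_assoc, ih, add_mul, mul_assoc, h, mul_add, smul_mul_assoc,
        mul_assoc, ← hbc.eq, ← mul_assoc, ← pow_succ, ← mul_assoc, ← pow_succ]
      push_cast
      rw [add_smul ((n : ℂ) + 1) 1, one_smul]
      abel
  have h1 : HasSum (fun n : ℕ => ((n.factorial : ℂ)⁻¹) • b ^ n) (NormedSpace.exp b) :=
    NormedSpace.exp_series_hasSum_exp' b
  have h2 := h1.mul_left a
  have h3 := h1.mul_right a
  have h4 := h1.mul_right c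
  have h5 : HasSum (fun n : ℕ => a * (((n.factorial : ℂ)⁻¹) • b ^ n) -
      (((n.factorial : ℂ)⁻¹) • b ^ n) * a) (NormedSpace.exp b * c) := by
    -- The term of index `0` vanishes; after the shift, `(n + 1) / (n + 1)! = 1 / n!` recovers the
    -- exponential series.
    rw [← hasSum_nat_add_iff' 1]
    simp only [Finset.range_one, Finset.sum_singleton, pow_zero, mul_smul_comm, smul_mul_assoc,
      mul_one, one_mul, sub_self, sub_zero]
    refine Eq.mpr (congrArg (HasSum · _ _) (funext fun n => ?_)) h4
    rw [← smul_sub, hpow, add_sub_cancel_left, smul_smul, smul_mul_assoc]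
    congr 1
    rw [Nat.factorial_succ]
    push_cast
    have h6 : (n : ℂ) + 1 ≠ 0 := by exact_mod_cast Nat.succ_ne_zero n
    have h7 : (n.factorial : ℂ) ≠ 0 := by exact_mod_cast n.factorial_ne_zero
    field_simp
  have h8 := h5.unique (h2.sub h3)
  rw [mul_add, h8]
  abel

/-- The element `e^b` intertwines `a + c` with `a`, hence also their exponentials, and `e^(a+c)`
splits because `a` and `c` commute. -/
theorem exp_mul_exp_of_commutator {a b c : R} (h : a * b = b * a + c) (hac : Commute a c)
    (hbc : Commute b c) : NormedSpace.exp a * NormedSpace.exp b =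
      NormedSpace.exp b * (NormedSpace.exp a * NormedSpace.exp c) := by
  let _ : NormedAlgebra ℚ R := NormedAlgebra.restrictScalars ℚ ℂ R
  have h1 : SemiconjBy (NormedSpace.exp b) (a + c) a := (mul_exp_of_commutator h hbc).symm
  rw [← exp_add_of_commute hac]
  exact h1.exp_right.symm

end Exp

namespace Triple

variable {H : Type*} [NormedAddCommGroup H] [InnerProductSpace ℂ H] [CompleteSpace H]
variable (D : Triple H) {N : ℕ} (e : OrthonormalBasis (Fin N) ℂ D.ran)

instance : CompleteSpace D.GAR := D.isClosed_GAR.completeSpace_coe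

instance : CompleteSpace D.Gr := D.isClosed_Gr.completeSpace_coe

theorem continuous_incl : Continuous D.incl := by
  rw [continuous_induced_rng]
  have : (Subtype.val ∘ D.incl : D.Gr → D.Env) = Subtype.val := funext D.coe_incl
  rw [this]
  exact continuous_subtype_val

theorem incl_exp (x : D.Gr) : D.incl (NormedSpace.exp x) = NormedSpace.exp (D.incl x) := by
  let _ : NormedAlgebra ℚ D.Gr := NormedAlgebra.restrictScalars ℚ ℂ D.Gr
  let _ : NormedAlgebra ℚ D.GAR := NormedAlgebra.restrictScalars ℚ ℂ D.GAR
  exact NormedSpace.map_exp D.incl D.continuous_incl x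

/-! ### Grassmann-Weyl operators -/

/-- The operator `G(f)` as an element of the GAR algebra. -/
noncomputable def gar (f : H) : D.GAR := ⟨D.G f, D.G_mem_GAR f⟩

theorem coe_gar (f : H) : (D.gar f : D.Env) = D.G f := rfl

theorem Phi_tmul_eq_gar (f : D.ran) (l : D.Gr) : D.Phi (f ⊗ₜ l) = D.gar f * D.incl l := D.Phi_tmul f l

theorem Phi_eq_sum_gar (ξ : D.Phase) :
    D.Phi ξ = ∑ i, D.gar (e i : H) * D.incl (D.comp (e i) ξ) := D.Phi_eq_sum e ξ

theorem gar_anticomm (i k : Fin N) (he : D.IsRealBasis e) :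
    D.gar (e i : H) * D.gar (e k : H) + D.gar (e k : H) * D.gar (e i : H) =
      (if i = k then (1 : ℂ) else 0) • (1 : D.GAR) := by
  refine Subtype.ext ?_
  have h := D.G_anticomm (e i : H) (e k : H)
  rw [D.mem_ran.1 (e k).2, show D.J (e i : H) = (e i : H) from congrArg Subtype.val (he i)] at h
  rw [Subalgebra.coe_add, Subalgebra.coe_mul, Subalgebra.coe_mul, coe_gar, coe_gar, h,
    Subalgebra.coe_smul, Subalgebra.coe_one]
  congr 1
  exact orthonormal_iff_ite.1 e.orthonormal i k

theorem incl_mul_gar {x : D.Gr} (hx : x ∈ D.GrOdd) (f : H) :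
    D.incl x * D.gar f = -(D.gar f * D.incl x) := by
  refine Subtype.ext ?_
  rw [Subalgebra.coe_mul, NegMemClass.coe_neg, Subalgebra.coe_mul, coe_incl, coe_gar,
    (D.isOdd_of_mem_GrOdd hx).2 _ (D.G_mem_GAR f), D.parity_G, neg_mul]

theorem odd_anticomm {x y : D.Gr} (hx : x ∈ D.GrOdd) (hy : y ∈ D.GrOdd) : x * y = -(y * x) := by
  have h := (D.isOdd_of_mem_GrOdd hx).anticomm (D.isOdd_of_mem_GrOdd hy) (D.Gr_le_GAR y.2)
  rw [Subtype.ext_iff, Subalgebra.coe_mul, h, NegMemClass.coe_neg, Subalgebra.coe_mul]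

theorem odd_mul_self {x : D.Gr} (hx : x ∈ D.GrOdd) : x * x = 0 :=
  eq_zero_of_eq_neg_self (D.odd_anticomm hx hx)

theorem commute_odd_mul_odd {x y : D.Gr} (hx : x ∈ D.GrOdd) (hy : y ∈ D.GrOdd) (X : D.Gr) :
    Commute X (x * y) := by
  refine Subtype.ext ?_
  have h := (D.isOdd_of_mem_GrOdd hx).mul_mul_comm (D.isOdd_of_mem_GrOdd hy) (D.Gr_le_GAR X.2)
  rw [Subalgebra.coe_mul, Subalgebra.coe_mul, Subalgebra.coe_mul _ (x * y), Subalgebra.coe_mul, h]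

/-- Moving the odd elements to the right turns the two products into `-G(e_i) G(e_k) x y` and
`G(e_k) G(e_i) x y`, so that an anticommutator of Fermi fields becomes a commutator of Bose fields.
-/
theorem gar_mul_odd_commutator {x y : D.Gr} (hx : x ∈ D.GrOdd) (hy : y ∈ D.GrOdd) (i k : Fin N)
    (he : D.IsRealBasis e) :
    D.gar (e i : H) * D.incl x * (D.gar (e k : H) * D.incl y) =
      D.gar (e k : H) * D.incl y * (D.gar (e i : H) * D.incl x) +
        (if i = k then (1 : ℂ) else 0) • D.incl (-(x * y)) := by
  have h1 : D.gar (e i : H) * D.incl x * (D.gar (e k : H) * D.incl y) =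
      -(D.gar (e i : H) * D.gar (e k : H) * D.incl (x * y)) := by
    rw [mul_assoc, ← mul_assoc (D.incl x), D.incl_mul_gar hx, neg_mul, mul_neg, map_mul]
    simp only [mul_assoc]
  have h2 : D.gar (e k : H) * D.incl y * (D.gar (e i : H) * D.incl x) =
      D.gar (e k : H) * D.gar (e i : H) * D.incl (x * y) := by
    rw [mul_assoc, ← mul_assoc (D.incl y), D.incl_mul_gar hy, neg_mul, mul_neg, D.odd_anticomm hx hy,
      map_neg, map_mul]
    simp only [mul_assoc, mul_neg]
  have h3 := congrArg (· * D.incl (x * y)) (D.gar_anticomm e i k he)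
  simp only [add_mul, smul_mul_assoc, one_mul] at h3
  rw [h1, h2, map_neg, smul_neg, ← h3]
  abel

variable {e} in
theorem Phi_commutator (he : D.IsRealBasis e) (ξ η : D.PhaseEven) :
    D.Phi ξ * D.Phi η = D.Phi η * D.Phi ξ +
      D.incl (-∑ i, D.comp (e i) ξ * D.comp (e i) η) := by
  have h : ∀ i k, _ := fun i k =>
    D.gar_mul_odd_commutator e (D.comp_mem_GrOdd (e i) ξ) (D.comp_mem_GrOdd (e k) η) i k he
  rw [D.Phi_eq_sum_gar e ξ, D.Phi_eq_sum_gar e η, Finset.sum_mul_sum, Finset.sum_mul_sum]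
  refine Eq.trans ?_ (congrArg (· + _) Finset.sum_comm)
  rw [← Finset.sum_neg_distrib, map_sum, ← Finset.sum_add_distrib]
  refine Finset.sum_congr rfl fun i _ => ?_
  rw [Finset.sum_congr rfl fun k _ => h i k, Finset.sum_add_distrib]
  congr 1
  simp

theorem Gr_mul_G {x : D.Env} (hx : x ∈ D.Gr) (f : H) : x * D.G f = D.G f * parity D.JQ x := by
  refine D.mem_Gr_induction (p := fun x => x * D.G f = D.G f * parity D.JQ x)
    (isClosed_eq (by fun_prop) (continuous_const.mul (continuous_parity _)))
    (fun g hg => ?_) (fun c => ?_) (fun x y hx hy => ?_) (fun x y hx hy => ?_) hx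
  · rw [D.parity_G, D.G_anticomm_perp hg, mul_neg]
  · rw [AlgHomClass.commutes]; exact Algebra.commutes _ _
  · rw [map_add, add_mul, mul_add, hx, hy]
  · rw [map_mul, mul_assoc, hy, ← mul_assoc, hx, mul_assoc]

/-- Passing `G(f)` twists `X` by the parity, and passing the odd element `m` undoes the twist.
Therefore the fields, Weyl operators and translations are compatible with the Grassmann part. -/
theorem commute_incl_gar_mul (X : D.Gr) (f : H) {m : D.Gr} (hm : m ∈ D.GrOdd) :
    Commute (D.incl X) (D.gar f * D.incl m) := by
  have h1 := D.Gr_mul_G X.2 f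
  have h2 := (D.isOdd_of_mem_GrOdd hm).2 _ (D.Gr_le_GAR X.2)
  refine Subtype.ext ?_
  rw [Subalgebra.coe_mul, Subalgebra.coe_mul, Subalgebra.coe_mul _ (D.gar f * D.incl m),
    Subalgebra.coe_mul, coe_incl, coe_incl, coe_gar, ← mul_assoc, h1, mul_assoc, mul_assoc, h2]

theorem commute_incl_Phi (X : D.Gr) (η : D.PhaseEven) : Commute (D.incl X) (D.Phi η) := by
  have h : ∀ t : D.ran ⊗[ℂ] D.GrOdd,
      Commute (D.incl X) (D.Phi (TensorProduct.map LinearMap.id D.GrOdd.subtype t)) := by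
    intro t
    induction t using TensorProduct.induction_on with
    | zero => rw [map_zero, map_zero]; exact Commute.zero_right _
    | add x y hx hy => rw [map_add, map_add]; exact hx.add_right hy
    | tmul f m =>
      rw [TensorProduct.map_tmul, Phi_tmul_eq_gar]
      exact D.commute_incl_gar_mul X f m.2
  obtain ⟨t, ht⟩ := η.2
  rw [← ht]
  exact h t

theorem commute_incl_weyl (X : D.Gr) (η : D.PhaseEven) : Commute (D.incl X) (D.weyl η) :=
  commute_exp_right (D.commute_incl_Phi X η)

theorem translate_mul_incl (η : D.PhaseEven) (A : D.GAR) (X : D.Gr) :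
    D.translate η (A * D.incl X) = D.translate η A * D.incl X := by
  rw [translate, translate, mul_assoc (D.weyl (-η) * A), ← (D.commute_incl_weyl X η).eq]
  simp only [mul_assoc]

theorem weyl_neg_mul (η : D.PhaseEven) : D.weyl (-η) * D.weyl η = 1 := by
  have h : D.Phi ((-η : D.PhaseEven) : D.Phase) = -D.Phi η := by
    rw [← map_neg]; rfl
  rw [weyl, weyl, h]
  exact exp_neg_mul_exp _

variable {e} in
/-- Phase space translations multiply the Grassmann-Weyl operators by Grassmann exponentials. -/
theorem translate_weyl (he : D.IsRealBasis e) (ζ η : D.PhaseEven) :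
    D.translate η (D.weyl ζ) =
      D.weyl ζ * D.incl (NormedSpace.exp (-∑ i, D.comp (e i) ζ * D.comp (e i) η)) := by
  have h := exp_mul_exp_of_commutator (D.Phi_commutator he ζ η) (D.commute_incl_Phi _ ζ).symm
    (D.commute_incl_Phi _ η).symm
  rw [← incl_exp] at h
  rw [translate, mul_assoc]
  change D.weyl (-η) * (NormedSpace.exp (D.Phi ζ) * NormedSpace.exp (D.Phi η)) = _
  rw [h, ← mul_assoc]
  change D.weyl (-η) * D.weyl η * _ = _
  rw [D.weyl_neg_mul, one_mul]
  rfl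

theorem weyl_add_of_commute {ζ η : D.PhaseEven} (h : Commute (D.Phi ζ) (D.Phi η)) :
    D.weyl (ζ + η) = D.weyl ζ * D.weyl η := by
  have h1 : D.Phi ((ζ + η : D.PhaseEven) : D.Phase) = D.Phi ζ + D.Phi η := by
    rw [← map_add]; rfl
  rw [weyl, h1]
  exact exp_add_of_commute h

theorem weyl_zero : D.weyl 0 = 1 := by
  have h1 : D.Phi ((0 : D.PhaseEven) : D.Phase) = 0 := map_zero D.Phi
  rw [weyl, h1]
  exact NormedSpace.exp_zero

theorem gar_mul_odd_self {x : D.Gr} (hx : x ∈ D.GrOdd) (f : H) :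
    (D.gar f * D.incl x) * (D.gar f * D.incl x) = 0 := by
  rw [mul_assoc, ← mul_assoc (D.incl x), D.incl_mul_gar hx, neg_mul, mul_assoc, ← map_mul,
    D.odd_mul_self hx]
  simp

theorem list_prod_mem_polyFun {R ι : Type*} [Ring R] [Algebra ℂ R] {j : D.Gr →ₐ[ℂ] R}
    (hj : D.PassesOdd j) (F : ι → D.PhaseEven → R) (hF : ∀ i, F i ∈ D.polyFun j 2) (l : List ι) :
    (l.map F).prod ∈ D.polyFun j (l.length + 1) := by
  induction l with
  | nil => exact const_mem_polyFun 1 one_pos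
  | cons i l ih =>
    rw [List.map_cons, List.prod_cons]
    exact mul_mem_polyFun hj (by simp; omega) (hF i) ih

theorem list_prod_apply {X R ι : Type*} [Ring R] (F : ι → X → R) (l : List ι) (x : X) :
    (l.map F).prod x = (l.map fun i => F i x).prod := by
  induction l with
  | nil => rfl
  | cons i l ih => simp [ih]

variable {e} in
-- In a real basis `Φ(ξ)` is a sum of `N` commuting terms `G(e_i) ξ_i` with square zero, so `w(ξ)`
-- is the product of the factors `1 + G(e_i) ξ_i`. The scalar `s` covers both `w(ξ)` and `w(-ξ)`.
theorem weyl_mem_polyGAR (he : D.IsRealBasis e) {s : ℂ} :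
    (fun ξ : D.PhaseEven => D.weyl (s • ξ)) ∈ D.polyGAR (N + 1) := by
  let F : Fin N → D.PhaseEven → D.GAR := fun i ξ =>
    D.gar (e i : H) * D.incl (D.comp (e i) (s • ξ : D.PhaseEven)) + 1
  have h1 : (fun ξ : D.PhaseEven => D.weyl (s • ξ)) = ((List.finRange N).map F).prod := by
    funext ξ
    rw [list_prod_apply, weyl, D.Phi_eq_sum_gar e, ← List.sum_ofFn, List.ofFn_eq_map]
    refine exp_list_sum (fun i => D.gar (e i : H) * D.incl (D.comp (e i) (s • ξ : D.PhaseEven)))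
      (fun i k => ?_) (fun i => ?_) _
    · have h := D.gar_mul_odd_commutator e (D.comp_mem_GrOdd (e i) (s • ξ))
        (D.comp_mem_GrOdd (e k) (s • ξ)) i k he
      rw [Commute, SemiconjBy, h]
      -- The commutator vanishes for distinct indices by the anticommutation relations and for equal
      -- ones because odd elements have square zero.
      by_cases hik : i = k
      · subst hik
        rw [D.odd_mul_self (D.comp_mem_GrOdd _ _)]
        simp
      · simp [hik]
    · exact D.gar_mul_odd_self (D.comp_mem_GrOdd _ _) _
  rw [h1]
  have h2 := D.list_prod_mem_polyFun D.passesOdd_incl F (fun i => ?_) (List.finRange N)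
  · simpa using h2
  · refine add_mem ?_ (const_mem_polyFun 1 two_pos)
    have h3 := generator_mem_polyFun (D := D) (j := D.incl) (k := 2) (s • D.gar (e i : H))
      (l := [e i]) one_lt_two
    convert h3 using 1
    funext ξ
    have h4 : D.comp (e i) ((s • ξ : D.PhaseEven) : D.Phase) = s • D.comp (e i) ξ :=
      D.comp_smul _ _ _
    rw [h4, map_smul, mul_smul_comm, smul_mul_assoc]
    simp [compFun]

variable {e} in
theorem isGHolomorphic_fourierHom (he : D.IsRealBasis e) (φ : D.RightModuleHom) :
    D.IsGHolomorphic (D.fourierHom φ) := by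
  have h := D.weyl_mem_polyGAR he (s := 1)
  simp only [one_smul] at h
  exact isGHolomorphic_of_mem (D.map_mem_polyGr φ h)

variable {e} in
theorem isGHolomorphic_conv (he : D.IsRealBasis e) (φ : D.RightModuleHom) (A : D.GAR) :
    D.IsGHolomorphic (D.conv φ A) := by
  have h1 := D.weyl_mem_polyGAR he (s := 1)
  have h2 := D.weyl_mem_polyGAR he (s := -1)
  have h0 : ∀ ξ : D.PhaseEven, (-1 : ℂ) • ξ = -ξ := fun ξ => neg_one_smul ℂ ξ
  simp only [one_smul, h0] at h1 h2
  have h3 := mul_mem_polyFun D.passesOdd_incl (r := N + 1) (by omega) h2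
    (const_mem_polyFun A one_pos)
  have h4 := mul_mem_polyFun D.passesOdd_incl (Nat.le_succ _) h3 h1
  exact isGHolomorphic_of_mem (D.map_mem_polyGr φ h4)


/-- Regrouping of a product of pairs of anticommuting elements. -/
theorem list_prod_mul_pairs {R ι : Type*} [Ring R] (x y : ι → R)
    (h : ∀ i k, x i * y k = -(y k * x i)) (l : List ι) :
    (l.map fun i => x i * y i).prod =
      (-1) ^ (l.length.choose 2) * ((l.map x).prod * (l.map y).prod) := by
  induction l with
  | nil => simp
  | cons i l ih =>
    have h1 := list_prod_mul_of_anticomm (l.map x) (y i) fun z hz => by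
      obtain ⟨k, -, rfl⟩ := List.mem_map.1 hz
      exact h k i
    have h2 : y i * (l.map x).prod = (-1) ^ l.length * ((l.map x).prod * y i) := by
      rw [h1, List.length_map, ← mul_assoc, ← pow_add, Even.neg_one_pow ⟨_, rfl⟩, one_mul]
    have h3 : x i * y i * ((l.map x).prod * (l.map y).prod) =
        x i * (y i * (l.map x).prod) * (l.map y).prod := by simp only [mul_assoc]
    simp only [List.map_cons, List.prod_cons, List.length_cons]
    rw [ih, Nat.choose_succ_succ' l.length 1, Nat.choose_one_right, pow_add]
    rcases neg_one_pow_eq_or R l.length with hk | hk <;>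
      rcases neg_one_pow_eq_or R (l.length.choose 2) with hC | hC <;>
      rw [hk] at h2 ⊢ <;> rw [hC] <;>
      simp only [one_mul, neg_mul, mul_neg, h3, h2, neg_neg, mul_assoc]

theorem mul_list_prod_eq_zero {R : Type*} [Ring R] (x : R) (l : List R) (hx : x * x = 0)
    (h : ∀ y ∈ l, x * y = -(y * x)) (hl : x ∈ l) : x * l.prod = 0 := by
  induction l with
  | nil => simp at hl
  | cons y l ih =>
    rw [List.prod_cons, ← mul_assoc]
    rcases List.mem_cons.1 hl with rfl | hl
    · rw [hx, zero_mul]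
    · rw [h y List.mem_cons_self, neg_mul, mul_assoc,
        ih (fun z hz => h z (List.mem_cons_of_mem _ hz)) hl, mul_zero, neg_zero]

variable {H : Type*} [NormedAddCommGroup H] [InnerProductSpace ℂ H] [CompleteSpace H]
variable {D : Triple H} {N : ℕ} {e : OrthonormalBasis (Fin N) ℂ D.ran}

/-! ### Grassmann integrals of exponentials and of the delta function -/

/-- Replacing a factor of degree one by a constant lowers the degree, so the shifts `c i` do not
affect the top term of the product. -/
theorem list_prod_add_sub_mem {ι : Type*} (F c : ι → D.Fun) (hF : ∀ i, F i ∈ D.polyGr 2)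
    (hc : ∀ i, c i ∈ D.polyGr 1) (l : List ι) :
    (l.map fun i => F i + c i).prod - (l.map F).prod ∈ D.polyGr l.length := by
  induction l with
  | nil => simp
  | cons i l ih =>
    have h1 := D.list_prod_mem_polyFun D.passesOdd_id (fun i => F i + c i)
      (fun i => add_mem (hF i) (polyFun_mono one_le_two (hc i))) l
    have h2 := mul_mem_polyFun D.passesOdd_id (r := l.length + 1) (by omega) (hF i) ih
    have h3 := mul_mem_polyFun D.passesOdd_id (r := l.length + 1) (by omega) (hc i) h1
    simp only [List.map_cons, List.prod_cons, List.length_cons]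
    convert add_mem h2 h3 using 1
    rw [mul_sub, add_mul]
    abel

theorem exp_sum_odd_mul_odd {x y : Fin N → D.Gr} (hx : ∀ i, x i ∈ D.GrOdd)
    (hy : ∀ i, y i ∈ D.GrOdd) : NormedSpace.exp (∑ i, x i * y i) =
      ((List.finRange N).map fun i => x i * y i + 1).prod := by
  rw [← List.sum_ofFn, List.ofFn_eq_map]
  refine exp_list_sum _ (fun i k => D.commute_odd_mul_odd (hx k) (hy k) _) (fun i => ?_) _
  rw [mul_assoc, ← mul_assoc (y i), D.odd_anticomm (hy i) (hx i), neg_mul, mul_neg, ← mul_assoc,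
    ← mul_assoc, D.odd_mul_self (hx i), zero_mul, zero_mul, neg_zero]

variable (e) in
-- The exponential is the product of the factors `x_i η_i + 1`. The top term takes `x_i η_i` from
-- every factor, and separating the `x_i` from the `η_i` produces the sign.
theorem hasTop_exp {x : Fin N → D.Gr} (hx : ∀ i, x i ∈ D.GrOdd) :
    D.HasTop e (fun η => NormedSpace.exp (∑ i, x i * D.comp (e i) η))
      ((-1) ^ (N.choose 2) * (List.ofFn x).prod) := by
  have h := list_prod_add_sub_mem (D := D) (fun (i : Fin N) η => x i * D.comp (e i) η) (fun _ => 1)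
    (fun i => ?_) (fun i => const_mem_polyFun 1 one_pos) (List.finRange N)
  · rw [List.length_finRange] at h
    unfold HasTop
    convert h using 1
    funext η
    simp only [Pi.sub_apply, list_prod_apply]
    rw [exp_sum_odd_mul_odd hx fun i => D.comp_mem_GrOdd (e i) η,
      list_prod_mul_pairs x (fun i => D.comp (e i) η)
        (fun i k => D.odd_anticomm (hx i) (D.comp_mem_GrOdd (e k) η)),
      monomial_univ, List.length_finRange, List.ofFn_eq_map, List.ofFn_eq_map, mul_assoc]
    rfl
  · have := generator_mem_polyFun (D := D) (j := AlgHom.id ℂ D.Gr) (k := 2) (x i) (l := [e i])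
      one_lt_two
    simpa [compFun] using this

variable (e) in
-- The shifted monomial is the product of the factors `ξ_i - ζ_i`, whose constants contribute only
-- to lower degrees.
theorem hasTop_delta (ζ : D.PhaseEven) :
    D.HasTop e (fun ξ => D.monomial e Finset.univ (ξ - ζ)) 1 := by
  have h := list_prod_add_sub_mem (D := D) (fun (i : Fin N) => D.compFun (e i))
    (fun i _ => -D.comp (e i) ζ)
    (fun i => comp_mem_polyFun (e i) one_lt_two) (fun i => const_mem_polyFun _ one_pos)
    (List.finRange N)
  rw [List.length_finRange] at h
  unfold HasTop
  convert h using 1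
  funext ξ
  simp only [Pi.sub_apply, list_prod_apply, one_mul, monomial_univ, List.ofFn_eq_map]
  congr 2
  refine List.map_congr_left fun i _ => ?_
  exact (D.comp_sub (e i) ξ ζ).trans (sub_eq_add_neg _ _)

theorem comp_mul_monomial_univ (u : D.ran) (ξ : D.PhaseEven) :
    D.comp u ξ * D.monomial e Finset.univ ξ = 0 := by
  rw [D.comp_eq_sum e, Finset.sum_mul]
  refine Finset.sum_eq_zero fun i _ => ?_
  rw [smul_mul_assoc, monomial_univ, mul_list_prod_eq_zero, smul_zero]
  · exact D.odd_mul_self (D.comp_mem_GrOdd _ _)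
  · intro y hy
    obtain ⟨k, rfl⟩ := (List.mem_ofFn' _ _).1 hy
    exact D.comp_anticomm _ _ _ _
  · exact (List.mem_ofFn' _ _).2 ⟨i, rfl⟩

/-- Under the delta function the variable can be replaced by the point. -/
theorem IsGHolomorphic.mul_delta (hN : Even N) {q : D.Fun} (hq : D.IsGHolomorphic q)
    (ξ ζ : D.PhaseEven) : q ξ * D.monomial e Finset.univ (ξ - ζ) =
      q ζ * D.monomial e Finset.univ (ξ - ζ) := by
  obtain ⟨k, hq'⟩ := hq.exists_mem
  clear hq
  induction hq' using Submodule.span_induction with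
  | zero => rfl
  | add x y _ _ hx hy => rw [Pi.add_apply, Pi.add_apply, add_mul, add_mul, hx, hy]
  | smul c x _ hx => rw [Pi.smul_apply, Pi.smul_apply, smul_mul_assoc, smul_mul_assoc, hx]
  | mem F hF =>
    obtain ⟨X, l, -, rfl⟩ := hF
    simp only [AlgHom.id_apply, mul_assoc]
    congr 1
    induction l with
    | nil => rfl
    | cons u l ih =>
      simp only [List.map_cons, List.prod_cons, Pi.mul_apply, mul_assoc]
      -- The difference of the two sides is `(ξ - ζ)_u` times the top monomial at `ξ - ζ`, in which
      -- every component of `ξ - ζ` already occurs.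
      have h1 : D.compFun u ξ * D.monomial e Finset.univ (ξ - ζ) =
          D.compFun u ζ * D.monomial e Finset.univ (ξ - ζ) := by
        rw [← sub_eq_zero, ← sub_mul]
        have h2 : D.compFun u ξ - D.compFun u ζ = D.comp u ((ξ - ζ : D.PhaseEven) : D.Phase) :=
          (D.comp_sub u ξ ζ).symm
        rw [h2, comp_mul_monomial_univ]
      rw [ih, ← monomial_univ_mul_comm hN, ← mul_assoc, h1, mul_assoc]

/-! ### Fourier transforms of G-holomorphic functions -/

variable (D) in
/-- The functions of two variables that are polynomial in the second one, with coefficients that are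
G-holomorphic in the first one. -/
noncomputable def twoVar : Submodule ℂ (D.PhaseEven → D.Fun) :=
  Submodule.span ℂ {M | ∃ (b : D.Fun) (l : List D.ran), D.IsGHolomorphic b ∧
    M = fun ξ η => b ξ * (l.map D.compFun).prod η}

theorem mem_twoVar_of_isGHolomorphic {f : D.Fun} (hf : D.IsGHolomorphic f) :
    (fun _ => f) ∈ D.twoVar := by
  obtain ⟨k, hf'⟩ := hf.exists_mem
  clear hf
  induction hf' using Submodule.span_induction with
  | zero => exact zero_mem _
  | add x y _ _ hx hy => exact add_mem hx hy
  | smul c x _ hx => exact Submodule.smul_mem _ c hx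
  | mem F hF =>
    obtain ⟨X, l, -, rfl⟩ := hF
    exact Submodule.subset_span ⟨fun _ => X, l, D.isGHolomorphic_const X, rfl⟩

theorem twoVar_mul {F : D.PhaseEven → D.Fun} (hF : F ∈ D.twoVar) (u : D.ran) :
    (fun ξ η => F ξ η * (D.comp u ξ * D.comp u η + 1)) ∈ D.twoVar := by
  let L : (D.PhaseEven → D.Fun) →ₗ[ℂ] (D.PhaseEven → D.Fun) :=
    LinearMap.mulRight ℂ (fun ξ η => D.comp u ξ * D.comp u η + 1)
  have h : D.twoVar ≤ D.twoVar.comap L := by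
    refine Submodule.span_le.2 ?_
    rintro _ ⟨b, l, hb, rfl⟩
    -- Moving `ξ_u` to the left of a monomial in `η` of length `l.length` gives this sign, which is
    -- absorbed into the coefficient.
    have h1 : (fun ξ η => ((fun _ => (-1) ^ l.length) * b * D.compFun u : D.Fun) ξ *
        ((l ++ [u]).map D.compFun).prod η) ∈ D.twoVar :=
      Submodule.subset_span ⟨_, _,
        ((D.isGHolomorphic_const _).mul hb).mul (D.isGHolomorphic_comp u), rfl⟩
    have h2 : (fun ξ η => b ξ * (l.map D.compFun).prod η) ∈ D.twoVar :=
      Submodule.subset_span ⟨b, l, hb, rfl⟩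
    refine Eq.mpr (congrArg (· ∈ D.twoVar) ?_) (add_mem h1 h2)
    funext ξ η
    have h3 := list_prod_mul_of_anticomm (l.map fun w => D.comp w η) (D.comp u ξ) fun z hz => by
      obtain ⟨w, -, rfl⟩ := List.mem_map.1 hz
      exact D.comp_anticomm _ _ _ _
    rw [← list_prod_compFun_apply, List.length_map] at h3
    change b ξ * (l.map D.compFun).prod η * (D.comp u ξ * D.comp u η + 1) =
      (-1) ^ l.length * b ξ * D.comp u ξ * ((l ++ [u]).map D.compFun).prod η +
        b ξ * (l.map D.compFun).prod η
    rw [mul_add_one, List.map_append, List.prod_append, Pi.mul_apply, List.map_singleton,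
      List.prod_singleton, ((Commute.neg_one_left (b ξ)).pow_left l.length).eq]
    congr 1
    rw [mul_assoc (b ξ), ← mul_assoc _ (D.comp u ξ), h3]
    simp only [mul_assoc]
    rfl
  exact h hF

theorem twoVar_mul_list {F : D.PhaseEven → D.Fun} (hF : F ∈ D.twoVar) (l : List D.ran) :
    (fun ξ η => F ξ η * (l.map fun u => D.comp u ξ * D.comp u η + 1).prod) ∈ D.twoVar := by
  induction l generalizing F with
  | nil => simpa using hF
  | cons u l ih =>
    have := ih (twoVar_mul hF u)
    simpa only [List.map_cons, List.prod_cons, mul_assoc] using this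

variable (e) in
-- The monomial in `η` has a top coefficient independent of `ξ`, so all dependence on `ξ` sits in
-- the G-holomorphic factor.
theorem exists_hasTop_of_mem_twoVar {F : D.PhaseEven → D.Fun} (hF : F ∈ D.twoVar) :
    ∃ Y : D.Fun, D.IsGHolomorphic Y ∧ ∀ ξ, D.HasTop e (F ξ) (Y ξ) := by
  induction hF using Submodule.span_induction with
  | zero => exact ⟨0, D.isGHolomorphic_const 0, fun ξ => hasTop_of_mem (zero_mem _)⟩
  | add x y _ _ hx hy =>
    obtain ⟨Y, hY, hx⟩ := hx
    obtain ⟨Z, hZ, hy⟩ := hy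
    exact ⟨Y + Z, hY.add hZ, fun ξ => (hx ξ).add (hy ξ)⟩
  | smul c x _ hx =>
    obtain ⟨Y, hY, hx⟩ := hx
    exact ⟨c • Y, Submodule.smul_mem _ c hY, fun ξ => (hx ξ).smul c⟩
  | mem F hF =>
    obtain ⟨b, l, hb, rfl⟩ := hF
    have h1 : D.IsGHolomorphic (l.map D.compFun).prod := by
      have := generator_mem_polyFun (D := D) (j := AlgHom.id ℂ D.Gr) 1 (Nat.lt_succ_self l.length)
      simp only [AlgHom.id_apply, one_mul] at this
      exact isGHolomorphic_of_mem this
    obtain ⟨Z, hZ⟩ := h1.exists_hasTop e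
    exact ⟨fun ξ => b ξ * Z, hb.mul (D.isGHolomorphic_const Z), fun ξ => hZ.const_mul (b ξ)⟩

theorem fourierIntegrand_eq (he : D.IsRealBasis e) (f : D.Fun) (ξ : D.PhaseEven) :
    D.fourierIntegrand f ξ =
      f * fun η : D.PhaseEven => NormedSpace.exp (∑ i, D.comp (e i) ξ * D.comp (e i) η) := by
  funext η
  rw [fourierIntegrand, D.rigging_phaseConj he]
  rfl

theorem isGHolomorphic_fourierIntegrand (he : D.IsRealBasis e) {f : D.Fun}
    (hf : D.IsGHolomorphic f) (ξ : D.PhaseEven) : D.IsGHolomorphic (D.fourierIntegrand f ξ) := by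
  rw [fourierIntegrand_eq he]
  exact hf.mul (hasTop_exp e fun i => D.comp_mem_GrOdd (e i) ξ).isGHolomorphic

/-- Expanding the kernel into the factors `ξ_i η_i + 1` makes the integrand polynomial in both
variables; integration over `η` then leaves a G-holomorphic function of `ξ`. -/
theorem exists_hasTop_fourierIntegrand (he : D.IsRealBasis e) {f : D.Fun}
    (hf : D.IsGHolomorphic f) :
    ∃ Y : D.Fun, D.IsGHolomorphic Y ∧ ∀ ξ, D.HasTop e (D.fourierIntegrand f ξ) (Y ξ) := by
  have h := twoVar_mul_list (mem_twoVar_of_isGHolomorphic hf) ((List.finRange N).map e)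
  obtain ⟨Y, hY, hY'⟩ := exists_hasTop_of_mem_twoVar e h
  refine ⟨Y, hY, fun ξ => ?_⟩
  convert hY' ξ using 1
  rw [fourierIntegrand_eq he]
  funext η
  rw [Pi.mul_apply, exp_sum_odd_mul_odd (fun i => D.comp_mem_GrOdd (e i) ξ)
    fun i => D.comp_mem_GrOdd (e i) η, List.map_map]
  rfl

/-- The Grassmann integral over `v` is `c` times the coefficient of highest degree with respect to
the basis `e`. -/
def IntegralFormula (v : D.Forms) (e : OrthonormalBasis (Fin N) ℂ D.ran) (c : ℂ) : Prop :=
  ∀ F Y, D.HasTop e F Y → D.integral v F = c • Y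

/-! ### Linearity of the integral and Fourier transform, and inversion on Grassmann-Weyl operators
-/

section Integral

variable {v : D.Forms} {c : ℂ}

theorem integral_add (hI : IntegralFormula v e c) {F G : D.Fun} (hF : D.IsGHolomorphic F) (hG : D.IsGHolomorphic G) :
    D.integral v (F + G) = D.integral v F + D.integral v G := by
  obtain ⟨X, hX⟩ := hF.exists_hasTop e
  obtain ⟨Y, hY⟩ := hG.exists_hasTop e
  rw [hI _ _ hX, hI _ _ hY, hI _ _ (hX.add hY), smul_add]

theorem integral_mul_const (hI : IntegralFormula v e c) (hN : Even N) {F : D.Fun} (hF : D.IsGHolomorphic F) (X : D.Gr) :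
    D.integral v (fun ξ => F ξ * X) = D.integral v F * X := by
  obtain ⟨Y, hY⟩ := hF.exists_hasTop e
  rw [hI _ _ hY, hI _ _ (hY.mul_const hN X), smul_mul_assoc]

theorem isGHolomorphic_fourier (hI : IntegralFormula v e c) (he : D.IsRealBasis e) {f : D.Fun} (hf : D.IsGHolomorphic f) :
    D.IsGHolomorphic (D.fourier v f) := by
  obtain ⟨Y, hY, hY'⟩ := exists_hasTop_fourierIntegrand he hf
  have : D.fourier v f = c • Y := funext fun ξ => hI _ _ (hY' ξ)
  rw [this]
  exact Submodule.smul_mem _ c hY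

theorem fourier_add (hI : IntegralFormula v e c) (he : D.IsRealBasis e) {f g : D.Fun} (hf : D.IsGHolomorphic f)
    (hg : D.IsGHolomorphic g) : D.fourier v (f + g) = D.fourier v f + D.fourier v g := by
  funext ξ
  rw [Pi.add_apply, fourier, fourier, fourier, ← integral_add hI
    (isGHolomorphic_fourierIntegrand he hf ξ) (isGHolomorphic_fourierIntegrand he hg ξ)]
  exact congrArg _ (funext fun η => add_mul _ _ _)

/-- The exponent of the kernel is a sum of products of two odd elements, so the kernel commutes with
`X`. -/
theorem fourier_mul_const (hI : IntegralFormula v e c) (he : D.IsRealBasis e) (hN : Even N)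
    {f : D.Fun} (hf : D.IsGHolomorphic f) (X : D.Gr) :
    D.fourier v (fun η => f η * X) = fun ξ => D.fourier v f ξ * X := by
  funext ξ
  rw [fourier, fourier, ← integral_mul_const hI hN (isGHolomorphic_fourierIntegrand he hf ξ)]
  congr 1
  funext η
  rw [fourierIntegrand_eq he, fourierIntegrand_eq he, Pi.mul_apply, Pi.mul_apply, mul_assoc, mul_assoc]
  congr 1
  refine (commute_exp_right (Commute.sum_right _ _ _ fun i _ => ?_)).eq
  exact D.commute_odd_mul_odd (D.comp_mem_GrOdd _ ξ) (D.comp_mem_GrOdd _ η) X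

theorem integral_fourier_conv_add (hI : IntegralFormula v e c)
    (he : D.IsRealBasis e) {q : D.Fun} (hq : D.IsGHolomorphic q) (φ : D.RightModuleHom)
    (A B : D.GAR) :
    D.integral v (q * D.fourier v (D.conv φ (A + B))) =
      D.integral v (q * D.fourier v (D.conv φ A)) + D.integral v (q * D.fourier v (D.conv φ B)) := by
  have h1 := D.isGHolomorphic_conv he φ A
  have h2 := D.isGHolomorphic_conv he φ B
  have h3 : D.conv φ (A + B) = D.conv φ A + D.conv φ B := by
    funext ξ
    rw [Pi.add_apply, conv, conv, conv, translate, mul_add, add_mul]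
    exact φ.toContinuousLinearMap.map_add _ _
  rw [h3, fourier_add hI he h1 h2, mul_add, integral_add hI
    (hq.mul (isGHolomorphic_fourier hI he h1)) (hq.mul (isGHolomorphic_fourier hI he h2))]

theorem integral_fourier_conv_mul (hI : IntegralFormula v e c)
    (he : D.IsRealBasis e) {q : D.Fun} (hq : D.IsGHolomorphic q) (φ : D.RightModuleHom)
    (hN : Even N) (A : D.GAR) (X : D.Gr) :
    D.integral v (q * D.fourier v (D.conv φ (A * D.incl X))) =
      D.integral v (q * D.fourier v (D.conv φ A)) * X := by
  have h1 := D.isGHolomorphic_conv he φ A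
  have h3 : D.conv φ (A * D.incl X) = fun ξ => D.conv φ A ξ * X := by
    funext ξ
    rw [conv, conv, translate_mul_incl]
    exact φ.map_mul_right' _ _
  rw [h3, fourier_mul_const hI he hN h1, ← integral_mul_const hI hN
    (hq.mul (isGHolomorphic_fourier hI he h1))]
  exact congrArg _ (funext fun ξ => (mul_assoc _ _ _).symm)

/-- The inversion formula for Grassmann-Weyl operators. -/
theorem integral_fourier_conv_weyl (hI : IntegralFormula v e c)
    (he : D.IsRealBasis e) {q : D.Fun} (hq : D.IsGHolomorphic q) (φ : D.RightModuleHom)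
    (hN : Even N) (hc : c * c * (-1) ^ (N.choose 2) = 1)
    (ζ : D.PhaseEven) :
    D.integral v (q * D.fourier v (D.conv φ (D.weyl ζ))) = q ζ * φ (D.weyl ζ) := by
  -- The exponential produced by the translation merges with the Fourier kernel and shifts `ξ` to `ξ
  -- - ζ`.
  have h1 : ∀ ξ, D.fourierIntegrand (D.conv φ (D.weyl ζ)) ξ = fun η : D.PhaseEven => φ (D.weyl ζ) *
      NormedSpace.exp (∑ i, D.comp (e i) ((ξ - ζ : D.PhaseEven) : D.Phase) * D.comp (e i) η) := by
    intro ξ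
    funext η
    have h2 : D.conv φ (D.weyl ζ) η = φ (D.weyl ζ) *
        NormedSpace.exp (-∑ i, D.comp (e i) ζ * D.comp (e i) η) := by
      rw [conv, D.translate_weyl he]
      exact φ.map_mul_right' _ _
    rw [fourierIntegrand_eq he, Pi.mul_apply, h2, mul_assoc, ← exp_add_of_commute]
    · congr 2
      rw [← Finset.sum_neg_distrib, ← Finset.sum_add_distrib]
      refine Finset.sum_congr rfl fun i _ => ?_
      have h3 : D.comp (e i) ((ξ - ζ : D.PhaseEven) : D.Phase) = D.comp (e i) ξ - D.comp (e i) ζ :=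
        D.comp_sub _ _ _
      rw [h3, sub_mul, neg_add_eq_sub]
    · exact Commute.sum_right _ _ _ fun i _ =>
        D.commute_odd_mul_odd (D.comp_mem_GrOdd _ ξ) (D.comp_mem_GrOdd _ η) _
  -- The integral of the shifted kernel is a delta function at `ζ`.
  have h4 : ∀ ξ, D.fourier v (D.conv φ (D.weyl ζ)) ξ = c • (φ (D.weyl ζ) *
      ((-1) ^ (N.choose 2) * D.monomial e Finset.univ (ξ - ζ))) := by
    intro ξ
    rw [fourier, h1, monomial_univ]
    exact hI _ _ ((hasTop_exp e fun i => D.comp_mem_GrOdd (e i) (ξ - ζ)).const_mul _)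
  -- The delta function is central because `N` is even, and under it `q ξ` may be replaced by `q ζ`.
  -- The remaining integral contributes the second factor `c`.
  have h5 : q * D.fourier v (D.conv φ (D.weyl ζ)) = fun ξ =>
      (c * (-1) ^ (N.choose 2)) • (q ζ * φ (D.weyl ζ)) * D.monomial e Finset.univ (ξ - ζ) := by
    funext ξ
    have h6 : ((-1 : D.Gr) ^ (N.choose 2)) = ((-1 : ℂ) ^ (N.choose 2)) • 1 := by
      rcases (N.choose 2).even_or_odd with h | h <;> simp [h.neg_one_pow]
    rw [Pi.mul_apply, h4, h6, smul_mul_assoc, one_mul, mul_smul_comm, mul_smul_comm, mul_smul_comm,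
      smul_smul, smul_mul_assoc]
    congr 1
    rw [← monomial_univ_mul_comm hN, ← mul_assoc, hq.mul_delta hN, mul_assoc,
      monomial_univ_mul_comm hN, mul_assoc]
  rw [h5, hI _ _ ((hasTop_delta e ζ).const_mul _), mul_one, smul_smul, ← mul_assoc, hc, one_smul]

end Integral

end Triple

/-! ### Adjoining a generator to a closed subalgebra -/

/-- Let `σ` be an involutive automorphism and `g` an element with `g² = 1/2` and `σ g = -g` that passes
through the closed subalgebra `S` up to `σ`. Then `S + S g` is a closed subalgebra. -/
theorem exists_closed_extension {R : Type*} [NormedRing R] [NormedAlgebra ℂ R] (σ : R →ₐ[ℂ] R)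
    (hσ : Continuous σ) (hσσ : ∀ x, σ (σ x) = x) {g : R} (hg : g * g = (1 / 2 : ℂ) • 1)
    (hσg : σ g = -g) (S : Subalgebra ℂ R) (hS : IsClosed (S : Set R)) (hSσ : ∀ x ∈ S, σ x ∈ S)
    (hSg : ∀ x ∈ S, g * x = σ x * g) : ∃ S' : Subalgebra ℂ R, IsClosed (S' : Set R) ∧ S ≤ S' ∧
      g ∈ S' ∧ (∀ x ∈ S', σ x ∈ S') ∧ ∀ x ∈ S', ∃ b ∈ S, ∃ c ∈ S, x = b + c * g := by
  -- The continuous map `x ↦ x g - g σ(x)` reads off the coefficient `c` of `b + c g`: the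
  -- contributions of `b` cancel, while `c g` contributes `c / 2` twice.
  have hC : ∀ b ∈ S, ∀ c ∈ S, (b + c * g) * g - g * σ (b + c * g) = c := by
    intro b hb c hc
    have h1 : g * σ b = b * g := by rw [hSg _ (hSσ b hb), hσσ]
    have h2 : g * (σ c * g) = (1 / 2 : ℂ) • c := by
      rw [← mul_assoc, hSg _ (hSσ c hc), hσσ, mul_assoc, hg, mul_smul_comm, mul_one]
    rw [map_add, map_mul, hσg, mul_neg, mul_add, mul_neg, h1, h2, add_mul, mul_assoc, hg,
      mul_smul_comm, mul_one]
    rw [sub_eq_add_neg, neg_add, neg_neg, add_add_add_comm, add_neg_cancel, zero_add, ← add_smul]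
    norm_num
  have hmem : ∀ x, (x * g - g * σ x ∈ S ∧ x - (x * g - g * σ x) * g ∈ S) ↔
      ∃ b ∈ S, ∃ c ∈ S, x = b + c * g := by
    refine fun x => ⟨fun h => ⟨_, h.2, _, h.1, by abel⟩, ?_⟩
    rintro ⟨b, hb, c, hc, rfl⟩
    rw [hC b hb c hc]
    exact ⟨hc, by simpa using hb⟩
  -- Describing `S + S g` by continuous conditions with values in `S` makes it a preimage of closed
  -- sets; no limit of decompositions has to be taken.
  let S' : Subalgebra ℂ R :=
    { carrier := {x | x * g - g * σ x ∈ S ∧ x - (x * g - g * σ x) * g ∈ S}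
      algebraMap_mem' := fun r =>
        (hmem _).2 ⟨_, S.algebraMap_mem r, 0, S.zero_mem, by simp⟩
      add_mem' := by
        intro x y hx hy
        obtain ⟨b, hb, c, hc, rfl⟩ := (hmem x).1 hx
        obtain ⟨b', hb', c', hc', rfl⟩ := (hmem y).1 hy
        exact (hmem _).2 ⟨_, add_mem hb hb', _, add_mem hc hc', by rw [add_mul]; abel⟩
      mul_mem' := by
        intro x y hx hy
        obtain ⟨b, hb, c, hc, rfl⟩ := (hmem x).1 hx
        obtain ⟨b', hb', c', hc', rfl⟩ := (hmem y).1 hy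
        refine (hmem _).2 ⟨b * b' + (1 / 2 : ℂ) • (c * σ c'),
          add_mem (mul_mem hb hb') (S.smul_mem (mul_mem hc (hSσ _ hc')) _),
          b * c' + c * σ b', add_mem (mul_mem hb hc') (mul_mem hc (hSσ _ hb')), ?_⟩
        have h1 : c * g * b' = c * σ b' * g := by rw [mul_assoc, hSg _ hb', mul_assoc]
        have h2 : c * g * (c' * g) = (1 / 2 : ℂ) • (c * σ c') := by
          rw [mul_assoc, ← mul_assoc g, hSg _ hc', mul_assoc, hg, mul_smul_comm, mul_one,
            mul_smul_comm]
        rw [add_mul, mul_add, mul_add, h1, h2, add_mul, mul_assoc b c' g]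
        abel }
  refine ⟨S', ?_, fun x hx => (hmem _).2 ⟨x, hx, 0, S.zero_mem, by simp⟩,
    (hmem _).2 ⟨0, S.zero_mem, 1, S.one_mem, by simp⟩, fun x hx => ?_, fun x hx => (hmem x).1 hx⟩
  · have h1 : Continuous fun x => x * g - g * σ x :=
      (continuous_id.mul continuous_const).sub (continuous_const.mul hσ)
    exact (hS.preimage h1).inter (hS.preimage (continuous_id.sub (h1.mul continuous_const)))
  · obtain ⟨b, hb, c, hc, rfl⟩ := (hmem x).1 hx
    refine (hmem _).2 ⟨_, hSσ b hb, _, neg_mem (hSσ c hc), ?_⟩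
    rw [map_add, map_mul, hσg, mul_neg, neg_mul]

/-! ### The GAR algebra and the span of the Grassmann-Weyl operators -/

namespace Triple

variable {H : Type*} [NormedAddCommGroup H] [InnerProductSpace ℂ H] [CompleteSpace H]
variable {D : Triple H} {N : ℕ} {e : OrthonormalBasis (Fin N) ℂ D.ran}

variable (e) in
/-- The right module over the Grassmann part that is spanned by the Grassmann-Weyl operators with
components in `l`. -/
noncomputable def weylSpan (l : List (Fin N)) : Submodule ℂ D.Env :=
  Submodule.span ℂ {x | ∃ (ζ : D.PhaseEven) (X : D.Gr), (∀ i, i ∉ l → D.comp (e i) ζ = 0) ∧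
    x = ((D.weyl ζ * D.incl X : D.GAR) : D.Env)}

theorem weylSpan_le_GAR (l : List (Fin N)) : weylSpan e l ≤ D.GAR.toSubmodule := by
  refine Submodule.span_le.2 ?_
  rintro _ ⟨ζ, X, -, rfl⟩
  exact (D.weyl ζ * D.incl X).2

theorem weylSpan_mono {l l' : List (Fin N)} (h : l ⊆ l') : weylSpan e l ≤ weylSpan e l' := by
  refine Submodule.span_mono ?_
  rintro _ ⟨ζ, X, hζ, rfl⟩
  exact ⟨ζ, X, fun i hi => hζ i fun hi' => hi (h hi'), rfl⟩

/-- Multiplication by `G(e_j) λ` with odd `λ`. -/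
theorem mul_gar_mem_weylSpan (he : D.IsRealBasis e) {j : Fin N} {l : List (Fin N)} (hj : j ∉ l)
    {m : D.Gr} (hm : m ∈ D.GrOdd) {x : D.Env} (hx : x ∈ weylSpan e l) :
    x * ((D.gar (e j : H) * D.incl m : D.GAR) : D.Env) ∈ weylSpan e (j :: l) := by
  induction hx using Submodule.span_induction with
  | zero => rw [zero_mul]; exact zero_mem _
  | add x y _ _ hx hy => rw [add_mul]; exact add_mem hx hy
  | smul c x _ hx => rw [smul_mul_assoc]; exact Submodule.smul_mem _ _ hx
  | mem x hx =>
    obtain ⟨ζ, X, hζ, rfl⟩ := hx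
    -- For `η = e_j ⊗ m` one has `w(η) = 1 + G(e_j) m`. Since `ζ` has no component along `e_j`, the
    -- fields commute, and multiplication by `G(e_j) m` is the difference between `w(ζ + η)` and
    -- `w(ζ)`.
    let η : D.PhaseEven := D.ofComponents e (Pi.single j ⟨m, hm⟩)
    have hη : ∀ i, D.comp (e i) η = if i = j then m else 0 := by
      intro i
      rw [D.comp_ofComponents]
      by_cases hij : i = j
      · subst hij; simp
      · simp [hij]
    have hPhi : D.Phi η = D.gar (e j : H) * D.incl m := by
      rw [D.Phi_eq_sum_gar e, Finset.sum_eq_single j]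
      · rw [hη, if_pos rfl]
      · intro i _ hij; rw [hη, if_neg hij, map_zero, mul_zero]
      · simp
    have hw : D.weyl η = 1 + D.gar (e j : H) * D.incl m := by
      rw [weyl, hPhi, exp_of_mul_self (D.gar_mul_odd_self hm _)]
    have hcomm : Commute (D.Phi ζ) (D.Phi η) := by
      rw [Commute, SemiconjBy, D.Phi_commutator he]
      have h0 : ∑ i, D.comp (e i) ζ * D.comp (e i) η = 0 := by
        refine Finset.sum_eq_zero fun i _ => ?_
        rw [hη]
        split_ifs with hij
        · subst hij; rw [hζ _ hj, zero_mul]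
        · rw [mul_zero]
      rw [h0, neg_zero, map_zero, add_zero]
    have h1 : D.weyl ζ * D.incl X * (D.gar (e j : H) * D.incl m) =
        D.weyl (ζ + η) * D.incl X - D.weyl ζ * D.incl X := by
      rw [mul_assoc, (D.commute_incl_gar_mul X _ hm).eq, D.weyl_add_of_commute hcomm, hw, mul_add,
        mul_one, add_mul, add_sub_cancel_left]
      simp only [mul_assoc]
    rw [← Subalgebra.coe_mul, h1, Subalgebra.coe_sub]
    refine sub_mem (Submodule.subset_span ⟨ζ + η, X, fun i hi => ?_, rfl⟩)
      (Submodule.subset_span ⟨ζ, X, fun i hi => hζ i fun hi' => hi (List.mem_cons_of_mem _ hi'), rfl⟩)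
    obtain ⟨hij, hi⟩ := not_or.1 (List.mem_cons.not.1 hi)
    have h2 : D.comp (e i) ((ζ + η : D.PhaseEven) : D.Phase) = D.comp (e i) ζ + D.comp (e i) η :=
      D.comp_add _ _ _
    rw [h2, hζ i hi, hη, if_neg hij, add_zero]

theorem Gr_le_weylSpan (l : List (Fin N)) {x : D.Env} (hx : x ∈ D.Gr) : x ∈ weylSpan e l := by
  refine Submodule.subset_span ⟨0, ⟨x, hx⟩, fun i _ => map_zero _, ?_⟩
  rw [weyl_zero, one_mul, coe_incl]

/-- The algebra is built from the Grassmann part by adjoining the `G(e_i)` one at a time; invariance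
under parity and passage of the remaining generators are carried along to allow the next extension.
In `b + c G(e_j)`, the extra factor `G(g_j)` is absorbed by the coefficient `b` in one term and
paired with `G(e_j)` in the other. -/
theorem exists_subalgebra_weylSpan (he : D.IsRealBasis e) (l : List (Fin N)) (hl : l.Nodup) :
    ∃ S : Subalgebra ℂ D.Env, IsClosed (S : Set D.Env) ∧ D.Gr ≤ S ∧ (∀ i ∈ l, D.G (e i : H) ∈ S) ∧
      (∀ x ∈ S, parity D.JQ x ∈ S) ∧
      (∀ i, i ∉ l → ∀ x ∈ S, D.G (e i : H) * x = parity D.JQ x * D.G (e i : H)) ∧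
      ∀ x ∈ S, ∀ g : Fin N → D.perp, x * (l.map fun i => D.G (g i : H)).prod ∈ weylSpan e l := by
  have hGG : ∀ i k, D.G (e i : H) * D.G (e k : H) + D.G (e k : H) * D.G (e i : H) =
      (if i = k then (1 : ℂ) else 0) • (1 : D.Env) := fun i k => by
    have h := congrArg Subtype.val (D.gar_anticomm e i k he)
    rw [Subalgebra.coe_add, Subalgebra.coe_mul, Subalgebra.coe_mul, coe_gar, coe_gar,
      Subalgebra.coe_smul, Subalgebra.coe_one] at h
    exact h
  induction l with
  | nil =>
    refine ⟨D.Gr, D.isClosed_Gr, le_rfl, by simp, fun x hx => D.parity_mem_Gr hx,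
      fun i _ x hx => ?_, fun x hx g => ?_⟩
    · rw [D.Gr_mul_G (D.parity_mem_Gr hx), parity_parity]
    · rw [List.map_nil, List.prod_nil, mul_one]
      exact Gr_le_weylSpan _ hx
  | cons j l ih =>
    obtain ⟨hj, hl⟩ := List.nodup_cons.1 hl
    obtain ⟨S, hS, hGr, hG, hσ, hpass, hW⟩ := ih hl
    have hgg : D.G (e j : H) * D.G (e j : H) = (1 / 2 : ℂ) • 1 := by
      have h := hGG j j
      rw [if_pos rfl, one_smul, ← two_smul ℂ] at h
      rw [← h, smul_smul]
      norm_num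
    obtain ⟨S', hS', hSS', hgS', hσ', hdec⟩ := exists_closed_extension
      (parity D.JQ : D.Env →⋆ₐ[ℂ] D.Env).toAlgHom (continuous_parity _) (parity_parity _) hgg
      (D.parity_G _) S hS hσ (hpass j hj)
    refine ⟨S', hS', hGr.trans hSS', fun i hi => ?_, hσ', fun i hi x hx => ?_, fun x hx g => ?_⟩
    · rcases List.mem_cons.1 hi with rfl | hi
      · exact hgS'
      · exact hSS' (hG i hi)
    · obtain ⟨hij, hi⟩ := not_or.1 (List.mem_cons.not.1 hi)
      obtain ⟨b, hb, c, hc, rfl⟩ := hdec x hx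
      have h1 : D.G (e i : H) * D.G (e j : H) = -(D.G (e j : H) * D.G (e i : H)) := by
        rw [eq_neg_iff_add_eq_zero, hGG, if_neg hij, zero_smul]
      rw [mul_add, ← mul_assoc, hpass i hi b hb, hpass i hi c hc, mul_assoc, h1, map_add, map_mul,
        D.parity_G, add_mul]
      simp only [mul_neg, neg_mul, mul_assoc]
    · obtain ⟨b, hb, c, hc, rfl⟩ := hdec x hx
      have hodd := D.G_mem_GrOdd (g j)
      have h1 := hW (b * D.G (g j : H)) (mul_mem hb (hGr (D.G_mem_Gr (g j)))) g
      have h2 := mul_gar_mem_weylSpan he hj hodd (hW c hc g)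
      -- The pair `G(e_j) G(g_j)` commutes with the Grassmann part and can be moved behind the
      -- product of the other generators.
      have h3 : (b + c * D.G (e j : H)) * ((j :: l).map fun i => D.G (g i : H)).prod =
          b * D.G (g j : H) * (l.map fun i => D.G (g i : H)).prod +
          c * (l.map fun i => D.G (g i : H)).prod *
            ((D.gar (e j : H) * D.incl ⟨_, D.G_mem_Gr (g j)⟩ : D.GAR) : D.Env) := by
        have hP : (l.map fun i => D.G (g i : H)).prod ∈ D.Gr := by
          refine list_prod_mem fun z hz => ?_
          obtain ⟨k, -, rfl⟩ := List.mem_map.1 hz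
          exact D.G_mem_Gr _
        have h4 := D.commute_incl_gar_mul ⟨_, hP⟩ (e j : H) hodd
        rw [Commute, SemiconjBy, Subtype.ext_iff, Subalgebra.coe_mul, Subalgebra.coe_mul _ _ (D.incl ⟨_, hP⟩), coe_incl] at h4
        rw [mul_assoc c _ (Subtype.val _), h4, Subalgebra.coe_mul, coe_gar, coe_incl, List.map_cons,
          List.prod_cons, add_mul]
        simp only [mul_assoc]
      rw [h3]
      exact add_mem (weylSpan_mono (List.subset_cons_self _ _) h1) h2

/-- The Grassmann-Weyl operators span the GAR algebra up to multiplication by odd generators. -/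
theorem mul_list_prod_mem_weylSpan (he : D.IsRealBasis e) {x : D.Env} (hx : x ∈ D.GAR)
    (g : Fin N → D.perp) :
    x * ((List.finRange N).map fun i => D.G (g i : H)).prod ∈ weylSpan e (List.finRange N) := by
  obtain ⟨S, hS, hGr, hG, -, -, hW⟩ :=
    exists_subalgebra_weylSpan he (List.finRange N) (List.nodup_finRange N)
  refine hW x ?_ g
  refine D.mem_GAR_induction (p := fun x => x ∈ S) hS (fun f => ?_) S.algebraMap_mem
    (fun _ _ => add_mem) (fun _ _ => mul_mem) hx
  -- The algebra `S` contains the Grassmann part and the `G(e_i)`, hence all `G(f)`; being closed,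
  -- it contains the GAR algebra.
  have h1 : f = D.Q f + (D.toPerp f : H) := by rw [coe_toPerp]; abel
  rw [h1, map_add]
  refine add_mem ?_ (hGr (D.G_mem_Gr _))
  have h2 := congrArg Subtype.val (e.sum_repr ⟨D.Q f, ⟨f, rfl⟩⟩)
  rw [Submodule.coe_sum] at h2
  rw [← show _ = D.Q f from h2, map_sum]
  refine sum_mem fun i _ => ?_
  rw [Submodule.coe_smul, map_smul]
  exact S.smul_mem (hG i (List.mem_finRange i)) _

/-- The inversion formula for right module homomorphisms. -/
theorem hom_eq_integral_fourier_conv (hinf : ¬ FiniteDimensional ℂ D.perp) {v : D.Forms} {c : ℂ}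
    (hI : IntegralFormula v e c) (he : D.IsRealBasis e) (hN : Even N)
    (hc : c * c * (-1) ^ (N.choose 2) = 1) {q : D.Fun} (hq : D.IsGHolomorphic q)
    {ω φ : D.RightModuleHom} (hdiv : D.fourierHom ω = q * D.fourierHom φ) (A : D.GAR) :
    ω A = D.integral v (q * D.fourier v (D.conv φ A)) := by
  have hmul := integral_fourier_conv_mul hI he hq φ hN
  have hadd := integral_fourier_conv_add hI he hq φ
  have hω : ∀ (B : D.GAR) (X : D.Gr), ω (B * D.incl X) = ω B * X := ω.map_mul_right'
  have hweyl : ∀ x ∈ weylSpan e (List.finRange N), ∀ hx : x ∈ D.GAR, ω (⟨x, hx⟩ : D.GAR) =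
      D.integral v (q * D.fourier v (D.conv φ ⟨x, hx⟩)) := by
    intro x hx
    induction hx using Submodule.span_induction with
    | zero =>
      intro h0
      -- Additivity forces the right-hand side to vanish at `A = 0`.
      have h1 := hadd 0 0
      rw [add_zero, left_eq_add] at h1
      exact ω.toContinuousLinearMap.map_zero.trans h1.symm
    | add x y hx hy hx' hy' =>
      intro _
      have h1 : x ∈ D.GAR := weylSpan_le_GAR _ hx
      have h2 : y ∈ D.GAR := weylSpan_le_GAR _ hy
      have h3 := hadd ⟨x, h1⟩ ⟨y, h2⟩
      rw [← hx' h1, ← hy' h2] at h3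
      exact (ω.toContinuousLinearMap.map_add ⟨x, h1⟩ ⟨y, h2⟩).trans h3.symm
    | smul r x hx hx' =>
      intro h
      have h1 : x ∈ D.GAR := weylSpan_le_GAR _ hx
      -- Complex homogeneity is a special case of compatibility with right multiplication by the
      -- Grassmann part.
      have h2 : (⟨r • x, h⟩ : D.GAR) = ⟨x, h1⟩ * D.incl (algebraMap ℂ D.Gr r) := by
        rw [AlgHom.commutes, ← Algebra.commutes, ← Algebra.smul_def]
        rfl
      rw [h2, hmul, ← hx' h1, hω]
    | mem x hx =>
      obtain ⟨ζ, X, -, rfl⟩ := hx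
      intro _
      change ω (D.weyl ζ * D.incl X) =
        D.integral v (q * D.fourier v (D.conv φ (D.weyl ζ * D.incl X)))
      rw [hmul, integral_fourier_conv_weyl hI he hq φ hN hc, hω]
      exact congrArg (· * X) (congrFun hdiv ζ)
  -- For general `A` the formula is known for `A` times each product of `N` odd generators, and
  -- these products can be cancelled from the difference.
  rw [← sub_eq_zero]
  refine Subtype.ext (D.eq_zero_of_mul_list_prod hinf (List.finRange N) (List.nodup_finRange N)
    (Subtype.property _) fun g => ?_)
  have hP : ((List.finRange N).map fun i => D.G (g i : H)).prod ∈ D.Gr := by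
    refine list_prod_mem fun z hz => ?_
    obtain ⟨k, -, rfl⟩ := List.mem_map.1 hz
    exact D.G_mem_Gr _
  have h1 : ω (A * D.incl ⟨_, hP⟩) =
      D.integral v (q * D.fourier v (D.conv φ (A * D.incl ⟨_, hP⟩))) := by
    refine hweyl _ ?_ (A * D.incl ⟨_, hP⟩).2
    rw [Subalgebra.coe_mul, coe_incl]
    exact mul_list_prod_mem_weylSpan he A.2 g
  rw [hω, hmul, ← sub_eq_zero, ← sub_mul] at h1
  have h2 := congrArg Subtype.val h1
  rw [Subalgebra.coe_mul] at h2
  exact h2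

end Triple

end GARAlgebra

/-! ### The division formula -/

open GARAlgebra GARAlgebra.Triple in
theorem mainTheorem5 {H : Type*} [NormedAddCommGroup H] [InnerProductSpace ℂ H] [CompleteSpace H]
    [TopologicalSpace.SeparableSpace H] (D : GARAlgebra.Triple H)
    (n : ℕ) (hfin : FiniteDimensional ℂ D.ran) (hrank : Module.finrank ℂ D.ran = 2 * n)
    (hinf : ¬ FiniteDimensional ℂ D.perp)
    (v : D.Forms) (hv : D.IsTopForm v) (hv_adj : D.IsSelfadjointForm v)
    (hv_norm : D.IsNormalizedForm v)
    (ω φ : D.RightModuleHom) (q : D.Fun) (hq : D.IsGHolomorphic q)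
    (hdiv : D.fourierHom ω = q * D.fourierHom φ) (A : D.GAR) :
    D.IsGHolomorphic (D.fourierHom ω) ∧ D.IsGHolomorphic (D.fourierHom φ) ∧
    (∀ ξ, D.IsGHolomorphic (D.fourierIntegrand (D.conv φ A) ξ)) ∧
    D.IsGHolomorphic (D.fourier v (D.conv φ A)) ∧
    D.IsGHolomorphic (q * D.fourier v (D.conv φ A)) ∧
    ω A = D.integral v (q * D.fourier v (D.conv φ A)) := by
  obtain ⟨e, he⟩ := D.exists_real_basis
  have hconv := D.isGHolomorphic_conv he φ A
  have main : D.IsGHolomorphic (D.fourier v (D.conv φ A)) ∧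
      ω A = D.integral v (q * D.fourier v (D.conv φ A)) := by
    -- The algebra consists of families indexed by representations, so without a representation it
    -- is the zero ring and everything is trivial. A representation is what makes the form `e¹ ∧ ⋯ ∧
    -- eᴺ` nonzero.
    rcases isEmpty_or_nonempty (CARRep D.JQ) with h | ⟨⟨π⟩⟩
    · have hs : Subsingleton D.Env := subsingleton_CAR h
      have hs' : Subsingleton D.Gr := ⟨fun x y => Subtype.ext (hs.elim _ _)⟩
      have h0 : D.fourier v (D.conv φ A) = 0 := Subsingleton.elim _ _
      rw [h0]
      exact ⟨D.isGHolomorphic_const 0, Subsingleton.elim _ _⟩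
    · obtain ⟨c, hc, hcc⟩ := D.exists_form_coefficient hinf π hrank hv_adj hv_norm he
      have hI : IntegralFormula v e c := fun F Y hF => integral_eq hinf π he hc hF
      have hN : Even (Module.finrank ℂ D.ran) := ⟨n, by rw [hrank, two_mul]⟩
      -- Here `c² = (-1)^n` meets `(-1)^(2n choose 2) = (-1)^n`.
      have hsign : c * c * (-1) ^ ((Module.finrank ℂ D.ran).choose 2) = 1 := by
        rw [hcc, hrank, neg_one_pow_choose_two, ← pow_add, Even.neg_one_pow ⟨n, rfl⟩]
      refine ⟨isGHolomorphic_fourier hI he hconv, ?_⟩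
      exact hom_eq_integral_fourier_conv hinf hI he hN hsign hq hdiv A
  exact ⟨D.isGHolomorphic_fourierHom he ω, D.isGHolomorphic_fourierHom he φ,
    isGHolomorphic_fourierIntegrand he hconv, main.1, hq.mul main.1, main.2⟩
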